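/- Let $\omega_1,\omega_2\in\mathbb C\setminus\{0\}$ be such that $\omega_2/\omega_1$ is purely imaginary with positive imaginary part, so that $\Omega=\{t\omega_1+s\omega_2:\ |t|<\tfrac12,\ |s|<\tfrac12\}$ is a rectangle, and let $\Lambda=\omega_1\mathbb Z+\omega_2\mathbb Z$. Let $G(z,p)=G(z-p,0)$ be the doubly-periodic Green function of $-\Delta$ in $\Omega$, that is, $-\Delta G(\cdot,p)=\delta_p-\frac1{|\Omega|}$ and $\int_\Omega G(z,p)\,dz=0$; such a function exists. Let $$\tilde p_1=\frac{\omega_1}{2},\qquad \tilde p_2=\frac{\omega_2}{2},\qquad \tilde p_3=\frac{\omega_1+\omega_2}{2},$$ and let $n,n_1,n_2,n_3\ge 0$ be even integers with $$\frac{n_1}{2}+\frac{n_2}{2}+\frac{n_3}{2}=\frac n2+1 .$$ For $\tau\in\Omega$ and points $p_j\in\tilde p_j+\tau+\Lambda$ ($j=1,2,3$) consider the vortex configuration consisting of $\tau$ with multiplicity $n$ and of $p_1,p_2,p_3$ with multiplicities $n_1,n_2,n_3$, and set $$u_0^\tau(z)=-4\pi n\,G(z,\tau)-4\pi\sum_{j=1}^3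 n_j\,G(z,p_j).$$ Then there is a meromorphic function $\mathcal H_0^\tau$ in $\Omega$, holomorphic outside the points congruent to a vortex point modulo $\Lambda$, with $|\mathcal H_0^\tau|^2=e^{u_0^\tau+8\pi(n+1)G(\cdot,\tau)}$ there. Every such $\mathcal H_0^\tau$ has a meromorphic antiderivative in $\Omega$, and for every choice of the antiderivative, with $\sigma_0^\tau(z)=-\big(\int^z\mathcal H_0^\tau(w)\,dw\big)^{-1}$, the quantity $$D_0^\tau=\frac1\pi\left[\int_{\Omega\setminus(\sigma_0^\tau)^{-1}(B_\rho(0))}e^{u_0^\tau+8\pi(n+1)G(z,\tau)}\,dz-\int_{\mathbb R^2\setminus B_\rho(0)}\frac{n+1}{|y|^4}\,dy\right]$$ is finite and independent of $\rho$ for all sufficiently small $\rho>0$; its value does not depend on $\tau$, on the $p_j$, on $\mathcal H_0^\tau$ or on the antiderivative. Moreover $$D_0^\tau<0\ \text{ if } \frac{n_3}{2}\text{ is odd},\qquad D_0^\tau>0\ \text{ if } \frac{n_3}{2}\text{ is even}.$$ -/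

import Mathlib

open Set Filter Topology MeasureTheory
open scoped ContDiff Pointwise

noncomputable section

/-- The open period cell `Ω = {t ω₁ + s ω₂ : (t, s) ∈ (-1/2, 1/2) × (-1/2, 1/2)}`. -/
def periodCell (ω₁ ω₂ : ℂ) : Set ℂ :=
  {z | ∃ t ∈ Ioo (-1 / 2 : ℝ) (1 / 2), ∃ s ∈ Ioo (-1 / 2 : ℝ) (1 / 2),
    z = (t : ℂ) * ω₁ + (s : ℂ) * ω₂}

/-- `z` and `w` are congruent modulo the lattice `ω₁ ℤ + ω₂ ℤ`. -/
def LatticeCongr (ω₁ ω₂ z w : ℂ) : Prop :=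
  ∃ k l : ℤ, z = w + (k : ℂ) * ω₁ + (l : ℂ) * ω₂

/-- `G` is the Green function `G(·, 0)` of `-Δ` on the flat torus with cell `Ω` and pole at `0`:
it is doubly periodic, `-Δ G = δ₀ - 1/|Ω|`, and it has zero mean over `Ω`.
The equation is expressed classically: in `2Ω` (which contains `closure Ω` and meets the lattice
only at `0`) one has `G(z) = -(1/2π) log |z| + H(z)` with `H` smooth and `Δ H = 1/|Ω|`.
The Green function with pole at `p` is `z ↦ G (z - p)`. -/
structure IsTorusGreen (ω₁ ω₂ : ℂ) (G : ℂ → ℝ) : Prop where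
  periodic₁ : ∀ z, G (z + ω₁) = G z
  periodic₂ : ∀ z, G (z + ω₂) = G z
  regularPart : ∃ H : ℂ → ℝ,
    ContDiffOn ℝ ∞ H ((2 : ℝ) • periodCell ω₁ ω₂) ∧
    (∀ z ∈ (2 : ℝ) • periodCell ω₁ ω₂,
      Laplacian.laplacian H z = 1 / volume.real (periodCell ω₁ ω₂)) ∧
    ∀ z ∈ (2 : ℝ) • periodCell ω₁ ω₂, z ≠ 0 →
      G z = -(1 / (2 * Real.pi)) * Real.log ‖z‖ + H z
  zeroMean : ∫ z in periodCell ω₁ ω₂, G z = 0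

/-- `u₀(z) = -4π n G(z, c) - 4π ∑ⱼ mⱼ G(z, pⱼ)`: the vortex `c` has multiplicity `n`, and the
remaining vortices `pⱼ` have multiplicities `mⱼ`. -/
def vortexU₀ {ι : Type*} [Fintype ι] (G : ℂ → ℝ) (c : ℂ) (n : ℕ) (p : ι → ℂ) (m : ι → ℕ)
    (z : ℂ) : ℝ :=
  -4 * Real.pi * (n * G (z - c)) - 4 * Real.pi * ∑ j, m j * G (z - p j)

/-- `exp (u₀(z) + 8π (n + 1) G(z, c))`. -/
def concPotential {ι : Type*} [Fintype ι] (G : ℂ → ℝ) (c : ℂ) (n : ℕ) (p : ι → ℂ) (m : ι → ℕ)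
    (z : ℂ) : ℝ :=
  Real.exp (vortexU₀ G c n p m z + 8 * Real.pi * (n + 1) * G (z - c))

/-- The cell `Ω` without the points of `{c} ∪ {pⱼ} + ω₁ ℤ + ω₂ ℤ`. -/
def puncturedCell {ι : Type*} (ω₁ ω₂ c : ℂ) (p : ι → ℂ) : Set ℂ :=
  {z ∈ periodCell ω₁ ω₂ | ¬ LatticeCongr ω₁ ω₂ z c ∧ ∀ j, ¬ LatticeCongr ω₁ ω₂ z (p j)}

/-- `H₀` is a meromorphic function in `Ω`, with `|H₀|² = exp (u₀ + 8π (n + 1) G(·, c))`.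
The values at the (isolated) vortex points are immaterial. -/
structure IsSqrtPotential {ι : Type*} [Fintype ι] (ω₁ ω₂ : ℂ) (G : ℂ → ℝ) (c : ℂ) (n : ℕ)
    (p : ι → ℂ) (m : ι → ℕ) (H₀ : ℂ → ℂ) : Prop where
  meromorphic : MeromorphicOn H₀ (periodCell ω₁ ω₂)
  differentiable : DifferentiableOn ℂ H₀ (puncturedCell ω₁ ω₂ c p)
  normSq_eq : ∀ z ∈ puncturedCell ω₁ ω₂ c p, ‖H₀ z‖ ^ 2 = concPotential G c n p m z

/-- `F` is a meromorphic antiderivative `∫^z H₀(w) dw` in `Ω`. -/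
structure IsMeroAntideriv {ι : Type*} (ω₁ ω₂ c : ℂ) (p : ι → ℂ) (H₀ F : ℂ → ℂ) : Prop where
  meromorphic : MeromorphicOn F (periodCell ω₁ ω₂)
  hasDerivAt : ∀ z ∈ puncturedCell ω₁ ω₂ c p, HasDerivAt F (H₀ z) z

/-- `σ₀ = -(∫^z H₀)⁻¹`, for the choice `F` of the antiderivative. -/
def sigmaZero (F : ℂ → ℂ) (z : ℂ) : ℂ := -(F z)⁻¹

/-- The domain of integration `Ω \ σ₀⁻¹(B_ρ(0))`. -/
def outerDomain (ω₁ ω₂ : ℂ) (F : ℂ → ℂ) (ρ : ℝ) : Set ℂ :=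
  periodCell ω₁ ω₂ \ sigmaZero F ⁻¹' Metric.ball 0 ρ

/-- `(1/π) [∫_{Ω \ σ₀⁻¹(B_ρ(0))} exp (u₀ + 8π (n + 1) G(z, c)) dz
  - ∫_{ℝ² \ B_ρ(0)} (n + 1) / |y|⁴ dy]`. -/
def coeffD₀ {ι : Type*} [Fintype ι] (ω₁ ω₂ : ℂ) (G : ℂ → ℝ) (c : ℂ) (n : ℕ)
    (p : ι → ℂ) (m : ι → ℕ) (F : ℂ → ℂ) (ρ : ℝ) : ℝ :=
  1 / Real.pi *
    ((∫ z in outerDomain ω₁ ω₂ F ρ, concPotential G c n p m z)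
      - ∫ y in (Metric.ball (0 : ℂ) ρ)ᶜ, ((n : ℝ) + 1) / ‖y‖ ^ 4)

/-- The three half-periods `ω₁/2`, `ω₂/2`, `(ω₁ + ω₂)/2`. -/
def halfPeriod (ω₁ ω₂ : ℂ) : Fin 3 → ℂ := ![ω₁ / 2, ω₂ / 2, (ω₁ + ω₂) / 2]

end

/-! In the coordinate `x = (z - τ) / ω₁` the lattice is `ℤ + i b ℤ`, and its Green function is, up
to a constant, `y ^ 2 / (2 b) - (1 / 2π) log |θ(x)|` with `y = Im x` and `θ` an odd theta function.
Periodicity and Liouville's theorem for harmonic functions show that there is no other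
(`IsTorusGreen.exists_eq_add_const`).

The balance condition says `-4πn + 8π(n + 1) = 4π(n₁ + n₂ + n₃)`, so with `nⱼ = 2 mⱼ` the potential
is the exponential of `8π ∑ mⱼ (G(z, τ) - G(z, pⱼ))`. Additive constants in `G` cancel, and the
result is `|C P(x)| ^ 2` with `P = ∏ hⱼ ^ mⱼ`, where `hⱼ` is the elliptic function with a double
pole at `0` and a double zero at the `j`-th half period, a multiple of `℘ - eⱼ`
(`exists_concPotential_eq`). Hence every square root of the potential is a constant of fixed modulus
times `P`.

`P` is even with a single pole, of order `n + 2`, modulo the lattice. Its residue vanishes, so it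
has a meromorphic antiderivative `A` with a pole of order `n + 1` and additive quasi-periods `E₁`,
`E₂`. Put `a = C ω₁ A`. The integral of the potential over the outer domain is the area, counted
with multiplicity, that `a` covers inside the disc of radius `1 / ρ`. By Green's formula this area
is the pole's contribution `π (n + 1) / ρ ^ 2` plus the area form of the two quasi-periods of `a`
(`IsQuasiPeriodicPole.integral_sublevel`). The first term is exactly the subtracted integral, so `D₀
= |C ω₁| ^ 2 Im(conj E₁ * E₂) / π`, unchanged by a unimodular factor or a constant of integration.

The sign is read off the edges of the rectangle (`exists_quasiPeriods`). Reality of `θ` makes every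
`hⱼ` nonpositive on the line `Im x = -b/2`; on `Re x = -1/2` the first two are nonpositive and the
third is nonnegative. So `E₁` is `(-1) ^ (m₁ + m₂ + m₃)` times a positive number, `E₂` is `i (-1) ^
(m₁ + m₂)` times a positive number, and `D₀` has the sign `(-1) ^ m₃`. -/

/-! ### The theta function of a rectangular lattice -/

/-- The infinite product `∏ (1 - q ^ k * w)` over `k ≥ 0`. -/
noncomputable def qProd (q : ℝ) (w : ℂ) : ℂ := ∏' k : ℕ, (1 + -((q : ℂ) ^ k * w))

section QProd

variable {q : ℝ}

lemma summable_norm_qProd (h0 : 0 < q) (h1 : q < 1) (w : ℂ) :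
    Summable fun k : ℕ => ‖-((q : ℂ) ^ k * w)‖ := by
  have : (fun k : ℕ => ‖-((q : ℂ) ^ k * w)‖) = fun k => q ^ k * ‖w‖ := by
    ext k; simp [abs_of_pos h0]
  rw [this]
  exact (summable_geometric_of_lt_one h0.le h1).mul_right _

lemma differentiable_qProd (h0 : 0 < q) (h1 : q < 1) : Differentiable ℂ (qProd q) := by
  intro w
  have hs : Summable fun k : ℕ => q ^ k * (‖w‖ + 1) :=
    (summable_geometric_of_lt_one h0.le h1).mul_right _
  have key := hs.hasProdLocallyUniformlyOn_nat_one_add (K := Metric.ball (0 : ℂ) (‖w‖ + 1))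
    (f := fun k w => -((q : ℂ) ^ k * w)) Metric.isOpen_ball
    (.of_forall fun k x hx => by
      have hx' : ‖x‖ < ‖w‖ + 1 := by simpa using hx
      simp only [norm_neg, norm_mul, norm_pow, Complex.norm_real, Real.norm_eq_abs, abs_of_pos h0]
      gcongr)
    (fun k => by fun_prop)
  have := key.differentiableOn (.of_forall fun s => by
    simpa [Finset.prod_fn] using DifferentiableOn.finsetProd (fun _ _ => by fun_prop))
    Metric.isOpen_ball
  exact this.differentiableAt (Metric.isOpen_ball.mem_nhds (by simp))

/-- Splitting off the factor `k = 0` and reindexing. This functional equation lies behind the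
transformation laws of `thetaOdd`. -/
lemma qProd_eq (h0 : 0 < q) (h1 : q < 1) (w : ℂ) : qProd q w = (1 - w) * qProd q (q * w) := by
  have hm : Multipliable fun k : ℕ => (1 + -((q : ℂ) ^ (k + 1) * w)) := by
    have := multipliable_one_add_of_summable (summable_norm_qProd h0 h1 (q * w))
    refine this.congr fun k => ?_
    ring
  have := tprod_eq_zero_mul' (f := fun k : ℕ => (1 + -((q : ℂ) ^ k * w))) hm
  rw [qProd, this, qProd]
  congr 1
  · simp [sub_eq_add_neg]
  · refine tprod_congr fun k => ?_
    ring

lemma qProd_ne_zero (h0 : 0 < q) (h1 : q < 1) {w : ℂ} (h : ∀ k : ℕ, (q : ℂ) ^ k * w ≠ 1) :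
    qProd q w ≠ 0 :=
  tprod_one_add_ne_zero_of_summable
    (fun k hk => h k (by rw [← sub_eq_add_neg, sub_eq_zero] at hk; exact hk.symm))
    (summable_norm_qProd h0 h1 w)

lemma conj_qProd (h0 : 0 < q) (h1 : q < 1) (w : ℂ) :
    (starRingEnd ℂ) (qProd q w) = qProd q ((starRingEnd ℂ) w) := by
  have hm := multipliable_one_add_of_summable (summable_norm_qProd h0 h1 w)
  have := hm.map_tprod (starRingEnd ℂ) Complex.continuous_conj
  rw [qProd, this, qProd]
  refine tprod_congr fun k => ?_
  simp

lemma qProd_eq_zero_of (h0 : 0 < q) (h1 : q < 1) {w : ℂ} {k : ℕ} (h : (q : ℂ) ^ k * w = 1) :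
    qProd q w = 0 := by
  induction k generalizing w with
  | zero => rw [qProd_eq h0 h1, show w = 1 by simpa using h]; simp
  | succ k ih => rw [qProd_eq h0 h1, ih (w := q * w) (by rw [← h]; ring), mul_zero]

end QProd

/-- The nome `exp (-2πb)` of the lattice `ℤ + i b ℤ`. -/
noncomputable def nome (b : ℝ) : ℝ := Real.exp (-2 * Real.pi * b)

/-- `exp (2πix)`. -/
noncomputable def expTwoPiI (x : ℂ) : ℂ := Complex.exp (2 * Real.pi * Complex.I * x)

/-- An odd theta function of the lattice `ℤ + i b ℤ`, in product form. -/
noncomputable def thetaOdd (b : ℝ) (x : ℂ) : ℂ :=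
  Complex.I * Complex.exp (-(Real.pi * Complex.I * x)) * qProd (nome b) (expTwoPiI x) *
    qProd (nome b) (nome b * expTwoPiI (-x))

section ThetaOdd

variable {b : ℝ}

lemma nome_pos : 0 < nome b := Real.exp_pos _

lemma nome_lt_one (hb : 0 < b) : nome b < 1 := by
  rw [nome, Real.exp_lt_one_iff]
  have := Real.pi_pos
  nlinarith [mul_pos this hb]

lemma expTwoPiI_ne_zero (x : ℂ) : expTwoPiI x ≠ 0 := Complex.exp_ne_zero _

lemma expTwoPiI_neg (x : ℂ) : expTwoPiI (-x) = (expTwoPiI x)⁻¹ := by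
  rw [expTwoPiI, expTwoPiI, ← Complex.exp_neg]; congr 1; ring

lemma expTwoPiI_add (x y : ℂ) : expTwoPiI (x + y) = expTwoPiI x * expTwoPiI y := by
  rw [expTwoPiI, expTwoPiI, expTwoPiI, ← Complex.exp_add]; congr 1; ring

lemma expTwoPiI_one : expTwoPiI 1 = 1 := by
  rw [expTwoPiI, mul_one, Complex.exp_two_pi_mul_I]

lemma expTwoPiI_I_mul : expTwoPiI (b * Complex.I) = nome b := by
  rw [expTwoPiI, nome, Complex.ofReal_exp]
  congr 1
  push_cast
  linear_combination (2 * Real.pi * b : ℂ) * Complex.I_mul_I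

@[fun_prop]
lemma differentiable_expTwoPiI : Differentiable ℂ expTwoPiI := by
  unfold expTwoPiI; fun_prop

lemma differentiable_thetaOdd (hb : 0 < b) : Differentiable ℂ (thetaOdd b) := by
  have h := differentiable_qProd nome_pos (nome_lt_one hb)
  unfold thetaOdd
  have h1 : Differentiable ℂ fun x => qProd (nome b) (expTwoPiI x) := h.comp (by fun_prop)
  have h2 : Differentiable ℂ fun x => qProd (nome b) (nome b * expTwoPiI (-x)) :=
    h.comp (by fun_prop)
  fun_prop

/-- Both `x ↦ -x` and `x ↦ x + b i` turn the pair of products in `thetaOdd` into the left side.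
Passing to the right side moves one linear factor from one product to the other. -/
lemma qProd_mul_shift (hb : 0 < b) {w : ℂ} (hw : w ≠ 0) :
    qProd (nome b) (nome b * w) * qProd (nome b) w⁻¹ =
      -w⁻¹ * (qProd (nome b) w * qProd (nome b) (nome b * w⁻¹)) := by
  rw [qProd_eq nome_pos (nome_lt_one hb) w, qProd_eq nome_pos (nome_lt_one hb) w⁻¹]
  field_simp
  ring

lemma thetaOdd_neg (hb : 0 < b) (x : ℂ) : thetaOdd b (-x) = -thetaOdd b x := by
  have h := qProd_mul_shift hb (expTwoPiI_ne_zero x)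
  rw [← expTwoPiI_neg] at h
  have hE : Complex.exp (-(Real.pi * Complex.I * -x)) * expTwoPiI (-x) =
      Complex.exp (-(Real.pi * Complex.I * x)) := by
    rw [expTwoPiI, ← Complex.exp_add]; congr 1; ring
  rw [thetaOdd, thetaOdd, neg_neg]
  linear_combination (Complex.I * Complex.exp (-(Real.pi * Complex.I * -x))) * h -
    Complex.I * (qProd (nome b) (expTwoPiI x) * qProd (nome b) (nome b * expTwoPiI (-x))) * hE

lemma thetaOdd_add_one (x : ℂ) : thetaOdd b (x + 1) = -thetaOdd b x := by
  have h1 : expTwoPiI (x + 1) = expTwoPiI x := by rw [expTwoPiI_add, expTwoPiI_one, mul_one]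
  have h2 : expTwoPiI (-(x + 1)) = expTwoPiI (-x) := by rw [expTwoPiI_neg, h1, expTwoPiI_neg]
  have h3 : Complex.exp (-(Real.pi * Complex.I * (x + 1))) =
      -Complex.exp (-(Real.pi * Complex.I * x)) := by
    rw [mul_add, neg_add, Complex.exp_add, mul_one, Complex.exp_neg (_ * _),
      Complex.exp_neg, Complex.exp_pi_mul_I]
    norm_num
  rw [thetaOdd, h1, h2, h3, thetaOdd]
  ring

lemma thetaOdd_add_I_mul (hb : 0 < b) (x : ℂ) :
    thetaOdd b (x + b * Complex.I) =
      -(Complex.exp (Real.pi * b) * expTwoPiI (-x)) * thetaOdd b x := by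
  have h := qProd_mul_shift hb (expTwoPiI_ne_zero x)
  rw [← expTwoPiI_neg] at h
  have h1 : expTwoPiI (x + b * Complex.I) = nome b * expTwoPiI x := by
    rw [expTwoPiI_add, expTwoPiI_I_mul, mul_comm]
  have hn : (nome b : ℂ) ≠ 0 := by exact_mod_cast nome_pos.ne'
  have h2 : (nome b : ℂ) * expTwoPiI (-(x + b * Complex.I)) = expTwoPiI (-x) := by
    rw [expTwoPiI_neg, h1, expTwoPiI_neg]
    field_simp
  have h3 : Complex.exp (-(Real.pi * Complex.I * (x + b * Complex.I))) =
      Complex.exp (Real.pi * b) * Complex.exp (-(Real.pi * Complex.I * x)) := by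
    rw [← Complex.exp_add]; congr 1
    linear_combination (-Real.pi * b : ℂ) * Complex.I_mul_I
  rw [thetaOdd, h1, h2, h3, thetaOdd]
  linear_combination (Complex.I * Complex.exp (Real.pi * b) *
    Complex.exp (-(Real.pi * Complex.I * x))) * h

lemma conj_expTwoPiI (x : ℂ) :
    (starRingEnd ℂ) (expTwoPiI x) = expTwoPiI (-(starRingEnd ℂ) x) := by
  rw [expTwoPiI, expTwoPiI, ← Complex.exp_conj]
  congr 1
  simp [Complex.conj_ofNat]

/-- The nome is real and conjugation inverts the exponential, so the product form yields `-θ(-conj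
x)`; oddness finishes. The factor `I` in `thetaOdd` is there to give this reality, from which all
later signs come. -/
lemma conj_thetaOdd (hb : 0 < b) (x : ℂ) :
    (starRingEnd ℂ) (thetaOdd b x) = thetaOdd b ((starRingEnd ℂ) x) := by
  have h : (starRingEnd ℂ) (thetaOdd b x) = -thetaOdd b (-(starRingEnd ℂ) x) := by
    rw [thetaOdd, thetaOdd]
    simp only [map_mul, conj_qProd nome_pos (nome_lt_one hb), conj_expTwoPiI, map_neg,
      Complex.conj_I, Complex.conj_ofReal, ← Complex.exp_conj]
    simp
  rw [h, thetaOdd_neg hb, neg_neg]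

lemma expTwoPiI_eq_one_iff (x : ℂ) : expTwoPiI x = 1 ↔ ∃ k : ℤ, x = k := by
  rw [expTwoPiI, Complex.exp_eq_one_iff]
  have : (2 * Real.pi * Complex.I : ℂ) ≠ 0 := Complex.two_pi_I_ne_zero
  refine exists_congr fun k => ?_
  rw [mul_comm, mul_left_inj' this]

lemma nome_pow_mul_expTwoPiI (k : ℕ) (x : ℂ) :
    (nome b : ℂ) ^ k * expTwoPiI x = expTwoPiI (x + k * (b * Complex.I)) := by
  induction k with
  | zero => simp
  | succ k ih =>
    rw [pow_succ, mul_right_comm, ih, ← expTwoPiI_I_mul, ← expTwoPiI_add]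
    push_cast
    congr 1; ring

/-- The first product vanishes on the lattice rows `l ≤ 0`, the second on the rows `l ≥ 1`. -/
lemma thetaOdd_eq_zero_iff (hb : 0 < b) (x : ℂ) :
    thetaOdd b x = 0 ↔ ∃ k l : ℤ, x = k + l * (b * Complex.I) := by
  constructor
  · intro h
    by_contra hcon
    push Not at hcon
    have h1 : qProd (nome b) (expTwoPiI x) ≠ 0 :=
      qProd_ne_zero nome_pos (nome_lt_one hb) fun k hk => by
        rw [nome_pow_mul_expTwoPiI, expTwoPiI_eq_one_iff] at hk
        obtain ⟨m, hm⟩ := hk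
        apply hcon m (-k)
        push_cast
        linear_combination hm
    have h2 : qProd (nome b) (nome b * expTwoPiI (-x)) ≠ 0 :=
      qProd_ne_zero nome_pos (nome_lt_one hb) fun k hk => by
        rw [← mul_assoc, ← pow_succ, nome_pow_mul_expTwoPiI, expTwoPiI_eq_one_iff] at hk
        obtain ⟨m, hm⟩ := hk
        apply hcon (-m) (k + 1)
        push_cast at hm ⊢
        linear_combination -hm
    exact mul_ne_zero (mul_ne_zero (mul_ne_zero Complex.I_ne_zero (Complex.exp_ne_zero _)) h1) h2 h
  · rintro ⟨k, l, hx⟩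
    rcases le_or_gt l 0 with hl | hl
    · obtain ⟨m, rfl⟩ := Int.exists_eq_neg_ofNat hl
      rw [thetaOdd, qProd_eq_zero_of (k := m) nome_pos (nome_lt_one hb), mul_zero, zero_mul]
      rw [nome_pow_mul_expTwoPiI, expTwoPiI_eq_one_iff]
      exact ⟨k, by rw [hx]; push_cast; ring⟩
    · obtain ⟨m, rfl⟩ := Int.eq_succ_of_zero_lt hl
      rw [thetaOdd, qProd_eq_zero_of (k := m) (w := nome b * _) nome_pos (nome_lt_one hb), mul_zero]
      rw [← mul_assoc, ← pow_succ, nome_pow_mul_expTwoPiI, expTwoPiI_eq_one_iff]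
      exact ⟨-k, by rw [hx]; push_cast; ring⟩

lemma thetaOdd_zero (hb : 0 < b) : thetaOdd b 0 = 0 :=
  (thetaOdd_eq_zero_iff hb 0).2 ⟨0, 0, by simp⟩

/-- Only the factor `1 - expTwoPiI x` vanishes at the origin, and it does so simply. Simplicity
makes `thetaQuot` nonvanishing, and so gives the Green function its exact logarithmic singularity.
-/
lemma deriv_thetaOdd_zero_ne_zero (hb : 0 < b) : deriv (thetaOdd b) 0 ≠ 0 := by
  have hq := nome_lt_one hb
  have hr := differentiable_qProd (nome_pos (b := b)) hq
  have h1 : ∀ x, thetaOdd b x = (1 - expTwoPiI x) * (Complex.I *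
      Complex.exp (-(Real.pi * Complex.I * x)) * qProd (nome b) (nome b * expTwoPiI x) *
      qProd (nome b) (nome b * expTwoPiI (-x))) := fun x => by
    rw [thetaOdd, qProd_eq nome_pos hq (expTwoPiI x)]; ring
  have hg : Differentiable ℂ fun x => (Complex.I *
      Complex.exp (-(Real.pi * Complex.I * x)) * qProd (nome b) (nome b * expTwoPiI x) *
      qProd (nome b) (nome b * expTwoPiI (-x))) := by
    have h1 : Differentiable ℂ fun x => qProd (nome b) (nome b * expTwoPiI x) :=
      hr.comp (by fun_prop)
    have h2 : Differentiable ℂ fun x => qProd (nome b) (nome b * expTwoPiI (-x)) :=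
      hr.comp (by fun_prop)
    fun_prop
  have he : HasDerivAt expTwoPiI (2 * Real.pi * Complex.I) 0 := by
    have := ((hasDerivAt_id (0 : ℂ)).const_mul (2 * Real.pi * Complex.I : ℂ)).cexp
    rw [show expTwoPiI = fun x => Complex.exp (2 * Real.pi * Complex.I * x) from rfl]
    simpa using this
  have h0 : expTwoPiI 0 = 1 := by simp [expTwoPiI]
  have hd := (he.const_sub 1).mul (hg 0).hasDerivAt
  rw [funext h1]
  erw [hd.deriv]
  have hne : qProd (nome b) (nome b) ≠ 0 :=
    qProd_ne_zero nome_pos hq fun k hk => by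
      have : nome b ^ (k + 1) = 1 := by rw [pow_succ]; exact_mod_cast hk
      exact (pow_lt_one₀ nome_pos.le hq (Nat.succ_ne_zero k)).ne this
  simp [h0, hne, Real.pi_ne_zero]

end ThetaOdd

/-! ### Rectangles and period cells -/

section Rectangles

variable {b : ℝ} {ω₁ ω₂ : ℂ}

/-- The period cell of `ℤ + i b ℤ`. -/
def cellRect (b : ℝ) : Set ℂ := Ioo (-(1 / 2)) (1 / 2) ×ℂ Ioo (-(b / 2)) (b / 2)

/-- The closed period cell of `ℤ + i b ℤ`. -/
def closedRect (b : ℝ) : Set ℂ := Icc (-(1 / 2)) (1 / 2) ×ℂ Icc (-(b / 2)) (b / 2)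

/-- The doubled period cell of `ℤ + i b ℤ`. -/
def doubleRect (b : ℝ) : Set ℂ := Ioo (-1) 1 ×ℂ Ioo (-b) b

lemma mem_cellRect {x : ℂ} : x ∈ cellRect b ↔
    (-(1 / 2) < x.re ∧ x.re < 1 / 2) ∧ -(b / 2) < x.im ∧ x.im < b / 2 := Iff.rfl

lemma mem_closedRect {x : ℂ} : x ∈ closedRect b ↔
    (-(1 / 2) ≤ x.re ∧ x.re ≤ 1 / 2) ∧ -(b / 2) ≤ x.im ∧ x.im ≤ b / 2 := Iff.rfl

lemma mem_doubleRect {x : ℂ} : x ∈ doubleRect b ↔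
    (-1 < x.re ∧ x.re < 1) ∧ -b < x.im ∧ x.im < b := Iff.rfl

lemma isOpen_cellRect : IsOpen (cellRect b) := isOpen_Ioo.reProdIm isOpen_Ioo

lemma isOpen_doubleRect : IsOpen (doubleRect b) := isOpen_Ioo.reProdIm isOpen_Ioo

lemma isCompact_closedRect : IsCompact (closedRect b) := isCompact_Icc.reProdIm isCompact_Icc

lemma convex_reProdIm {s t : Set ℝ} (hs : Convex ℝ s) (ht : Convex ℝ t) :
    Convex ℝ (s ×ℂ t) :=
  (hs.is_linear_preimage Complex.reLm.isLinear).inter (ht.is_linear_preimage Complex.imLm.isLinear)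

lemma convex_cellRect : Convex ℝ (cellRect b) := convex_reProdIm (convex_Ioo _ _) (convex_Ioo _ _)

lemma convex_doubleRect : Convex ℝ (doubleRect b) :=
  convex_reProdIm (convex_Ioo _ _) (convex_Ioo _ _)

lemma cellRect_subset_closedRect : cellRect b ⊆ closedRect b := fun _ hx =>
  ⟨Ioo_subset_Icc_self hx.1, Ioo_subset_Icc_self hx.2⟩

lemma closedRect_subset_doubleRect (hb : 0 < b) : closedRect b ⊆ doubleRect b := by
  intro x hx
  rw [mem_closedRect] at hx
  rw [mem_doubleRect]
  refine ⟨⟨?_, ?_⟩, ?_, ?_⟩ <;> linarith [hx.1.1, hx.1.2, hx.2.1, hx.2.2]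

lemma zero_mem_doubleRect (hb : 0 < b) : (0 : ℂ) ∈ doubleRect b := by
  simp [mem_doubleRect, hb]

/-- This is the purpose of the doubled rectangle: after moving the pole from `t` to the origin, the
closed cell stays in an open convex set whose only lattice point is `0`. -/
lemma sub_mem_doubleRect {x t : ℂ} (hx : x ∈ closedRect b) (ht : t ∈ cellRect b) :
    x - t ∈ doubleRect b := by
  rw [mem_closedRect] at hx
  rw [mem_cellRect] at ht
  rw [mem_doubleRect, Complex.sub_re, Complex.sub_im]
  refine ⟨⟨?_, ?_⟩, ?_, ?_⟩ <;>
    linarith [hx.1.1, hx.1.2, hx.2.1, hx.2.2, ht.1.1, ht.1.2, ht.2.1, ht.2.2]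

lemma volume_cellRect : volume (cellRect b) = ENNReal.ofReal b := by
  have : cellRect b = Complex.measurableEquivRealProd ⁻¹'
      (Ioo (-(1 / 2)) (1 / 2) ×ˢ Ioo (-(b / 2)) (b / 2)) := rfl
  rw [this, Complex.volume_preserving_equiv_real_prod.measure_preimage_equiv,
    Measure.volume_eq_prod, Measure.prod_prod, Real.volume_Ioo, Real.volume_Ioo]
  norm_num

lemma volume_closedRect_sdiff : volume (closedRect b \ cellRect b) = 0 := by
  have : closedRect b \ cellRect b = Complex.measurableEquivRealProd ⁻¹'
      (Icc (-(1 / 2)) (1 / 2) ×ˢ Icc (-(b / 2)) (b / 2) \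
        Ioo (-(1 / 2)) (1 / 2) ×ˢ Ioo (-(b / 2)) (b / 2)) := rfl
  rw [this, Complex.volume_preserving_equiv_real_prod.measure_preimage_equiv,
    Measure.volume_eq_prod, ← ae_le_set]
  exact (Measure.set_prod_ae_eq Ioo_ae_eq_Icc Ioo_ae_eq_Icc).symm.le

lemma periodCell_eq_image (hω : ω₂ = ω₁ * (b * Complex.I)) (hb : 0 < b) :
    periodCell ω₁ ω₂ = (fun x => ω₁ * x) '' cellRect b := by
  ext z
  constructor
  · rintro ⟨t, ht, s, hs, rfl⟩
    refine ⟨t + s * b * Complex.I, ?_, by rw [hω]; ring⟩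
    rw [mem_cellRect]
    simp only [mem_Ioo] at ht hs
    simp only [Complex.add_re, Complex.ofReal_re, Complex.mul_re, Complex.ofReal_im,
      Complex.I_re, Complex.I_im, Complex.add_im, Complex.mul_im]
    refine ⟨⟨?_, ?_⟩, ?_, ?_⟩ <;> nlinarith
  · rintro ⟨x, hx, rfl⟩
    rw [mem_cellRect] at hx
    refine ⟨x.re, ⟨by linarith [hx.1.1], by linarith [hx.1.2]⟩, x.im / b, ⟨?_, ?_⟩, ?_⟩
    · rw [lt_div_iff₀ hb]; linarith [hx.2.1]
    · rw [div_lt_iff₀ hb]; linarith [hx.2.2]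
    · have : (b : ℂ) ≠ 0 := by exact_mod_cast hb.ne'
      rw [hω]
      nth_rewrite 1 [← Complex.re_add_im x]
      push_cast
      field_simp

lemma mul_mem_periodCell (h1 : ω₁ ≠ 0) (hω : ω₂ = ω₁ * (b * Complex.I)) (hb : 0 < b) {x : ℂ} :
    ω₁ * x ∈ periodCell ω₁ ω₂ ↔ x ∈ cellRect b := by
  rw [periodCell_eq_image hω hb]
  exact (mul_right_injective₀ h1).mem_set_image

lemma mem_periodCell (h1 : ω₁ ≠ 0) (hω : ω₂ = ω₁ * (b * Complex.I)) (hb : 0 < b) {z : ℂ} :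
    z ∈ periodCell ω₁ ω₂ ↔ z / ω₁ ∈ cellRect b := by
  rw [← mul_mem_periodCell h1 hω hb, mul_div_cancel₀ _ h1]

lemma mem_two_smul_periodCell (h1 : ω₁ ≠ 0) (hω : ω₂ = ω₁ * (b * Complex.I)) (hb : 0 < b) {z : ℂ} :
    z ∈ (2 : ℝ) • periodCell ω₁ ω₂ ↔ z / ω₁ ∈ doubleRect b := by
  rw [mem_smul_set_iff_inv_smul_mem₀ two_ne_zero, mem_periodCell h1 hω hb, mem_cellRect,
    mem_doubleRect]
  have : (2 : ℝ)⁻¹ • z / ω₁ = (2 : ℝ)⁻¹ • (z / ω₁) := by rw [smul_div_assoc]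
  rw [this, Complex.smul_re, Complex.smul_im, smul_eq_mul, smul_eq_mul]
  constructor
  · rintro ⟨⟨h1, h2⟩, h3, h4⟩
    refine ⟨⟨?_, ?_⟩, ?_, ?_⟩ <;> linarith
  · rintro ⟨⟨h1, h2⟩, h3, h4⟩
    refine ⟨⟨?_, ?_⟩, ?_, ?_⟩ <;> linarith

lemma isOpen_periodCell (h1 : ω₁ ≠ 0) (hω : ω₂ = ω₁ * (b * Complex.I)) (hb : 0 < b) :
    IsOpen (periodCell ω₁ ω₂) := by
  have : periodCell ω₁ ω₂ = (fun z => z / ω₁) ⁻¹' cellRect b :=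
    ext fun z => mem_periodCell h1 hω hb
  rw [this]
  exact isOpen_cellRect.preimage (by fun_prop)

/-- Multiplication by a complex number, as a real-linear map. -/
noncomputable def mulRealCLM (c : ℂ) : ℂ →L[ℝ] ℂ := ContinuousLinearMap.mul ℝ ℂ c

lemma det_mulRealCLM (c : ℂ) : (mulRealCLM c).det = ‖c‖ ^ 2 := by
  rw [← Complex.normSq_eq_norm_sq, ← Algebra.norm_complex_apply, Algebra.norm_apply]
  rfl

lemma volume_real_periodCell (hω : ω₂ = ω₁ * (b * Complex.I)) (hb : 0 < b) :
    volume.real (periodCell ω₁ ω₂) = ‖ω₁‖ ^ 2 * b := by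
  rw [periodCell_eq_image hω hb, Measure.real]
  have h : volume ((fun x => ω₁ * x) '' cellRect b) =
      ENNReal.ofReal |(mulRealCLM ω₁).det| * volume (cellRect b) :=
    Measure.addHaar_image_continuousLinearMap volume (mulRealCLM ω₁) (cellRect b)
  rw [h, volume_cellRect, det_mulRealCLM, ENNReal.toReal_mul, ENNReal.toReal_ofReal (abs_nonneg _),
    ENNReal.toReal_ofReal hb.le, abs_of_nonneg (by positivity)]

lemma setIntegral_mul_image (h1 : ω₁ ≠ 0) {s : Set ℂ} (hs : MeasurableSet s) (f : ℂ → ℝ) :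
    ∫ z in (fun x => ω₁ * x) '' s, f z = ‖ω₁‖ ^ 2 * ∫ x in s, f (ω₁ * x) := by
  have := integral_image_eq_integral_abs_det_fderiv_smul volume hs (f := fun x => ω₁ * x)
    (f' := fun _ => mulRealCLM ω₁)
    (fun x _ => (mulRealCLM ω₁).hasFDerivAt.hasFDerivWithinAt) (mul_right_injective₀ h1).injOn f
  rw [this]
  simp_rw [det_mulRealCLM, abs_of_nonneg (sq_nonneg ‖ω₁‖), smul_eq_mul]
  rw [integral_const_mul]

lemma integrableOn_mul_image (h1 : ω₁ ≠ 0) {s : Set ℂ} (hs : MeasurableSet s) (f : ℂ → ℝ) :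
    IntegrableOn f ((fun x => ω₁ * x) '' s) ↔ IntegrableOn (fun x => f (ω₁ * x)) s := by
  have := integrableOn_image_iff_integrableOn_abs_det_fderiv_smul volume hs (f := fun x => ω₁ * x)
    (f' := fun _ => mulRealCLM ω₁)
    (fun x _ => (mulRealCLM ω₁).hasFDerivAt.hasFDerivWithinAt) (mul_right_injective₀ h1).injOn f
  rw [this]
  simp_rw [det_mulRealCLM, abs_of_nonneg (sq_nonneg ‖ω₁‖)]
  have hne : ‖ω₁‖ ^ 2 ≠ 0 := by positivity
  exact integrable_smul_iff hne _

lemma thetaOdd_eq_zero_iff_of_mem_doubleRect (hb : 0 < b) {x : ℂ} (hx : x ∈ doubleRect b) :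
    thetaOdd b x = 0 ↔ x = 0 := by
  rw [thetaOdd_eq_zero_iff hb]
  constructor
  · rintro ⟨k, l, rfl⟩
    rw [mem_doubleRect] at hx
    simp only [Complex.add_re, Complex.intCast_re, Complex.mul_re, Complex.intCast_im,
      Complex.ofReal_re, Complex.ofReal_im, Complex.I_re, Complex.I_im, Complex.add_im,
      Complex.mul_im, mul_zero, mul_one, zero_mul, sub_zero, zero_add, add_zero] at hx
    obtain ⟨⟨h1, h2⟩, h3, h4⟩ := hx
    have hk : k = 0 := by
      have : (-1 : ℤ) < k := by exact_mod_cast h1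
      have : k < 1 := by exact_mod_cast h2
      omega
    have hl : l = 0 := by
      have : (-1 : ℤ) < l := by
        have : (-1 : ℝ) < l := by nlinarith
        exact_mod_cast this
      have : l < 1 := by
        have : (l : ℝ) < 1 := by nlinarith
        exact_mod_cast this
      omega
    simp [hk, hl]
  · rintro rfl
    exact ⟨0, 0, by simp⟩

end Rectangles

/-! ### The Green function of a rectangular torus -/

section Green

variable {b : ℝ} {ω₁ ω₂ : ℂ}

/-- The quotient `θ(x) / x`, extended to `0`. -/
noncomputable def thetaQuot (b : ℝ) : ℂ → ℂ := dslope (thetaOdd b) 0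

lemma differentiable_thetaQuot (hb : 0 < b) : Differentiable ℂ (thetaQuot b) := by
  rw [← differentiableOn_univ]
  exact (Complex.differentiableOn_dslope univ_mem).2 (differentiable_thetaOdd hb).differentiableOn

lemma thetaOdd_eq_mul_thetaQuot (hb : 0 < b) (x : ℂ) : thetaOdd b x = x * thetaQuot b x := by
  have := sub_smul_dslope (thetaOdd b) 0 x
  rw [thetaOdd_zero hb, sub_zero, sub_zero, smul_eq_mul] at this
  exact this.symm

lemma thetaQuot_ne_zero (hb : 0 < b) {x : ℂ} (hx : x ∈ doubleRect b) : thetaQuot b x ≠ 0 := by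
  rcases eq_or_ne x 0 with rfl | h0
  · rw [thetaQuot, dslope_same]
    exact deriv_thetaOdd_zero_ne_zero hb
  · intro h
    apply h0
    rw [← thetaOdd_eq_zero_iff_of_mem_doubleRect hb hx, thetaOdd_eq_mul_thetaQuot hb, h, mul_zero]

open Classical in
/-- The Green function of `ℤ + i b ℤ`, up to a constant, and set to `0` at the lattice points. -/
noncomputable def thetaGreen (b : ℝ) (x : ℂ) : ℝ :=
  if thetaOdd b x = 0 then 0 else
    x.im ^ 2 / (2 * b) - 1 / (2 * Real.pi) * Real.log ‖thetaOdd b x‖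

lemma thetaGreen_add_one (x : ℂ) : thetaGreen b (x + 1) = thetaGreen b x := by
  simp [thetaGreen, thetaOdd_add_one]

lemma norm_expTwoPiI (x : ℂ) : ‖expTwoPiI x‖ = Real.exp (-2 * Real.pi * x.im) := by
  rw [expTwoPiI, Complex.norm_exp]
  simp

/-- The increment of the quadratic term compensates the modulus of the multiplier of `thetaOdd`. -/
lemma thetaGreen_add_I_mul (hb : 0 < b) (x : ℂ) :
    thetaGreen b (x + b * Complex.I) = thetaGreen b x := by
  have him : (x + b * Complex.I).im = x.im + b := by simp
  have hx : x.im ^ 2 / (2 * b) + (x.im + b / 2) = (x.im + b) ^ 2 / (2 * b) := by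
    field_simp; ring
  have he : -(Complex.exp (Real.pi * b) * expTwoPiI (-x)) ≠ 0 :=
    neg_ne_zero.2 (mul_ne_zero (Complex.exp_ne_zero _) (expTwoPiI_ne_zero _))
  rcases eq_or_ne (thetaOdd b x) 0 with h0 | h0
  · rw [thetaGreen, thetaGreen, if_pos h0, if_pos (by rw [thetaOdd_add_I_mul hb, h0, mul_zero])]
  · rw [thetaGreen, thetaGreen, if_neg h0,
      if_neg (by rw [thetaOdd_add_I_mul hb]; exact mul_ne_zero he h0), him, thetaOdd_add_I_mul hb,
      norm_mul, norm_neg, norm_mul,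
      norm_expTwoPiI, Complex.norm_exp, Real.log_mul (by positivity) (by simpa using h0),
      ← Real.exp_add, Real.log_exp, ← hx]
    have := Real.pi_pos
    simp
    field_simp
    ring

/-- The regular part of the Green function of `ω₁ (ℤ + i b ℤ)`, up to a constant. -/
noncomputable def greenRegular (b : ℝ) (ω₁ : ℂ) (z : ℂ) : ℝ :=
  1 / (2 * b) * (z / ω₁).im ^ 2 -
    1 / (2 * Real.pi) * (Real.log ‖thetaQuot b (z / ω₁)‖ - Real.log ‖ω₁‖)

lemma thetaGreen_div_eq (h1 : ω₁ ≠ 0) (hb : 0 < b) {z : ℂ} (hz : z / ω₁ ∈ doubleRect b)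
    (h0 : z ≠ 0) :
    thetaGreen b (z / ω₁) = -(1 / (2 * Real.pi)) * Real.log ‖z‖ + greenRegular b ω₁ z := by
  have hx : z / ω₁ ≠ 0 := div_ne_zero h0 h1
  have hq := thetaQuot_ne_zero hb hz
  rw [thetaGreen, if_neg (fun h => hx ((thetaOdd_eq_zero_iff_of_mem_doubleRect hb hz).1 h)),
    thetaOdd_eq_mul_thetaQuot hb, greenRegular, norm_mul, norm_div,
    Real.log_mul (div_ne_zero (by simpa) (by simpa)) (by simpa),
    Real.log_div (by simpa) (by simpa)]
  ring

open InnerProductSpace in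
lemma laplacian_sq_of_continuousLinear (l : ℂ →L[ℝ] ℝ) (z : ℂ) :
    Laplacian.laplacian (fun w => l w ^ 2) z = 2 * (l 1 ^ 2 + l Complex.I ^ 2) := by
  have h : fderiv ℝ (fun w => l w ^ 2) = fun w => (2 * l w) • l := by
    ext1 w
    have := (l.hasFDerivAt (x := w)).pow 2
    simpa using this.fderiv
  have h2 : fderiv ℝ (fun w => (2 * l w) • l) z = ((2 : ℝ) • l).smulRight l :=
    ((2 : ℝ) • l).smulRight l |>.hasFDerivAt.fderiv
  rw [laplacian_eq_iteratedFDeriv_complexPlane]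
  simp only [iteratedFDeriv_two_apply, h, h2]
  simp
  ring

lemma harmonicAt_log_norm_thetaQuot (hb : 0 < b) {z : ℂ} (hz : z / ω₁ ∈ doubleRect b) :
    InnerProductSpace.HarmonicAt (fun z => Real.log ‖thetaQuot b (z / ω₁)‖) z := by
  have : AnalyticAt ℂ (fun z => thetaQuot b (z / ω₁)) z :=
    ((differentiable_thetaQuot hb).comp
      (differentiable_id.div_const ω₁ : Differentiable ℂ fun z => z / ω₁)).analyticAt z
  exact this.harmonicAt_log_norm (thetaQuot_ne_zero hb hz)

lemma contDiffAt_greenRegular (hb : 0 < b) {z : ℂ} (hz : z / ω₁ ∈ doubleRect b) :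
    ContDiffAt ℝ ∞ (greenRegular b ω₁) z := by
  have h := (HarmonicAt.analyticAt (harmonicAt_log_norm_thetaQuot hb hz)).contDiffAt (n := ∞)
  have h2 : ContDiff ℝ ∞ fun z : ℂ => (z / ω₁).im :=
    Complex.imCLM.contDiff.comp (contDiff_id.div_const ω₁)
  exact (contDiffAt_const.mul (h2.contDiffAt.pow 2)).sub
    (contDiffAt_const.mul (h.sub contDiffAt_const))

/-- Only the quadratic term contributes, since the logarithm of the modulus of a nonvanishing
holomorphic function is harmonic. The value is the reciprocal of the area of the cell. -/
lemma laplacian_greenRegular (h1 : ω₁ ≠ 0) (hb : 0 < b) {z : ℂ} (hz : z / ω₁ ∈ doubleRect b) :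
    Laplacian.laplacian (greenRegular b ω₁) z = 1 / (‖ω₁‖ ^ 2 * b) := by
  set l : ℂ →L[ℝ] ℝ := Complex.imCLM.comp (mulRealCLM ω₁⁻¹) with hl
  have hlz : ∀ z, l z = (z / ω₁).im := fun z => by
    rw [div_eq_mul_inv, mul_comm]; rfl
  have hh := harmonicAt_log_norm_thetaQuot hb hz
  have hh' := (hh.sub (InnerProductSpace.harmonicAt_const (Real.log ‖ω₁‖))).const_smul
    (c := 1 / (2 * Real.pi))
  have heq : greenRegular b ω₁ = (1 / (2 * b)) • (fun w => l w ^ 2) -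
      (1 / (2 * Real.pi)) • ((fun z => Real.log ‖thetaQuot b (z / ω₁)‖) -
        fun _ => Real.log ‖ω₁‖) := by
    ext w
    simp [greenRegular, hlz]
  have hc : ContDiff ℝ 2 (fun w => l w ^ 2) := l.contDiff.pow 2
  have hc' : ContDiffAt ℝ 2 ((1 / (2 * b)) • fun w => l w ^ 2) z :=
    contDiffAt_const.smul hc.contDiffAt
  rw [heq, ContDiffAt.laplacian_sub hc' hh'.1,
    InnerProductSpace.laplacian_smul _ hc.contDiffAt, laplacian_sq_of_continuousLinear,
    hh'.2.self_of_nhds, hlz, hlz]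
  have : ‖ω₁‖ ^ 2 ≠ 0 := by positivity
  have hn : ω₁.re ^ 2 + ω₁.im ^ 2 = ‖ω₁‖ ^ 2 := by
    rw [← Complex.normSq_eq_norm_sq, Complex.normSq_apply]; ring
  simp only [Complex.div_im, Complex.normSq_eq_norm_sq, Complex.one_im, Complex.one_re,
    Complex.I_im, Complex.I_re, smul_eq_mul, Pi.zero_apply]
  field_simp
  linear_combination hn

lemma integrableOn_log_norm (r : ℝ) :
    IntegrableOn (fun z : ℂ => Real.log ‖z‖) (Metric.ball 0 r) := by
  rw [integrableOn_fun_norm_addHaar volume (f := Real.log), Complex.finrank_real_complex]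
  have : Continuous fun y : ℝ => y ^ (2 - 1) • Real.log y := by
    simpa using Real.continuous_mul_log
  exact (this.integrableOn_Icc (a := 0) (b := r)).mono_set Ioo_subset_Icc_self

lemma integrableOn_thetaGreen (h1 : ω₁ ≠ 0) (hω : ω₂ = ω₁ * (b * Complex.I)) (hb : 0 < b) :
    IntegrableOn (fun z => thetaGreen b (z / ω₁)) (periodCell ω₁ ω₂) := by
  have hcomp : IsCompact ((fun x => ω₁ * x) '' closedRect b) :=
    isCompact_closedRect.image (by fun_prop)
  have hsub : periodCell ω₁ ω₂ ⊆ (fun x => ω₁ * x) '' closedRect b := by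
    rw [periodCell_eq_image hω hb]
    exact image_mono cellRect_subset_closedRect
  have hdouble : ∀ z ∈ (fun x => ω₁ * x) '' closedRect b, z / ω₁ ∈ doubleRect b := by
    rintro _ ⟨x, hx, rfl⟩
    simpa [mul_div_cancel_left₀ x h1] using closedRect_subset_doubleRect hb hx
  obtain ⟨r, hr⟩ := hcomp.isBounded.subset_ball 0
  have hlog := ((integrableOn_log_norm r).mono_set (hsub.trans hr)).const_mul (-(1 / (2 * Real.pi)))
  have hreg : IntegrableOn (greenRegular b ω₁) (periodCell ω₁ ω₂) :=
    (ContinuousOn.integrableOn_compact hcomp fun z hz =>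
      (contDiffAt_greenRegular hb (hdouble z hz)).continuousAt.continuousWithinAt).mono_set hsub
  refine (hlog.add hreg).congr ?_
  have hne : ∀ᵐ z : ℂ ∂volume.restrict (periodCell ω₁ ω₂), z ≠ 0 :=
    ae_restrict_of_ae (by simp [ae_iff])
  filter_upwards [hne, ae_restrict_mem (isOpen_periodCell h1 hω hb).measurableSet] with z hz hz'
  exact (thetaGreen_div_eq h1 hb (hdouble z (hsub hz')) hz).symm

theorem exists_isTorusGreen (h1 : ω₁ ≠ 0) (hω : ω₂ = ω₁ * (b * Complex.I)) (hb : 0 < b) :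
    ∃ c : ℝ, IsTorusGreen ω₁ ω₂ fun z => thetaGreen b (z / ω₁) - c := by
  have hvol := volume_real_periodCell hω hb
  have hvol0 : volume.real (periodCell ω₁ ω₂) ≠ 0 := by rw [hvol]; positivity
  set m := ∫ z in periodCell ω₁ ω₂, thetaGreen b (z / ω₁)
  set c := m / volume.real (periodCell ω₁ ω₂) with hc
  have hmem := fun z => mem_two_smul_periodCell (z := z) h1 hω hb
  refine ⟨c, fun z => ?_, fun z => ?_, ⟨fun z => greenRegular b ω₁ z - c, ?_, ?_, ?_⟩, ?_⟩
  · rw [add_div, div_self h1, thetaGreen_add_one]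
  · rw [add_div, hω, mul_div_cancel_left₀ _ h1, thetaGreen_add_I_mul hb]
  · intro z hz
    rw [hmem] at hz
    exact ((contDiffAt_greenRegular hb hz).sub contDiffAt_const).contDiffWithinAt
  · intro z hz
    rw [hmem] at hz
    have := ContDiffAt.laplacian_sub ((contDiffAt_greenRegular hb hz).of_le (WithTop.coe_le_coe.2 le_top))
      (contDiffAt_const (c := c))
    rw [hvol]
    erw [this]
    rw [laplacian_greenRegular h1 hb hz]
    simp
  · intro z hz h0
    rw [hmem] at hz
    rw [thetaGreen_div_eq h1 hb hz h0]
    ring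
  · have hfin : IsFiniteMeasure (volume.restrict (periodCell ω₁ ω₂)) := by
      rw [isFiniteMeasure_restrict]
      exact fun h => hvol0 (by simp [Measure.real, h])
    rw [integral_sub (integrableOn_thetaGreen h1 hω hb) (integrable_const c)]
    rw [setIntegral_const, smul_eq_mul, hc, mul_div_cancel₀ _ hvol0, sub_self]

end Green

/-! ### Uniqueness of the Green function up to a constant -/

section GreenUnique

variable {b : ℝ} {ω₁ ω₂ : ℂ}

open InnerProductSpace in
lemma harmonicAt_comp_add_right {f : ℂ → ℝ} {z a : ℂ} (h : HarmonicAt f (z + a)) :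
    HarmonicAt (fun w => f (w + a)) z := by
  refine ⟨h.1.comp z (contDiffAt_id.add contDiffAt_const), ?_⟩
  have ht : Tendsto (fun w => w + a) (𝓝 z) (𝓝 (z + a)) :=
    (continuous_id.add continuous_const).tendsto z
  filter_upwards [ht.eventually h.2] with w hw
  rw [laplacian_eq_iteratedFDeriv_complexPlane] at hw ⊢
  simpa [iteratedFDeriv_comp_add_right] using hw

lemma exists_add_mem_closedRect (hb : 0 < b) (x : ℂ) :
    ∃ k l : ℤ, x + (k + l * (b * Complex.I)) ∈ closedRect b := by
  refine ⟨-round x.re, -round (x.im / b), ?_⟩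
  have h1 := abs_le.1 (abs_sub_round x.re)
  have h2 := abs_le.1 (abs_sub_round (x.im / b))
  have h3 : x.im = x.im / b * b := by field_simp
  rw [mem_closedRect]
  simp only [Complex.add_re, Complex.intCast_re, Complex.mul_re, Complex.intCast_im,
    Complex.ofReal_re, Complex.ofReal_im, Complex.I_re, Complex.I_im, Complex.add_im,
    Complex.mul_im, Int.cast_neg, Complex.neg_re, Complex.neg_im, mul_zero, mul_one, zero_mul,
    sub_zero, zero_add, add_zero, neg_zero]
  refine ⟨⟨by linarith, by linarith⟩, ?_, ?_⟩ <;> nlinarith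

lemma harmonicAt_sub_of_laplacian_eq {U : Set ℂ} (hU : IsOpen U) {H₁ H₂ : ℂ → ℝ} {c : ℝ}
    (h1 : ContDiffOn ℝ ∞ H₁ U) (h2 : ContDiffOn ℝ ∞ H₂ U)
    (hl1 : ∀ z ∈ U, Laplacian.laplacian H₁ z = c) (hl2 : ∀ z ∈ U, Laplacian.laplacian H₂ z = c)
    {z : ℂ} (hz : z ∈ U) : InnerProductSpace.HarmonicAt (H₁ - H₂) z := by
  have hc1 : ∀ w ∈ U, ContDiffAt ℝ 2 H₁ w := fun w hw =>
    (h1.contDiffAt (hU.mem_nhds hw)).of_le (WithTop.coe_le_coe.2 le_top)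
  have hc2 : ∀ w ∈ U, ContDiffAt ℝ 2 H₂ w := fun w hw =>
    (h2.contDiffAt (hU.mem_nhds hw)).of_le (WithTop.coe_le_coe.2 le_top)
  refine ⟨(hc1 z hz).sub (hc2 z hz), ?_⟩
  filter_upwards [hU.mem_nhds hz] with w hw
  rw [ContDiffAt.laplacian_sub (hc1 w hw) (hc2 w hw), hl1 w hw, hl2 w hw, sub_self]
  rfl

lemma isOpen_two_smul_periodCell (h1 : ω₁ ≠ 0) (hω : ω₂ = ω₁ * (b * Complex.I)) (hb : 0 < b) :
    IsOpen ((2 : ℝ) • periodCell ω₁ ω₂) :=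
  (isOpen_periodCell h1 hω hb).smul₀ two_ne_zero

/-- In the difference the logarithms cancel and the Laplacians agree, so it extends to a doubly
periodic harmonic function on the plane. Compactness of the cell makes it bounded, hence constant.
The constant can be left undetermined because it drops out of `concPotential`. Lattice points are
excluded, as the values of a Green function there carry no information. -/
theorem IsTorusGreen.exists_eq_add_const (h1 : ω₁ ≠ 0) (hω : ω₂ = ω₁ * (b * Complex.I))
    (hb : 0 < b) {G₁ G₂ : ℂ → ℝ} (hG₁ : IsTorusGreen ω₁ ω₂ G₁) (hG₂ : IsTorusGreen ω₁ ω₂ G₂) :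
    ∃ c : ℝ, ∀ z, thetaOdd b (z / ω₁) ≠ 0 → G₁ z = G₂ z + c := by
  classical
  obtain ⟨H₁, hH₁, hL₁, hE₁⟩ := hG₁.regularPart
  obtain ⟨H₂, hH₂, hL₂, hE₂⟩ := hG₂.regularPart
  have hmem := fun z => mem_two_smul_periodCell (z := z) h1 hω hb
  -- The value at lattice points is the removable extension read off at the origin; using it at all
  -- of them keeps `D` periodic.
  set D : ℂ → ℝ := fun z => if thetaOdd b (z / ω₁) = 0 then H₁ 0 - H₂ 0 else G₁ z - G₂ z with hD
  have hDeq : ∀ z ∈ (2 : ℝ) • periodCell ω₁ ω₂, D z = (H₁ - H₂) z := by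
    intro z hz
    have hz' := (hmem z).1 hz
    rcases eq_or_ne z 0 with rfl | h0
    · simp [hD, thetaOdd_zero hb]
    · have : thetaOdd b (z / ω₁) ≠ 0 := fun h =>
        div_ne_zero h0 h1 ((thetaOdd_eq_zero_iff_of_mem_doubleRect hb hz').1 h)
      simp only [hD, if_neg this, hE₁ z hz h0, hE₂ z hz h0, Pi.sub_apply]
      ring
  have hp1 : Function.Periodic D ω₁ := fun z => by
    simp only [hD, add_div, div_self h1, thetaOdd_add_one, neg_eq_zero, hG₁.periodic₁,
      hG₂.periodic₁]
  have hp2 : Function.Periodic D ω₂ := fun z => by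
    have : z / ω₁ + ω₂ / ω₁ = z / ω₁ + b * Complex.I := by
      rw [hω, mul_div_cancel_left₀ _ h1]
    have hne : -(Complex.exp (Real.pi * b) * expTwoPiI (-(z / ω₁))) ≠ 0 :=
      neg_ne_zero.2 (mul_ne_zero (Complex.exp_ne_zero _) (expTwoPiI_ne_zero _))
    simp only [hD, add_div, this, thetaOdd_add_I_mul hb, mul_eq_zero, hne, false_or,
      hG₁.periodic₂, hG₂.periodic₂]
  have hper : ∀ (k l : ℤ) z, D (z + ω₁ * (k + l * (b * Complex.I))) = D z := fun k l z => by
    have := (hp1.int_mul k).add_period (hp2.int_mul l) z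
    rw [← this]
    congr 1
    rw [hω]; ring
  have hred : ∀ z, ∃ a, z + a ∈ (fun x => ω₁ * x) '' closedRect b ∧ ∀ w, D (w + a) = D w := by
    intro z
    obtain ⟨k, l, hkl⟩ := exists_add_mem_closedRect hb (z / ω₁)
    refine ⟨ω₁ * (k + l * (b * Complex.I)), ⟨_, hkl, ?_⟩, hper k l⟩
    simp only [mul_add, mul_div_cancel₀ _ h1]
  have hsub : (fun x => ω₁ * x) '' closedRect b ⊆ (2 : ℝ) • periodCell ω₁ ω₂ := by
    rintro _ ⟨x, hx, rfl⟩
    rw [hmem, mul_div_cancel_left₀ _ h1]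
    exact closedRect_subset_doubleRect hb hx
  have hopen := isOpen_two_smul_periodCell h1 hω hb
  have hharm : InnerProductSpace.HarmonicOnNhd D univ := by
    intro z _
    obtain ⟨a, ha, hDa⟩ := hred z
    have hza := hsub ha
    have hh : InnerProductSpace.HarmonicAt D (z + a) :=
      (InnerProductSpace.harmonicAt_congr_nhds (by
        filter_upwards [hopen.mem_nhds hza] with w hw using hDeq w hw)).2
        (harmonicAt_sub_of_laplacian_eq hopen hH₁ hH₂ hL₁ hL₂ hza)
    have := harmonicAt_comp_add_right hh
    simpa only [hDa] using this
  have hbound : Bornology.IsBounded (range D) := by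
    have hc : IsCompact (D '' ((fun x => ω₁ * x) '' closedRect b)) :=
      (isCompact_closedRect.image (by fun_prop)).image_of_continuousOn
        (hharm.continuousOn.mono (subset_univ _))
    refine hc.isBounded.subset ?_
    rintro _ ⟨z, rfl⟩
    obtain ⟨a, ha, hDa⟩ := hred z
    exact ⟨z + a, ha, hDa z⟩
  have hconst := InnerProductSpace.bounded_harmonic_on_complex_plane_is_constant D hharm hbound
  refine ⟨D 0, fun z hz => ?_⟩
  have := hconst z 0
  rw [← this]
  simp only [hD, if_neg hz]
  ring

end GreenUnique

/-! ### Elliptic functions with a double zero at a half period and a double pole at the origin -/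

section HalfRatio

variable {b : ℝ}

/-- The square of the odd theta function. -/
noncomputable def thetaSq (b : ℝ) (x : ℂ) : ℂ := thetaOdd b x ^ 2

lemma thetaSq_neg (hb : 0 < b) (x : ℂ) : thetaSq b (-x) = thetaSq b x := by
  rw [thetaSq, thetaOdd_neg hb, neg_sq, thetaSq]

lemma thetaSq_add_one (x : ℂ) : thetaSq b (x + 1) = thetaSq b x := by
  rw [thetaSq, thetaOdd_add_one, neg_sq, thetaSq]

lemma thetaSq_sub_one (x : ℂ) : thetaSq b (x - 1) = thetaSq b x := by
  rw [← thetaSq_add_one, sub_add_cancel]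

lemma thetaSq_add_I_mul (hb : 0 < b) (x : ℂ) :
    nome b * expTwoPiI x ^ 2 * thetaSq b (x + b * Complex.I) = thetaSq b x := by
  rw [thetaSq, thetaOdd_add_I_mul hb, expTwoPiI_neg, thetaSq]
  have h : (nome b : ℂ) * Complex.exp (Real.pi * b) ^ 2 = 1 := by
    rw [nome, Complex.ofReal_exp, ← Complex.exp_nat_mul, ← Complex.exp_add]
    rw [Complex.exp_eq_one_iff]
    exact ⟨0, by push_cast; ring⟩
  have := expTwoPiI_ne_zero x
  field_simp
  linear_combination thetaOdd b x ^ 2 * h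

/-- The half periods of `ℤ + i b ℤ`. -/
noncomputable def unitHalfPeriod (b : ℝ) : Fin 3 → ℂ :=
  ![1 / 2, b * Complex.I / 2, (1 + b * Complex.I) / 2]

/-- The exponential factors which make the quotients of theta functions elliptic. -/
noncomputable def halfTwist : Fin 3 → ℂ → ℂ :=
  ![fun _ => 1, fun x => expTwoPiI (-x), fun x => expTwoPiI (-x)]

/-- The elliptic function with a double zero at a half period and a double pole at `0`. -/
noncomputable def halfRatio (b : ℝ) (j : Fin 3) (x : ℂ) : ℂ :=
  halfTwist j x * thetaSq b (x - unitHalfPeriod b j) / thetaSq b x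

lemma halfTwist_ne_zero (j : Fin 3) (x : ℂ) : halfTwist j x ≠ 0 := by
  fin_cases j
  · exact one_ne_zero
  · exact expTwoPiI_ne_zero _
  · exact expTwoPiI_ne_zero _

lemma differentiable_halfTwist (j : Fin 3) : Differentiable ℂ (halfTwist j) := by
  fin_cases j
  · exact differentiable_const 1
  · exact differentiable_expTwoPiI.comp differentiable_neg
  · exact differentiable_expTwoPiI.comp differentiable_neg

lemma halfTwist_add_one (j : Fin 3) (x : ℂ) : halfTwist j (x + 1) = halfTwist j x := by
  fin_cases j
  · rfl
  all_goals
    change expTwoPiI (-(x + 1)) = expTwoPiI (-x)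
    rw [expTwoPiI_neg, expTwoPiI_add, expTwoPiI_one, mul_one, expTwoPiI_neg]

lemma halfRatio_add_one (j : Fin 3) (x : ℂ) : halfRatio b j (x + 1) = halfRatio b j x := by
  rw [halfRatio, halfTwist_add_one, thetaSq_add_one, add_sub_right_comm, thetaSq_add_one, halfRatio]

lemma expTwoPiI_half : expTwoPiI (1 / 2) = -1 := by
  rw [expTwoPiI, show 2 * Real.pi * Complex.I * (1 / 2) = Real.pi * Complex.I by ring,
    Complex.exp_pi_mul_I]

lemma expTwoPiI_sq (x : ℂ) : expTwoPiI x ^ 2 = expTwoPiI (2 * x) := by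
  rw [two_mul, expTwoPiI_add, sq]

/-- The multipliers of `thetaSq` at `x` and at `x` minus a half period agree for the real half
period, and differ by a factor `nome b` for the other two. `halfTwist` supplies precisely this
factor. -/
lemma halfRatio_add_I_mul (hb : 0 < b) (j : Fin 3) (x : ℂ) :
    halfRatio b j (x + b * Complex.I) = halfRatio b j x := by
  have hn : (nome b : ℂ) ≠ 0 := by exact_mod_cast nome_pos.ne'
  have hE := expTwoPiI_ne_zero x
  have hI := expTwoPiI_I_mul (b := b)
  rw [halfRatio, halfRatio, add_sub_right_comm, ← thetaSq_add_I_mul hb x,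
    ← thetaSq_add_I_mul hb (x - _), mul_comm (nome b * expTwoPiI x ^ 2), ← div_div _ _ (_ * _)]
  rw [div_right_comm]
  congr 1
  rw [eq_div_iff (by positivity)]
  have key : halfTwist j (x + b * Complex.I) * expTwoPiI x ^ 2 =
      halfTwist j x * expTwoPiI (x - unitHalfPeriod b j) ^ 2 := by
    fin_cases j
    · change 1 * _ = 1 * expTwoPiI (x - 1 / 2) ^ 2
      rw [sub_eq_add_neg, expTwoPiI_add, expTwoPiI_neg, expTwoPiI_half]; ring
    · change expTwoPiI (-(x + b * Complex.I)) * _ =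
        expTwoPiI (-x) * expTwoPiI (x - b * Complex.I / 2) ^ 2
      rw [expTwoPiI_sq, expTwoPiI_sq, ← expTwoPiI_add, ← expTwoPiI_add]; congr 1; ring
    · change expTwoPiI (-(x + b * Complex.I)) * _ =
        expTwoPiI (-x) * expTwoPiI (x - (1 + b * Complex.I) / 2) ^ 2
      rw [expTwoPiI_sq, expTwoPiI_sq, ← expTwoPiI_add, ← expTwoPiI_add]
      have : -x + 2 * (x - (1 + b * Complex.I) / 2) = -(x + b * Complex.I) + 2 * x + -1 := by ring
      rw [this, expTwoPiI_add _ (-1), expTwoPiI_neg 1, expTwoPiI_one, inv_one, mul_one]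
  linear_combination (nome b * thetaSq b (x - unitHalfPeriod b j + b * Complex.I)) * key

/-- Since `thetaSq` is even, the reflection replaces `x - h` by `x + h`, which differs from it by
the full period `2h`. Evenness is what later kills the residue at the pole. -/
lemma halfRatio_neg (hb : 0 < b) (j : Fin 3) (x : ℂ) : halfRatio b j (-x) = halfRatio b j x := by
  rw [halfRatio, halfRatio, thetaSq_neg hb x]
  congr 1
  rw [← thetaSq_neg hb (-x - _), neg_sub, sub_neg_eq_add, add_comm]
  have h := thetaSq_add_I_mul hb (x - b * Complex.I / 2)
  have hx : x - b * Complex.I / 2 + b * Complex.I = x + b * Complex.I / 2 := by ring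
  have hE : expTwoPiI (-x) * (nome b * expTwoPiI (x - b * Complex.I / 2) ^ 2) = expTwoPiI x := by
    rw [← expTwoPiI_I_mul, expTwoPiI_sq, ← expTwoPiI_add, ← expTwoPiI_add]; congr 1; ring
  rw [hx] at h
  fin_cases j
  · change 1 * thetaSq b (x + 1 / 2) = 1 * thetaSq b (x - 1 / 2)
    rw [show x + 1 / 2 = x - 1 / 2 + 1 by ring, thetaSq_add_one]
  · change expTwoPiI (- -x) * thetaSq b (x + b * Complex.I / 2) =
      expTwoPiI (-x) * thetaSq b (x - b * Complex.I / 2)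
    rw [neg_neg, ← h, ← hE]; ring
  · change expTwoPiI (- -x) * thetaSq b (x + (1 + b * Complex.I) / 2) =
      expTwoPiI (-x) * thetaSq b (x - (1 + b * Complex.I) / 2)
    have h' := thetaSq_add_I_mul hb (x - (1 + b * Complex.I) / 2)
    have h1 : expTwoPiI (x - (1 + b * Complex.I) / 2) ^ 2 =
        expTwoPiI (x - b * Complex.I / 2) ^ 2 := by
      rw [show x - (1 + b * Complex.I) / 2 = x - b * Complex.I / 2 + -(1 / 2) by ring,
        expTwoPiI_add, expTwoPiI_neg, expTwoPiI_half]
      ring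
    have h2 : thetaSq b (x - (1 + b * Complex.I) / 2 + b * Complex.I) =
        thetaSq b (x + (1 + b * Complex.I) / 2) := by
      rw [← thetaSq_add_one]; congr 1; ring
    rw [h1, h2] at h'
    rw [neg_neg, ← h', ← hE]; ring

lemma differentiableAt_halfRatio (hb : 0 < b) (j : Fin 3) {x : ℂ} (hx : thetaOdd b x ≠ 0) :
    DifferentiableAt ℂ (halfRatio b j) x := by
  have h1 : Differentiable ℂ (thetaSq b) := (differentiable_thetaOdd hb).pow 2
  have h2 : Differentiable ℂ fun x => thetaSq b (x - unitHalfPeriod b j) :=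
    h1.comp (differentiable_id.sub_const _)
  exact (((differentiable_halfTwist j) x).mul (h2 x)).div (h1 x) (pow_ne_zero 2 hx)

lemma halfRatio_ne_zero {j : Fin 3} {x : ℂ} (hx : thetaOdd b x ≠ 0)
    (hj : thetaOdd b (x - unitHalfPeriod b j) ≠ 0) : halfRatio b j x ≠ 0 :=
  div_ne_zero (mul_ne_zero (halfTwist_ne_zero j x) (pow_ne_zero 2 hj)) (pow_ne_zero 2 hx)

lemma exp_thetaGreen {x : ℂ} (hx : thetaOdd b x ≠ 0) :
    Real.exp (4 * Real.pi * thetaGreen b x) * ‖thetaOdd b x‖ ^ 2 =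
      Real.exp (2 * Real.pi / b * x.im ^ 2) := by
  have h0 : 0 < ‖thetaOdd b x‖ := norm_pos_iff.2 hx
  rw [thetaGreen, if_neg hx, ← Real.exp_log (pow_pos h0 2), ← Real.exp_add, Real.log_pow]
  congr 1
  have := Real.pi_ne_zero
  push_cast
  field_simp
  ring

/-- The modulus of an elliptic function with a double zero at a half period and a double pole
at `0`, in terms of the Green function. -/
lemma exists_norm_halfRatio_eq (hb : 0 < b) (j : Fin 3) : ∃ κ : ℝ, 0 < κ ∧ ∀ x,
    thetaOdd b x ≠ 0 → thetaOdd b (x - unitHalfPeriod b j) ≠ 0 →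
    ‖halfRatio b j x‖ = κ * Real.exp (4 * Real.pi *
      (thetaGreen b x - thetaGreen b (x - unitHalfPeriod b j))) := by
  set y := (unitHalfPeriod b j).im
  refine ⟨Real.exp (2 * Real.pi / b * y ^ 2), Real.exp_pos _, fun x hx hxj => ?_⟩
  have h1 := exp_thetaGreen hx
  have h2 := exp_thetaGreen hxj
  have h0 : ‖thetaOdd b x‖ ≠ 0 := norm_ne_zero_iff.2 hx
  have ht : ‖halfTwist j x‖ = Real.exp (4 * Real.pi / b * y * x.im) := by
    fin_cases j
    · simp [halfTwist, y, unitHalfPeriod]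
    all_goals
      simp [halfTwist, y, unitHalfPeriod, norm_expTwoPiI]
      field_simp
      left
      ring
  rw [halfRatio, norm_div, norm_mul, thetaSq, thetaSq, norm_pow, norm_pow, ht,
    div_eq_iff (by positivity), mul_sub, Real.exp_sub]
  set A := Real.exp (4 * Real.pi * thetaGreen b x)
  have hB : Real.exp (4 * Real.pi * thetaGreen b (x - unitHalfPeriod b j)) ≠ 0 :=
    (Real.exp_pos _).ne'
  set B := Real.exp (4 * Real.pi * thetaGreen b (x - unitHalfPeriod b j))
  -- Expanding `(x.im - y) ^ 2`: the cross term is cancelled by the modulus of the twist, and the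
  -- constant term is the logarithm of `κ`.
  have h3 : Real.exp (4 * Real.pi / b * y * x.im) *
      Real.exp (2 * Real.pi / b * (x - unitHalfPeriod b j).im ^ 2) =
      Real.exp (2 * Real.pi / b * y ^ 2) * Real.exp (2 * Real.pi / b * x.im ^ 2) := by
    rw [← Real.exp_add, ← Real.exp_add, Complex.sub_im]
    congr 1
    ring
  rw [← h1, ← h2] at h3
  generalize Real.exp (4 * Real.pi / b * y * x.im) = P at h3 ⊢
  generalize Real.exp (2 * Real.pi / b * y ^ 2) = Q at h3 ⊢
  field_simp
  linear_combination h3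

end HalfRatio

/-! ### Products of the basic elliptic functions, and their signs on two lines -/

section HalfProd

variable {b : ℝ}

/-- The elliptic function with zeros of order `2 mⱼ` at the half periods. -/
noncomputable def halfProd (b : ℝ) (m : Fin 3 → ℕ) (x : ℂ) : ℂ := ∏ j, halfRatio b j x ^ m j

lemma halfProd_add_one (m : Fin 3 → ℕ) (x : ℂ) : halfProd b m (x + 1) = halfProd b m x := by
  simp only [halfProd, halfRatio_add_one]

lemma halfProd_add_I_mul (hb : 0 < b) (m : Fin 3 → ℕ) (x : ℂ) :
    halfProd b m (x + b * Complex.I) = halfProd b m x := by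
  simp only [halfProd, halfRatio_add_I_mul hb]

lemma halfProd_neg (hb : 0 < b) (m : Fin 3 → ℕ) (x : ℂ) : halfProd b m (-x) = halfProd b m x := by
  simp only [halfProd, halfRatio_neg hb]

lemma differentiableAt_halfProd (hb : 0 < b) (m : Fin 3 → ℕ) {x : ℂ} (hx : thetaOdd b x ≠ 0) :
    DifferentiableAt ℂ (halfProd b m) x := by
  unfold halfProd
  exact DifferentiableAt.fun_finsetProd fun j _ => (differentiableAt_halfRatio hb j hx).pow _

lemma halfProd_ne_zero {m : Fin 3 → ℕ} {x : ℂ} (hx : thetaOdd b x ≠ 0)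
    (hj : ∀ j, thetaOdd b (x - unitHalfPeriod b j) ≠ 0) : halfProd b m x ≠ 0 :=
  Finset.prod_ne_zero_iff.2 fun j _ => pow_ne_zero _ (halfRatio_ne_zero hx (hj j))

/-- Near the cell, `halfProd` has a single pole, at the origin, and an even numerator. -/
lemma exists_halfProd_eq_div (hb : 0 < b) (m : Fin 3 → ℕ) :
    ∃ φ : ℂ → ℂ, DifferentiableOn ℂ φ (doubleRect b) ∧ φ 0 ≠ 0 ∧
      (∀ x ∈ doubleRect b, φ (-x) = φ x) ∧
      ∀ x ∈ doubleRect b, halfProd b m x = φ x / x ^ (2 * ∑ j, m j) := by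
  set φ : ℂ → ℂ := fun x => ∏ j, (halfTwist j x * thetaSq b (x - unitHalfPeriod b j) /
    thetaQuot b x ^ 2) ^ m j with hφ
  have heq : ∀ x, halfProd b m x = φ x / x ^ (2 * ∑ j, m j) := by
    intro x
    rw [hφ, halfProd, pow_mul, ← Finset.prod_pow_eq_pow_sum, ← Finset.prod_div_distrib]
    refine Finset.prod_congr rfl fun j _ => ?_
    have hsq : thetaSq b x = thetaQuot b x ^ 2 * x ^ 2 := by
      rw [thetaSq, thetaOdd_eq_mul_thetaQuot hb x]; ring
    rw [← div_pow, halfRatio, hsq, div_div]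
  refine ⟨φ, fun x hx => DifferentiableAt.differentiableWithinAt ?_, ?_, ?_, fun x _ => heq x⟩
  · have h1 : Differentiable ℂ (thetaSq b) := (differentiable_thetaOdd hb).pow 2
    have h2 : ∀ j, Differentiable ℂ fun x => thetaSq b (x - unitHalfPeriod b j) := fun j =>
      h1.comp (differentiable_id.sub_const _)
    rw [hφ]
    refine DifferentiableAt.fun_finsetProd fun j _ => DifferentiableAt.pow ?_ _
    exact (((differentiable_halfTwist j) x).mul (h2 j x)).div ((differentiable_thetaQuot hb x).pow 2)
      (pow_ne_zero 2 (thetaQuot_ne_zero hb hx))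
  · refine Finset.prod_ne_zero_iff.2 fun j _ => pow_ne_zero _ (div_ne_zero
      (mul_ne_zero (halfTwist_ne_zero j 0) (pow_ne_zero 2 ?_))
      (pow_ne_zero 2 (thetaQuot_ne_zero hb (zero_mem_doubleRect hb))))
    rw [zero_sub, thetaOdd_neg hb, neg_ne_zero]
    have hmem : unitHalfPeriod b j ∈ doubleRect b := by
      rw [mem_doubleRect]
      fin_cases j <;> simp [unitHalfPeriod] <;> norm_num [hb] <;> linarith
    rw [Ne, thetaOdd_eq_zero_iff_of_mem_doubleRect hb hmem]
    intro h
    have hre := congrArg Complex.re h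
    have him := congrArg Complex.im h
    fin_cases j <;> simp [unitHalfPeriod, hb.ne'] at hre him
  · intro x _
    rcases eq_or_ne x 0 with rfl | h0
    · rw [neg_zero]
    · have h1 := heq x
      have h2 := heq (-x)
      have hp : x ^ (2 * ∑ j, m j) ≠ 0 := pow_ne_zero _ h0
      rw [halfProd_neg hb, h1, (even_two_mul _).neg_pow, div_left_inj' hp] at h2
      exact h2.symm

lemma thetaSq_eq_norm_of_conj (hb : 0 < b) {x : ℂ} (h : (starRingEnd ℂ) x = x) :
    thetaSq b x = ‖thetaSq b x‖ := by
  have : (starRingEnd ℂ) (thetaOdd b x) = thetaOdd b x := by rw [conj_thetaOdd hb, h]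
  obtain ⟨r, hr⟩ := Complex.conj_eq_iff_real.1 this
  rw [thetaSq, hr, norm_pow, Complex.norm_real, Real.norm_eq_abs, sq_abs, Complex.ofReal_pow]

/-- The hypothesis describes the line `Re x = -1/2`, where oddness and antiperiodicity together make
`thetaOdd` real. -/
lemma thetaSq_eq_norm_of_conj_sub (hb : 0 < b) {x : ℂ} (h : (starRingEnd ℂ) x = -x - 1) :
    thetaSq b x = ‖thetaSq b x‖ := by
  have : (starRingEnd ℂ) (thetaOdd b x) = thetaOdd b x := by
    rw [conj_thetaOdd hb, h]
    have h1 := thetaOdd_add_one (b := b) (-x - 1)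
    rw [sub_add_cancel, thetaOdd_neg hb] at h1
    exact (neg_injective h1).symm
  obtain ⟨r, hr⟩ := Complex.conj_eq_iff_real.1 this
  rw [thetaSq, hr, norm_pow, Complex.norm_real, Real.norm_eq_abs, sq_abs, Complex.ofReal_pow]

/-- On the imaginary axis oddness makes `thetaOdd` purely imaginary. -/
lemma thetaSq_eq_neg_norm_of_conj (hb : 0 < b) {x : ℂ} (h : (starRingEnd ℂ) x = -x) :
    thetaSq b x = -‖thetaSq b x‖ := by
  have : (starRingEnd ℂ) (thetaOdd b x) = -thetaOdd b x := by
    rw [conj_thetaOdd hb, h, thetaOdd_neg hb]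
  have h2 : thetaSq b x = -(thetaOdd b x * (starRingEnd ℂ) (thetaOdd b x)) := by
    rw [this, thetaSq]; ring
  rw [h2, Complex.mul_conj, norm_neg, Complex.norm_real, Complex.normSq_eq_norm_sq,
    Real.norm_eq_abs, abs_of_nonneg (by positivity)]

/-- On this line conjugation is translation by `b i`, so the multiplier of `thetaOdd` fixes the
phase. -/
lemma thetaSq_half_line (hb : 0 < b) (t : ℝ) :
    thetaSq b (t - b * Complex.I / 2) =
      -(expTwoPiI t * ‖thetaSq b (t - b * Complex.I / 2)‖) := by
  set x : ℂ := t - b * Complex.I / 2 with hx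
  have hc : (starRingEnd ℂ) x = x + b * Complex.I := by
    simp [hx, Complex.conj_ofNat]; ring
  have h := conj_thetaOdd hb x
  rw [hc, thetaOdd_add_I_mul hb] at h
  have hE : Complex.exp (Real.pi * b) * expTwoPiI (-x) = expTwoPiI (-t) := by
    rw [expTwoPiI, expTwoPiI, ← Complex.exp_add, hx]
    congr 1
    linear_combination (Real.pi * b : ℂ) * Complex.I_mul_I
  rw [hE] at h
  have h2 : thetaSq b x = -(expTwoPiI t * (thetaOdd b x * (starRingEnd ℂ) (thetaOdd b x))) := by
    rw [h, expTwoPiI_neg, thetaSq]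
    have := expTwoPiI_ne_zero t
    field_simp
  rw [Complex.mul_conj, Complex.normSq_eq_norm_sq] at h2
  rw [thetaSq, norm_pow, ← thetaSq, h2]

lemma thetaSq_sub_I_mul (hb : 0 < b) (x : ℂ) :
    thetaSq b (x - b * Complex.I) = expTwoPiI x ^ 2 * (nome b : ℂ)⁻¹ * thetaSq b x := by
  have h := thetaSq_add_I_mul hb (x - b * Complex.I)
  rw [sub_add_cancel] at h
  have hn : (nome b : ℂ) ≠ 0 := by exact_mod_cast nome_pos.ne'
  rw [← h, sub_eq_add_neg, expTwoPiI_add, expTwoPiI_neg, expTwoPiI_I_mul]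
  field_simp

lemma expTwoPiI_mul_I (s : ℝ) : expTwoPiI (s * Complex.I) = ‖expTwoPiI (s * Complex.I)‖ := by
  have : expTwoPiI (s * Complex.I) = (Real.exp (-(2 * Real.pi * s)) : ℝ) := by
    rw [expTwoPiI, Complex.ofReal_exp]
    congr 1
    push_cast
    linear_combination (2 * Real.pi * s : ℂ) * Complex.I_mul_I
  rw [this, Complex.norm_real, Real.norm_eq_abs, abs_of_pos (Real.exp_pos _)]

/-- The denominator has phase `-expTwoPiI t`. For `j = 0` the numerator has the opposite phase,
because a shift by `1/2` negates `expTwoPiI t`. For the other two indices the numerator sits on the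
real line translated by `-b i`; its phase `expTwoPiI t ^ 2` and the inverse phase of the twist again
leave a quotient of negative sign. -/
lemma halfRatio_horizontal (hb : 0 < b) (j : Fin 3) (t : ℝ) :
    halfRatio b j (t - b * Complex.I / 2) = -‖halfRatio b j (t - b * Complex.I / 2)‖ := by
  suffices h : ∃ r : ℝ, 0 ≤ r ∧ halfRatio b j (t - b * Complex.I / 2) = -(r : ℂ) by
    obtain ⟨r, hr, h⟩ := h
    rw [h, norm_neg, Complex.norm_real, Real.norm_eq_abs, abs_of_nonneg hr]
  have hd := thetaSq_half_line hb t
  have hE := expTwoPiI_ne_zero t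
  have hbI := expTwoPiI_mul_I (b / 2)
  have htw : expTwoPiI (-(t - b * Complex.I / 2)) =
      (expTwoPiI t)⁻¹ * expTwoPiI ((b / 2 : ℝ) * Complex.I) := by
    rw [← expTwoPiI_neg, ← expTwoPiI_add]; congr 1; push_cast; ring
  fin_cases j
  · have hn := thetaSq_half_line hb (t - 1 / 2)
    have h1 : expTwoPiI ((t - 1 / 2 : ℝ) : ℂ) = -expTwoPiI t := by
      push_cast
      rw [sub_eq_add_neg, expTwoPiI_add, expTwoPiI_neg, expTwoPiI_half]; ring
    have h2 : (((t - 1 / 2 : ℝ) : ℂ) - b * Complex.I / 2) = t - b * Complex.I / 2 - 1 / 2 := by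
      push_cast; ring
    rw [h1, h2] at hn
    refine ⟨‖thetaSq b (t - b * Complex.I / 2 - 1 / 2)‖ / ‖thetaSq b (t - b * Complex.I / 2)‖,
      by positivity, ?_⟩
    change 1 * thetaSq b (t - b * Complex.I / 2 - 1 / 2) / thetaSq b (t - b * Complex.I / 2) = _
    generalize ‖thetaSq b (t - b * Complex.I / 2)‖ = N at hd ⊢
    generalize ‖thetaSq b (t - b * Complex.I / 2 - 1 / 2)‖ = N' at hn ⊢
    rw [hd, hn, neg_mul, neg_neg, one_mul, div_neg, mul_div_mul_left _ _ hE, Complex.ofReal_div]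
  · refine ⟨‖expTwoPiI ((b / 2 : ℝ) * Complex.I)‖ * (nome b)⁻¹ * ‖thetaSq b (t : ℂ)‖ /
      ‖thetaSq b (t - b * Complex.I / 2)‖, by have := nome_pos (b := b); positivity, ?_⟩
    generalize ‖thetaSq b (t - b * Complex.I / 2)‖ = N at hd ⊢
    change expTwoPiI (-(t - b * Complex.I / 2)) *
      thetaSq b (t - b * Complex.I / 2 - b * Complex.I / 2) / thetaSq b (t - b * Complex.I / 2) = _
    rw [htw, hbI, Complex.norm_real, norm_norm]
    generalize ‖expTwoPiI ((b / 2 : ℝ) * Complex.I)‖ = K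
    rw [show (t : ℂ) - b * Complex.I / 2 - b * Complex.I / 2 = t - b * Complex.I by ring,
      thetaSq_sub_I_mul hb, thetaSq_eq_norm_of_conj hb (Complex.conj_ofReal t), hd]
    simp only [Complex.norm_real, norm_norm]
    push_cast
    field_simp
  · refine ⟨‖expTwoPiI ((b / 2 : ℝ) * Complex.I)‖ * (nome b)⁻¹ *
      ‖thetaSq b ((t - 1 / 2 : ℝ) : ℂ)‖ /
      ‖thetaSq b (t - b * Complex.I / 2)‖, by have := nome_pos (b := b); positivity, ?_⟩
    generalize ‖thetaSq b (t - b * Complex.I / 2)‖ = N at hd ⊢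
    change expTwoPiI (-(t - b * Complex.I / 2)) *
      thetaSq b (t - b * Complex.I / 2 - (1 + b * Complex.I) / 2) /
        thetaSq b (t - b * Complex.I / 2) = _
    have h1 : expTwoPiI ((t - 1 / 2 : ℝ) : ℂ) = -expTwoPiI t := by
      push_cast
      rw [sub_eq_add_neg, expTwoPiI_add, expTwoPiI_neg, expTwoPiI_half]; ring
    rw [htw, hbI, Complex.norm_real, norm_norm]
    generalize ‖expTwoPiI ((b / 2 : ℝ) * Complex.I)‖ = K
    rw [show (t : ℂ) - b * Complex.I / 2 - (1 + b * Complex.I) / 2 =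
        ((t - 1 / 2 : ℝ) : ℂ) - b * Complex.I by push_cast; ring,
      thetaSq_sub_I_mul hb, thetaSq_eq_norm_of_conj hb (Complex.conj_ofReal (t - 1 / 2)), hd, h1]
    simp only [Complex.norm_real, norm_norm]
    push_cast
    field_simp

/-- On `Re x = -1/2` the denominator is positive. The numerator is nonpositive for `j = 0, 2`, where
the shift leads to a translate of the imaginary axis, and nonnegative for `j = 1`. The twist is
negative for `j = 1, 2`. Only `j = 2` ends up with a plus sign, which is why `n₃` alone decides the
sign of the coefficient. -/
lemma halfRatio_vertical (hb : 0 < b) (j : Fin 3) (s : ℝ) :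
    halfRatio b j (-(1 / 2) + s * Complex.I) =
      (![-1, -1, 1] j : ℂ) * ‖halfRatio b j (-(1 / 2) + s * Complex.I)‖ := by
  have hc : ∀ s : ℝ, (starRingEnd ℂ) (-(1 / 2) + s * Complex.I) = -(-(1 / 2) + s * Complex.I) - 1 :=
    fun s => by simp [Complex.conj_ofNat]; ring
  have hc' : ∀ s : ℝ, (starRingEnd ℂ) (s * Complex.I) = -(s * Complex.I) := fun s => by simp
  have hd := thetaSq_eq_norm_of_conj_sub hb (hc s)
  have htw : expTwoPiI (-(-(1 / 2) + s * Complex.I)) = -‖expTwoPiI ((-s : ℝ) * Complex.I)‖ := by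
    rw [← expTwoPiI_mul_I, neg_add, neg_neg, expTwoPiI_add, expTwoPiI_half]
    push_cast
    rw [neg_mul, neg_mul, one_mul]
  have htw' : ‖expTwoPiI (-(-(1 / 2) + s * Complex.I))‖ = ‖expTwoPiI ((-s : ℝ) * Complex.I)‖ := by
    rw [htw, norm_neg, Complex.norm_real, norm_norm]
  have hs1 : ∀ s : ℝ, thetaSq b (-(1 / 2) + s * Complex.I - 1 / 2) =
      -‖thetaSq b (-(1 / 2) + s * Complex.I - 1 / 2)‖ := fun s => by
    have : (-(1 / 2) + s * Complex.I - 1 / 2 : ℂ) = s * Complex.I - 1 := by ring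
    rw [this, thetaSq_sub_one]
    exact thetaSq_eq_neg_norm_of_conj hb (hc' s)
  have hs2 : ∀ c : ℂ, (s * Complex.I - b * Complex.I / 2 : ℂ) = (s - b / 2 : ℝ) * Complex.I := by
    intro; push_cast; ring
  fin_cases j
  · change 1 * thetaSq b (-(1 / 2) + s * Complex.I - 1 / 2) / thetaSq b (-(1 / 2) + s * Complex.I) =
      -1 * ((‖1 * thetaSq b (-(1 / 2) + s * Complex.I - 1 / 2) /
        thetaSq b (-(1 / 2) + s * Complex.I)‖ : ℝ) : ℂ)
    rw [norm_div, norm_mul, norm_one, one_mul, one_mul]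
    nth_rewrite 1 [hd, hs1 s]
    push_cast
    ring
  · change expTwoPiI (-(-(1 / 2) + s * Complex.I)) *
      thetaSq b (-(1 / 2) + s * Complex.I - b * Complex.I / 2) /
        thetaSq b (-(1 / 2) + s * Complex.I) = -1 * ((‖expTwoPiI (-(-(1 / 2) + s * Complex.I)) *
      thetaSq b (-(1 / 2) + s * Complex.I - b * Complex.I / 2) /
        thetaSq b (-(1 / 2) + s * Complex.I)‖ : ℝ) : ℂ)
    have hx : (-(1 / 2) + s * Complex.I - b * Complex.I / 2 : ℂ) =
      -(1 / 2) + (s - b / 2 : ℝ) * Complex.I := by push_cast; ring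
    rw [norm_div, norm_mul, htw', htw, hx]
    nth_rewrite 1 [hd, thetaSq_eq_norm_of_conj_sub hb (hc _)]
    push_cast
    ring
  · change expTwoPiI (-(-(1 / 2) + s * Complex.I)) *
      thetaSq b (-(1 / 2) + s * Complex.I - (1 + b * Complex.I) / 2) /
        thetaSq b (-(1 / 2) + s * Complex.I) = 1 * ((‖expTwoPiI (-(-(1 / 2) + s * Complex.I)) *
      thetaSq b (-(1 / 2) + s * Complex.I - (1 + b * Complex.I) / 2) /
        thetaSq b (-(1 / 2) + s * Complex.I)‖ : ℝ) : ℂ)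
    have hx : (-(1 / 2) + s * Complex.I - (1 + b * Complex.I) / 2 : ℂ) =
      -(1 / 2) + (s - b / 2 : ℝ) * Complex.I - 1 / 2 := by push_cast; ring
    rw [norm_div, norm_mul, htw', htw, hx]
    nth_rewrite 1 [hd, hs1]
    push_cast
    ring

lemma halfProd_horizontal (hb : 0 < b) (m : Fin 3 → ℕ) (t : ℝ) :
    halfProd b m (t - b * Complex.I / 2) =
      (-1) ^ (m 0 + m 1 + m 2) * ‖halfProd b m (t - b * Complex.I / 2)‖ := by
  rw [halfProd, norm_prod, Complex.ofReal_prod, Fin.prod_univ_three, Fin.prod_univ_three]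
  simp only [norm_pow, Complex.ofReal_pow]
  nth_rewrite 1 [halfRatio_horizontal hb 0 t, halfRatio_horizontal hb 1 t,
    halfRatio_horizontal hb 2 t]
  rw [neg_pow, neg_pow (‖halfRatio b 1 _‖ : ℂ), neg_pow (‖halfRatio b 2 _‖ : ℂ)]
  ring

lemma halfProd_vertical (hb : 0 < b) (m : Fin 3 → ℕ) (s : ℝ) :
    halfProd b m (-(1 / 2) + s * Complex.I) =
      (-1) ^ (m 0 + m 1) * ‖halfProd b m (-(1 / 2) + s * Complex.I)‖ := by
  rw [halfProd, norm_prod, Complex.ofReal_prod, Fin.prod_univ_three, Fin.prod_univ_three]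
  simp only [norm_pow, Complex.ofReal_pow]
  nth_rewrite 1 [halfRatio_vertical hb 0 s, halfRatio_vertical hb 1 s, halfRatio_vertical hb 2 s]
  simp only [Matrix.cons_val_zero, Matrix.cons_val_one, Matrix.cons_val, mul_pow]
  ring

end HalfProd

/-! ### Antiderivatives of even functions with a single pole -/

section Antiderivative

/-- An even function with a single pole, at the origin, of order at most `2 m + 2`, has an
antiderivative with a pole of order at most `2 m + 1`. -/
lemma exists_antideriv_of_even_numerator {U : Set ℂ} (hU : IsOpen U) (hconv : Convex ℝ U)
    (h0 : (0 : ℂ) ∈ U) (m : ℕ) :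
    ∀ φ : ℂ → ℂ, DifferentiableOn ℂ φ U → (∀ x ∈ U, φ (-x) = φ x) →
      ∃ χ : ℂ → ℂ, DifferentiableOn ℂ χ U ∧
        ∀ x ∈ U, x ≠ 0 → HasDerivAt (fun x => χ x / x ^ (2 * m + 1)) (φ x / x ^ (2 * m + 2)) x := by
  have hnhds : U ∈ 𝓝 (0 : ℂ) := hU.mem_nhds h0
  -- an even function is `φ 0 + x ^ 2 * ψ x` with `ψ` even
  have step : ∀ φ : ℂ → ℂ, DifferentiableOn ℂ φ U → (∀ x ∈ U, φ (-x) = φ x) →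
      ∃ ψ : ℂ → ℂ, DifferentiableOn ℂ ψ U ∧ (∀ x ∈ U, ψ (-x) = ψ x) ∧
        ∀ x, φ x = φ 0 + x ^ 2 * ψ x := by
    intro φ hφ heven
    -- `dslope φ 0 0` is the derivative at the origin, zero for an even function. Applied
    -- repeatedly, this rules out a residue.
    have hd0 : dslope φ 0 0 = 0 := by
      rw [dslope_same]
      have h1 : (fun x => φ (-x)) =ᶠ[𝓝 0] φ := by
        filter_upwards [hnhds] with x hx using heven x hx
      have h2 := h1.deriv_eq
      rw [deriv_comp_neg, neg_zero] at h2
      have h3 : (2 : ℂ) * deriv φ 0 = 0 := by linear_combination -h2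
      simpa using h3
    have heq : ∀ x, φ x = φ 0 + x ^ 2 * dslope (dslope φ 0) 0 x := by
      intro x
      have e1 := sub_smul_dslope φ 0 x
      have e2 := sub_smul_dslope (dslope φ 0) 0 x
      simp only [sub_zero, smul_eq_mul, hd0] at e1 e2
      rw [sq, mul_assoc, e2, e1]
      ring
    refine ⟨dslope (dslope φ 0) 0, ?_, fun x hx => ?_, heq⟩
    · rw [Complex.differentiableOn_dslope hnhds, Complex.differentiableOn_dslope hnhds]
      exact hφ
    · rcases eq_or_ne x 0 with rfl | hx0
      · rw [neg_zero]
      · have e1 := heq x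
        have e2 := heq (-x)
        rw [heven x hx, e1, neg_sq, add_right_inj] at e2
        exact (mul_left_cancel₀ (pow_ne_zero 2 hx0) e2).symm
  induction m with
  | zero =>
    intro φ hφ heven
    obtain ⟨ψ, hψ, -, heq⟩ := step φ hφ heven
    obtain ⟨Ψ, hΨ⟩ := hconv.exists_forall_hasDerivWithinAt hψ
    have hΨ' : ∀ x ∈ U, HasDerivAt Ψ (ψ x) x := fun x hx =>
      (hΨ x hx).hasDerivAt (hU.mem_nhds hx)
    -- An antiderivative of `φ 0 / x ^ 2 + ψ` is `-φ 0 / x + Ψ`, written over the denominator `x`.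
    refine ⟨fun x => -φ 0 + x * Ψ x, fun x hx => ?_, fun x hx hx0 => ?_⟩
    · exact ((differentiableAt_const _).add
        (differentiableAt_id.mul (hΨ' x hx).differentiableAt)).differentiableWithinAt
    · have hd := (((hasDerivAt_id x).mul (hΨ' x hx)).const_add (-φ 0)).div
        ((hasDerivAt_id x).pow (2 * 0 + 1)) (pow_ne_zero _ hx0)
      refine HasDerivAt.congr_deriv (f' := _) (by exact hd) ?_
      rw [heq x]
      simp
      field_simp
      ring
  | succ m ih =>
    intro φ hφ heven
    obtain ⟨ψ, hψ, hψe, heq⟩ := step φ hφ heven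
    obtain ⟨χ, hχ, hχd⟩ := ih ψ hψ hψe
    have hm : ((2 * m + 3 : ℕ) : ℂ) ≠ 0 := Nat.cast_ne_zero.2 (by omega)
    -- The leading term `φ 0 / x ^ (2m + 4)` integrates to `-φ 0 / ((2m + 3) x ^ (2m + 3))`; the
    -- rest is the case `m` for `ψ`.
    refine ⟨fun x => -φ 0 / (2 * m + 3 : ℕ) + x ^ 2 * χ x,
      (differentiableOn_const _).add ((differentiableOn_id.pow 2).mul hχ), fun x hx hx0 => ?_⟩
    have hd1 := ((hasDerivAt_pow (2 * m + 3) x).inv (pow_ne_zero _ hx0)).const_mul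
      (-φ 0 / (2 * m + 3 : ℕ))
    have hd := hd1.add (hχd x hx hx0)
    refine (hd.congr_of_eventuallyEq ?_).congr_deriv ?_
    · filter_upwards [eventually_ne_nhds hx0] with y hy
      simp only [Pi.add_apply, Pi.inv_apply]
      rw [show 2 * (m + 1) + 1 = 2 * m + 3 by ring, pow_add y (2 * m) 3, pow_add y (2 * m) 1]
      field_simp
    · rw [heq x, show 2 * (m + 1) + 2 = 2 * m + 4 by ring,
        show 2 * m + 3 - 1 = 2 * m + 2 by omega,
        pow_add x (2 * m) 3, pow_add x (2 * m) 4, pow_add x (2 * m) 2]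
      field_simp

/-- If the antiderivative of `φ x / x ^ (N + 2)` is `χ x / x ^ (N + 1)`, then `χ` does not vanish
at the origin unless `φ` does. -/
lemma antideriv_numerator_ne_zero {U : Set ℂ} (hU : IsOpen U) (h0 : (0 : ℂ) ∈ U) {N : ℕ}
    {φ χ : ℂ → ℂ} (hφ : DifferentiableOn ℂ φ U) (hχ : DifferentiableOn ℂ χ U) (hφ0 : φ 0 ≠ 0)
    (hd : ∀ x ∈ U, x ≠ 0 → HasDerivAt (fun x => χ x / x ^ (N + 1)) (φ x / x ^ (N + 2)) x) :
    χ 0 ≠ 0 := by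
  intro hχ0
  have hnhds := hU.mem_nhds h0
  have hφc : ContinuousAt φ 0 := (hφ.differentiableAt hnhds).continuousAt
  have hχ' : ContinuousAt (deriv χ) 0 := ((hχ.deriv hU).differentiableAt hnhds).continuousAt
  have hχc : ContinuousAt χ 0 := (hχ.differentiableAt hnhds).continuousAt
  -- The quotient rule with denominators cleared; letting `x → 0` gives `φ 0 = -(N + 1) χ 0`.
  have heq : ∀ x ∈ U, x ≠ 0 → φ x = x * deriv χ x - (N + 1) * χ x := by
    intro x hx hx0
    have h1 := (hχ.differentiableAt (hU.mem_nhds hx)).hasDerivAt.div (hasDerivAt_pow (N + 1) x)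
      (pow_ne_zero _ hx0)
    have h2 := (hd x hx hx0).unique h1
    rw [div_eq_div_iff (pow_ne_zero _ hx0) (pow_ne_zero _ (pow_ne_zero _ hx0))] at h2
    have hne : x ^ (N + 1) * x ^ (N + 1) ≠ 0 := by positivity
    apply mul_right_cancel₀ hne
    rw [Nat.add_sub_cancel] at h2
    push_cast at h2
    linear_combination h2
  have ht1 : Tendsto φ (𝓝[≠] 0) (𝓝 (φ 0)) := hφc.tendsto.mono_left nhdsWithin_le_nhds
  have ht2 : Tendsto (fun x => x * deriv χ x - (N + 1) * χ x) (𝓝[≠] 0)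
      (𝓝 (0 * deriv χ 0 - (N + 1) * χ 0)) :=
    (((continuousAt_id.mul hχ').sub (continuousAt_const.mul hχc)).tendsto).mono_left
      nhdsWithin_le_nhds
  have ht3 : Tendsto φ (𝓝[≠] 0) (𝓝 (0 * deriv χ 0 - (N + 1) * χ 0)) := by
    refine ht2.congr' ?_
    filter_upwards [nhdsWithin_le_nhds hnhds, self_mem_nhdsWithin] with x hx hx0
    exact (heq x hx hx0).symm
  have := tendsto_nhds_unique ht1 ht3
  rw [hχ0] at this
  apply hφ0
  rw [this]; ring

end Antiderivative

/-! ### Quasi-periods of the antiderivative -/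

section QuasiPeriods

variable {b : ℝ}

lemma thetaOdd_ne_zero_of_mem_doubleRect (hb : 0 < b) {x : ℂ} (hx : x ∈ doubleRect b)
    (h0 : x ≠ 0) : thetaOdd b x ≠ 0 :=
  fun h => h0 ((thetaOdd_eq_zero_iff_of_mem_doubleRect hb hx).1 h)

theorem exists_antideriv_halfProd (hb : 0 < b) {m : Fin 3 → ℕ} {M : ℕ}
    (hm : ∑ j, m j = M + 1) :
    ∃ χ : ℂ → ℂ, DifferentiableOn ℂ χ (doubleRect b) ∧ χ 0 ≠ 0 ∧
      ∀ x ∈ doubleRect b, x ≠ 0 →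
        HasDerivAt (fun x => χ x / x ^ (2 * M + 1)) (halfProd b m x) x := by
  obtain ⟨φ, hφ, hφ0, heven, heq⟩ := exists_halfProd_eq_div hb m
  rw [hm] at heq
  obtain ⟨χ, hχ, hd⟩ := exists_antideriv_of_even_numerator isOpen_doubleRect convex_doubleRect
    (zero_mem_doubleRect hb) M φ hφ heven
  refine ⟨χ, hχ, antideriv_numerator_ne_zero (N := 2 * M) isOpen_doubleRect
    (zero_mem_doubleRect hb) hφ hχ hφ0 hd, fun x hx hx0 => ?_⟩
  rw [heq x hx]
  exact hd x hx hx0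

/-- The points that stay in `U` under translation by `a` form a convex set without `0` and `-a`. The
difference has zero derivative on this connected set although `U` itself contains the pole. -/
lemma exists_forall_sub_eq_const {A h : ℂ → ℂ} {U : Set ℂ}
    (hA : ∀ x ∈ U, x ≠ 0 → HasDerivAt A (h x) x) (a : ℂ) (hper : ∀ x, h (x + a) = h x)
    (hVo : IsOpen {x | x ∈ U ∧ x + a ∈ U}) (hVc : Convex ℝ {x | x ∈ U ∧ x + a ∈ U})
    (h0 : (0 : ℂ) ∉ {x | x ∈ U ∧ x + a ∈ U}) (h0' : -a ∉ {x | x ∈ U ∧ x + a ∈ U}) :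
    ∃ E : ℂ, ∀ x ∈ U, x + a ∈ U → A (x + a) - A x = E := by
  set V := {x | x ∈ U ∧ x + a ∈ U} with hV
  have hd : ∀ x ∈ V, HasDerivAt (fun x => A (x + a) - A x) 0 x := by
    intro x hx
    have hx0 : x ≠ 0 := fun h => h0 (h ▸ hx)
    have hxa : x + a ≠ 0 := fun h => h0' (eq_neg_of_add_eq_zero_left h ▸ hx)
    have := ((hA _ hx.2 hxa).comp_add_const x a).sub (hA x hx.1 hx0)
    rwa [hper, sub_self] at this
  obtain ⟨E, hE⟩ := hVo.exists_is_const_of_deriv_eq_zero hVc.isPreconnected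
    (fun x hx => (hd x hx).differentiableAt.differentiableWithinAt) (fun x hx => (hd x hx).deriv)
  exact ⟨E, fun x hx hx' => hE x (And.intro hx hx')⟩

lemma convex_inter_translate {U : Set ℂ} (hU : Convex ℝ U) (a : ℂ) :
    Convex ℝ {x | x ∈ U ∧ x + a ∈ U} := by
  have := hU.inter (hU.translate_preimage_left a)
  exact this

lemma isOpen_inter_translate {U : Set ℂ} (hU : IsOpen U) (a : ℂ) :
    IsOpen {x | x ∈ U ∧ x + a ∈ U} :=
  hU.inter (hU.preimage (continuous_id.add continuous_const))

lemma ne_zero_of_re_ne_intCast {x : ℂ} (hb : 0 < b) (h : ∀ k : ℤ, x.re ≠ k) :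
    thetaOdd b x ≠ 0 := by
  intro h0
  obtain ⟨k, l, rfl⟩ := (thetaOdd_eq_zero_iff hb x).1 h0
  exact h k (by simp)

lemma ne_zero_of_im_ne_intCast_mul {x : ℂ} (hb : 0 < b) (h : ∀ k : ℤ, x.im ≠ k * b) :
    thetaOdd b x ≠ 0 := by
  intro h0
  obtain ⟨k, l, rfl⟩ := (thetaOdd_eq_zero_iff hb x).1 h0
  exact h l (by simp)

lemma intCast_ne_of_four_mul {r : ℝ} {c : ℤ} (h : 4 * r = c) (hc : ¬ (4 ∣ c)) (k : ℤ) :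
    r ≠ k := by
  rintro rfl
  exact hc ⟨k, by exact_mod_cast h.symm⟩

/-- A quarter point of the edge, away from all zeros and poles; it makes the integral over the edge
strictly positive. -/
lemma halfProd_ne_zero_horizontal (hb : 0 < b) (m : Fin 3 → ℕ) :
    halfProd b m ((1 / 4 : ℝ) - b * Complex.I / 2) ≠ 0 := by
  refine halfProd_ne_zero (ne_zero_of_re_ne_intCast hb (intCast_ne_of_four_mul (c := 1) ?_ ?_))
    fun j => ?_
  · simp
  · norm_num
  · fin_cases j
    · refine ne_zero_of_re_ne_intCast hb (intCast_ne_of_four_mul (c := -1) ?_ ?_)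
      · simp [unitHalfPeriod]; norm_num
      · norm_num
    · refine ne_zero_of_re_ne_intCast hb (intCast_ne_of_four_mul (c := 1) ?_ ?_)
      · simp [unitHalfPeriod]
      · norm_num
    · refine ne_zero_of_re_ne_intCast hb (intCast_ne_of_four_mul (c := -1) ?_ ?_)
      · simp [unitHalfPeriod]; norm_num
      · norm_num

lemma halfProd_ne_zero_vertical (hb : 0 < b) (m : Fin 3 → ℕ) :
    halfProd b m (-(1 / 2) + (b / 4 : ℝ) * Complex.I) ≠ 0 := by
  have key : ∀ {r : ℝ} {c : ℤ}, 4 * r = c * b → ¬ (4 ∣ c) → ∀ k : ℤ, r ≠ k * b := by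
    intro r c h hc k hk
    refine intCast_ne_of_four_mul (r := r / b) (c := c) ?_ hc k ?_
    · field_simp; linarith
    · rw [hk]; field_simp
  refine halfProd_ne_zero (ne_zero_of_im_ne_intCast_mul hb (key (c := 1) ?_ ?_)) fun j => ?_
  · simp; ring
  · norm_num
  · fin_cases j
    · refine ne_zero_of_im_ne_intCast_mul hb (key (c := 1) ?_ ?_)
      · simp [unitHalfPeriod]; ring
      · norm_num
    · refine ne_zero_of_im_ne_intCast_mul hb (key (c := -1) ?_ ?_)
      · simp [unitHalfPeriod]; ring
      · norm_num
    · refine ne_zero_of_im_ne_intCast_mul hb (key (c := -1) ?_ ?_)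
      · simp [unitHalfPeriod]; ring
      · norm_num

lemma continuousOn_halfProd (hb : 0 < b) (m : Fin 3 → ℕ) :
    ContinuousOn (halfProd b m) (doubleRect b \ {0}) := fun _ hx =>
  (differentiableAt_halfProd hb m
    (thetaOdd_ne_zero_of_mem_doubleRect hb hx.1 hx.2)).continuousAt.continuousWithinAt

/-- The quasi-periods of an antiderivative of `halfProd`, up to positive factors. -/
theorem exists_quasiPeriods (hb : 0 < b) (m : Fin 3 → ℕ) {A : ℂ → ℂ}
    (hA : ∀ x ∈ doubleRect b, x ≠ 0 → HasDerivAt A (halfProd b m x) x) :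
    ∃ I₁ I₂ : ℝ, 0 < I₁ ∧ 0 < I₂ ∧
      (∀ x ∈ doubleRect b, x + 1 ∈ doubleRect b →
        A (x + 1) - A x = (-1) ^ (m 0 + m 1 + m 2) * I₁) ∧
      ∀ x ∈ doubleRect b, x + b * Complex.I ∈ doubleRect b →
        A (x + b * Complex.I) - A x = (-1) ^ (m 0 + m 1) * I₂ * Complex.I := by
  obtain ⟨E₁, hE₁⟩ := exists_forall_sub_eq_const hA 1 (halfProd_add_one m)
    (isOpen_inter_translate isOpen_doubleRect 1) (convex_inter_translate convex_doubleRect 1)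
    (fun h => by have := h.2; simp [mem_doubleRect] at this)
    (fun h => by have := h.1; simp [mem_doubleRect] at this)
  obtain ⟨E₂, hE₂⟩ := exists_forall_sub_eq_const hA (b * Complex.I) (halfProd_add_I_mul hb m)
    (isOpen_inter_translate isOpen_doubleRect _) (convex_inter_translate convex_doubleRect _)
    (fun h => by have := h.2; simp [mem_doubleRect] at this)
    (fun h => by have := h.1; simp [mem_doubleRect] at this)
  have hmem₁ : ∀ t ∈ Icc (-(1 / 2) : ℝ) (1 / 2),
      (t - b * Complex.I / 2 : ℂ) ∈ doubleRect b \ {0} := by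
    intro t ht
    refine ⟨?_, fun h => ?_⟩
    · rw [mem_doubleRect]
      simp
      exact ⟨⟨by linarith [ht.1], by linarith [ht.2]⟩, by linarith, by linarith⟩
    · have := congrArg Complex.im h
      simp [hb.ne'] at this
  have hmem₂ : ∀ s ∈ Icc (-(b / 2) : ℝ) (b / 2),
      (-(1 / 2) + s * Complex.I : ℂ) ∈ doubleRect b \ {0} := by
    intro s hs
    refine ⟨?_, fun h => ?_⟩
    · rw [mem_doubleRect]
      simp
      exact ⟨⟨by norm_num, by norm_num⟩, by linarith [hs.1], by linarith [hs.2]⟩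
    · have := congrArg Complex.re h
      simp at this
  have hc₁ : ContinuousOn (fun t : ℝ => halfProd b m (t - b * Complex.I / 2))
      (Icc (-(1 / 2)) (1 / 2)) :=
    (continuousOn_halfProd hb m).comp (by fun_prop) hmem₁
  have hc₂ : ContinuousOn (fun s : ℝ => halfProd b m (-(1 / 2) + s * Complex.I))
      (Icc (-(b / 2)) (b / 2)) :=
    (continuousOn_halfProd hb m).comp (by fun_prop) hmem₂
  -- The quasi-periods are computed along the edges `Im x = -b/2` and `Re x = -1/2`, which avoid the
  -- pole and on which `halfProd` is its modulus times a fixed sign.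
  refine ⟨∫ t in (-(1 / 2) : ℝ)..(1 / 2), ‖halfProd b m (t - b * Complex.I / 2)‖,
    ∫ s in (-(b / 2) : ℝ)..(b / 2), ‖halfProd b m (-(1 / 2) + s * Complex.I)‖, ?_, ?_, ?_, ?_⟩
  · refine intervalIntegral.integral_pos (by norm_num) hc₁.norm (fun _ _ => norm_nonneg _)
      ⟨1 / 4, by constructor <;> norm_num, norm_pos_iff.2 (halfProd_ne_zero_horizontal hb m)⟩
  · refine intervalIntegral.integral_pos (by linarith) hc₂.norm (fun _ _ => norm_nonneg _)
      ⟨b / 4, by constructor <;> linarith, norm_pos_iff.2 (halfProd_ne_zero_vertical hb m)⟩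
  · intro x hx hx1
    have hle : (-(1 / 2) : ℝ) ≤ 1 / 2 := by norm_num
    have hint := intervalIntegral.integral_eq_sub_of_hasDerivAt
      (f := fun t : ℝ => A (t - b * Complex.I / 2))
      (f' := fun t : ℝ => halfProd b m (t - b * Complex.I / 2))
      (a := -(1 / 2)) (b := 1 / 2) (fun t ht => by
        rw [uIcc_of_le hle] at ht
        have h := hmem₁ t ht
        exact ((hA _ h.1 h.2).comp_sub_const (t : ℂ) _).comp_ofReal)
      (hc₁.mono (by rw [uIcc_of_le hle])).intervalIntegrable
    have h1 := hmem₁ (-(1 / 2)) ⟨le_rfl, hle⟩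
    have h2 := hmem₁ (1 / 2) ⟨hle, le_rfl⟩
    have hx2 : (((1 / 2 : ℝ) : ℂ) - b * Complex.I / 2) =
      ((-(1 / 2) : ℝ) : ℂ) - b * Complex.I / 2 + 1 := by push_cast; ring
    rw [hx2] at h2 hint
    rw [hE₁ x hx hx1, ← hE₁ _ h1.1 h2.1, ← hint, ← intervalIntegral.integral_ofReal,
      ← intervalIntegral.integral_const_mul]
    exact intervalIntegral.integral_congr fun t _ => halfProd_horizontal hb m t
  · intro x hx hx1
    have hle : (-(b / 2) : ℝ) ≤ b / 2 := by linarith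
    have hint := intervalIntegral.integral_eq_sub_of_hasDerivAt
      (f := fun s : ℝ => A (-(1 / 2) + s * Complex.I))
      (f' := fun s : ℝ => halfProd b m (-(1 / 2) + s * Complex.I) * Complex.I)
      (a := -(b / 2)) (b := b / 2) (fun s hs => by
        rw [uIcc_of_le hle] at hs
        have h := hmem₂ s hs
        have hi : HasDerivAt (fun w : ℂ => -(1 / 2) + w * Complex.I) Complex.I (s : ℂ) := by
          simpa using ((hasDerivAt_id (s : ℂ)).mul_const Complex.I).const_add (-(1 / 2))
        have hA' : HasDerivAt A _ (-(1 / 2) + (s : ℂ) * Complex.I) := hA _ h.1 h.2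
        exact (hA'.comp (s : ℂ) hi).comp_ofReal)
      ((hc₂.mono (by rw [uIcc_of_le hle])).mul continuousOn_const).intervalIntegrable
    have h1 := hmem₂ (-(b / 2)) ⟨le_rfl, hle⟩
    have h2 := hmem₂ (b / 2) ⟨hle, le_rfl⟩
    have hx2 : (-(1 / 2) + ((b / 2 : ℝ) : ℂ) * Complex.I) =
      -(1 / 2) + ((-(b / 2) : ℝ) : ℂ) * Complex.I + b * Complex.I := by push_cast; ring
    rw [hx2] at h2 hint
    rw [hE₂ x hx hx1, ← hE₂ _ h1.1 h2.1, ← hint, ← intervalIntegral.integral_ofReal,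
      intervalIntegral.integral_mul_const, ← intervalIntegral.integral_const_mul]
    congr 1
    exact intervalIntegral.integral_congr fun s _ => halfProd_vertical hb m s

end QuasiPeriods

/-! ### Cutoffs and Wirtinger derivatives -/

section Cutoff

/-- A continuous cutoff `k` of `1` between `M` and `M + δ`, with its antiderivative `K`. -/
structure IsCutoff (M δ c : ℝ) (k K : ℝ → ℝ) : Prop where
  continuous : Continuous k
  hasDerivAt : ∀ s, HasDerivAt K (k s) s
  nonneg : ∀ s, 0 ≤ k s
  le_one : ∀ s, k s ≤ 1
  eq_one : ∀ s ≤ M, k s = 1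
  eq_self : ∀ s ≤ M, K s = s
  eq_zero : ∀ s, M + δ ≤ s → k s = 0
  eq_const : ∀ s, M + δ ≤ s → K s = c
  le_const : M ≤ c
  const_le : c ≤ M + δ

lemma exists_isCutoff {M δ : ℝ} (hM : 0 ≤ M) (hδ : 0 < δ) :
    ∃ (c : ℝ) (k K : ℝ → ℝ), IsCutoff M δ c k K := by
  -- A piecewise linear ramp: continuity of `k` suffices, since only its primitive `K` is
  -- differentiated.
  set k : ℝ → ℝ := fun s => max 0 (min 1 ((M + δ - s) / δ)) with hk
  set K : ℝ → ℝ := fun s => ∫ t in (0 : ℝ)..s, k t with hK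
  have hkc : Continuous k := by fun_prop
  have hki : ∀ a b, IntervalIntegrable k volume a b := fun a b => hkc.intervalIntegrable a b
  have h1 : ∀ s ≤ M, k s = 1 := by
    intro s hs
    have : 1 ≤ (M + δ - s) / δ := by rw [le_div_iff₀ hδ]; linarith
    simp [hk, this]
  have h0 : ∀ s, M + δ ≤ s → k s = 0 := by
    intro s hs
    have : (M + δ - s) / δ ≤ 0 := div_nonpos_of_nonpos_of_nonneg (by linarith) hδ.le
    simp [hk, this]
  have hn : ∀ s, 0 ≤ k s := fun s => le_max_left _ _
  have hl : ∀ s, k s ≤ 1 := fun s => max_le zero_le_one (min_le_left _ _)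
  have hself : ∀ s ≤ M, K s = s := by
    intro s hs
    have : ∫ t in (0 : ℝ)..s, k t = ∫ t in (0 : ℝ)..s, (1 : ℝ) := by
      refine intervalIntegral.integral_congr fun t ht => h1 t ?_
      exact (mem_uIcc.1 ht).elim (fun h => h.2.trans hs) (fun h => h.2.trans hM)
    simp [hK, this]
  have hadd : ∀ s, K s = M + ∫ t in M..s, k t := by
    intro s
    have h := intervalIntegral.integral_add_adjacent_intervals (hki 0 M) (hki M s)
    have hM : ∫ t in (0 : ℝ)..M, k t = M := hself M le_rfl
    rw [hM] at h
    exact h.symm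
  refine ⟨K (M + δ), k, K, hkc, fun s => hkc.integral_hasStrictDerivAt 0 s |>.hasDerivAt, hn, hl, h1,
    hself, h0, ?_, ?_, ?_⟩
  · intro s hs
    have : ∫ t in (M + δ)..s, k t = 0 := by
      rw [intervalIntegral.integral_congr (g := fun _ => (0 : ℝ)) fun t ht => ?_]
      · simp
      · rw [uIcc_of_le hs] at ht
        exact h0 t ht.1
    have h2 := intervalIntegral.integral_add_adjacent_intervals (hki 0 (M + δ)) (hki (M + δ) s)
    rw [this, add_zero] at h2
    exact h2.symm
  · rw [hadd]
    have := intervalIntegral.integral_nonneg (f := k) (μ := volume) (a := M) (b := M + δ)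
      (by linarith) fun t _ => hn t
    linarith
  · rw [hadd]
    have := intervalIntegral.integral_mono_on (f := k) (g := fun _ => (1 : ℝ)) (μ := volume)
      (a := M) (b := M + δ) (by linarith) (hki _ _) (by simp) fun t _ => hl t
    simp at this
    linarith

/-- The real-linear map `v ↦ α v + β conj v`. -/
noncomputable def wirtingerCLM (α β : ℂ) : ℂ →L[ℝ] ℂ :=
  mulRealCLM α + (mulRealCLM β).comp Complex.conjCLE.toContinuousLinearMap

lemma wirtingerCLM_apply (α β v : ℂ) :
    wirtingerCLM α β v = α * v + β * (starRingEnd ℂ) v := rfl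

/-- This combination is the integrand in Green's formula on a rectangle; it sees only the
antiholomorphic coefficient. -/
lemma wirtingerCLM_greenForm (α β : ℂ) :
    Complex.I • wirtingerCLM α β 1 - wirtingerCLM α β Complex.I = 2 * Complex.I * β := by
  simp only [wirtingerCLM_apply, smul_eq_mul, map_one, Complex.conj_I]
  ring

lemma HasDerivAt.hasFDerivAt_wirtinger {f : ℂ → ℂ} {f' x : ℂ} (h : HasDerivAt f f' x) :
    HasFDerivAt f (wirtingerCLM f' 0) x := by
  refine (h.hasFDerivAt.restrictScalars ℝ).congr_fderiv ?_
  ext v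
  simp [wirtingerCLM_apply, mul_comm]

/-- Truncation of `w ↦ conj w`, the antiholomorphic primitive of a truncated area density. -/
noncomputable def truncConj (M : ℝ) (K : ℝ → ℝ) (w : ℂ) : ℂ :=
  if ‖w‖ ^ 2 ≤ M then (starRingEnd ℂ) w else K (‖w‖ ^ 2) / w

variable {M δ c : ℝ} {k K : ℝ → ℝ}

lemma IsCutoff.truncConj_eq (h : IsCutoff M δ c k K) {w : ℂ} (hw : w ≠ 0) :
    truncConj M K w = K (‖w‖ ^ 2) / w := by
  rw [truncConj]
  split_ifs with hM
  · rw [h.eq_self _ hM, eq_div_iff hw, mul_comm, Complex.mul_conj, Complex.normSq_eq_norm_sq]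
  · rfl

/-- Near `0` the function is `conj w`; elsewhere it is `K(|w| ^ 2) / w`, whose antiholomorphic
derivative is `k(|w| ^ 2) w / w`. The coefficient `α` plays no role in Green's formula, hence is
left existential. -/
lemma IsCutoff.hasFDerivAt_truncConj (h : IsCutoff M δ c k K) (hM : 0 < M) (w : ℂ) :
    ∃ α : ℂ, HasFDerivAt (truncConj M K) (wirtingerCLM α (k (‖w‖ ^ 2))) w := by
  rcases eq_or_ne w 0 with rfl | hw
  · refine ⟨0, ?_⟩
    have hk : k (‖(0 : ℂ)‖ ^ 2) = 1 := h.eq_one _ (by simpa using hM.le)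
    have hd : HasFDerivAt (fun w : ℂ => (starRingEnd ℂ) w) (wirtingerCLM 0 1) 0 := by
      refine Complex.conjCLE.hasFDerivAt.congr_fderiv ?_
      ext v
      simp [wirtingerCLM_apply]
    rw [hk, Complex.ofReal_one]
    refine hd.congr_of_eventuallyEq ?_
    have : ∀ᶠ w : ℂ in 𝓝 0, ‖w‖ ^ 2 < M := by
      have hc : Continuous fun w : ℂ => ‖w‖ ^ 2 := by fun_prop
      exact (hc.tendsto 0).eventually_lt_const (by simpa using hM)
    filter_upwards [this] with v hv
    rw [truncConj, if_pos hv.le]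
  · have hs : HasFDerivAt (fun w : ℂ => ‖w‖ ^ 2) (2 • (innerSL ℝ w)) w :=
      (hasStrictFDerivAt_norm_sq w).hasFDerivAt
    have hK : HasFDerivAt (fun w : ℂ => K (‖w‖ ^ 2)) (k (‖w‖ ^ 2) • (2 • (innerSL ℝ w))) w :=
      (h.hasDerivAt _).comp_hasFDerivAt w hs
    have hKc : HasFDerivAt (fun w : ℂ => (K (‖w‖ ^ 2) : ℂ))
        (Complex.ofRealCLM.comp (k (‖w‖ ^ 2) • (2 • (innerSL ℝ w)))) w :=
      Complex.ofRealCLM.hasFDerivAt.comp w hK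
    have hinv := (hasDerivAt_inv hw).hasFDerivAt_wirtinger
    have hmul := hKc.mul hinv
    refine ⟨k (‖w‖ ^ 2) * (starRingEnd ℂ) w / w - K (‖w‖ ^ 2) / w ^ 2, ?_⟩
    refine (hmul.congr_of_eventuallyEq ?_).congr_fderiv ?_
    · filter_upwards [eventually_ne_nhds hw] with v hv
      rw [h.truncConj_eq hv, div_eq_mul_inv]
      rfl
    · refine ContinuousLinearMap.ext fun v => ?_
      have hin : ((inner ℝ w v : ℝ) : ℂ) * 2 =
          (starRingEnd ℂ) w * v + w * (starRingEnd ℂ) v := by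
        rw [Complex.inner]
        have := Complex.add_conj ((starRingEnd ℂ) w * v)
        rw [map_mul, Complex.conj_conj] at this
        rw [this]
        push_cast
        rw [mul_comm v]
        ring
      simp only [wirtingerCLM_apply, add_apply, smul_apply,
        ContinuousLinearMap.comp_apply, Complex.ofRealCLM_apply, innerSL_apply_apply, smul_eq_mul,
        nsmul_eq_mul, Complex.ofReal_mul]
      push_cast
      field_simp
      linear_combination (k (‖w‖ ^ 2) * w : ℂ) * hin

end Cutoff

/-! ### The truncated area of a quasi-periodic function with a single pole -/

section GreenFormula

variable {b : ℝ}

lemma integral_closedRect_eq (hb : 0 < b) {f : ℂ → ℂ} (hf : ContinuousOn f (closedRect b)) :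
    ∫ x in (-(1 / 2) : ℝ)..(1 / 2), ∫ y in (-(b / 2))..(b / 2), f (x + y * Complex.I) =
      ∫ z in closedRect b, f z := by
  have hpre : closedRect b = Complex.measurableEquivRealProd ⁻¹'
      (Icc (-(1 / 2)) (1 / 2) ×ˢ Icc (-(b / 2)) (b / 2)) := rfl
  have h1 := Complex.volume_preserving_equiv_real_prod.setIntegral_preimage_emb
    Complex.measurableEquivRealProd.measurableEmbedding
    (fun p : ℝ × ℝ => f (p.1 + p.2 * Complex.I))
    (Icc (-(1 / 2)) (1 / 2) ×ˢ Icc (-(b / 2)) (b / 2))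
  rw [← hpre] at h1
  have h2 : ∫ z in closedRect b, f z = ∫ z in closedRect b,
      (fun p : ℝ × ℝ => f (p.1 + p.2 * Complex.I)) (Complex.measurableEquivRealProd z) := by
    congr 1
    ext z
    simp [Complex.measurableEquivRealProd_apply, Complex.re_add_im]
  have hmaps : MapsTo (fun p : ℝ × ℝ => (p.1 + p.2 * Complex.I : ℂ))
      (Icc (-(1 / 2)) (1 / 2) ×ˢ Icc (-(b / 2)) (b / 2)) (closedRect b) := by
    rintro ⟨x, y⟩ ⟨hx, hy⟩
    simp only [closedRect, Complex.mem_reProdIm]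
    simpa using And.intro hx hy
  have hint : IntegrableOn (fun p : ℝ × ℝ => f (p.1 + p.2 * Complex.I))
      (Icc (-(1 / 2)) (1 / 2) ×ˢ Icc (-(b / 2)) (b / 2)) (volume.prod volume) := by
    rw [← Measure.volume_eq_prod]
    exact (hf.comp (by fun_prop) hmaps).integrableOn_compact (isCompact_Icc.prod isCompact_Icc)
  rw [h2, h1, Measure.volume_eq_prod, setIntegral_prod _ hint,
    intervalIntegral.integral_of_le (by norm_num), ← integral_Icc_eq_integral_Ioc]
  refine setIntegral_congr_fun measurableSet_Icc fun x _ => ?_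
  simp only
  rw [intervalIntegral.integral_of_le (by linarith), ← integral_Icc_eq_integral_Ioc]

/-- `a` is a function with derivative `a'` near the closed cell, with a pole of order `N + 1` at
the interior point `x₀` and no other pole, whose values on opposite edges of the cell differ by
the constants `E₁` and `E₂`. -/
structure IsQuasiPeriodicPole (b : ℝ) (x₀ : ℂ) (N : ℕ) (a a' : ℂ → ℂ) (E₁ E₂ : ℂ) : Prop where
  pos : 0 < b
  mem : x₀ ∈ cellRect b
  exists_numerator : ∃ X : ℂ → ℂ, DifferentiableOn ℂ X ((· - x₀) ⁻¹' doubleRect b) ∧ X x₀ ≠ 0 ∧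
    ∀ x, x - x₀ ∈ doubleRect b → x ≠ x₀ → a x = X x / (x - x₀) ^ (N + 1)
  hasDerivAt : ∀ x, x - x₀ ∈ doubleRect b → x ≠ x₀ → HasDerivAt a (a' x) x
  add_one : ∀ x ∈ closedRect b, x + 1 ∈ closedRect b → a (x + 1) = a x + E₁
  deriv_add_one : ∀ x, a' (x + 1) = a' x
  add_I_mul : ∀ x ∈ closedRect b, x + b * Complex.I ∈ closedRect b →
    a (x + b * Complex.I) = a x + E₂
  deriv_add_I_mul : ∀ x, a' (x + b * Complex.I) = a' x

/-- The logarithmic derivative of the odd theta function. -/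
noncomputable def thetaLogDeriv (b : ℝ) (x : ℂ) : ℂ := deriv (thetaOdd b) x / thetaOdd b x

lemma thetaLogDeriv_add_one (x : ℂ) : thetaLogDeriv b (x + 1) = thetaLogDeriv b x := by
  have h : (fun x => thetaOdd b (x + 1)) = fun x => -thetaOdd b x :=
    funext fun x => thetaOdd_add_one x
  have hd := congrFun (congrArg deriv h) x
  rw [deriv_comp_add_const, deriv.fun_neg] at hd
  rw [thetaLogDeriv, hd, thetaOdd_add_one, neg_div_neg_eq, thetaLogDeriv]

/-- The logarithmic derivative turns the multiplier into an additive constant. In Green's formula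
this `-2πi` becomes the area `π (N + 1) c` attributed to the pole. -/
lemma thetaLogDeriv_add_I_mul (hb : 0 < b) {x : ℂ} (hx : thetaOdd b x ≠ 0) :
    thetaLogDeriv b (x + b * Complex.I) = thetaLogDeriv b x - 2 * Real.pi * Complex.I := by
  have h : (fun x => thetaOdd b (x + b * Complex.I)) =
      fun x => -(Complex.exp (Real.pi * b) * expTwoPiI (-x)) * thetaOdd b x :=
    funext fun x => thetaOdd_add_I_mul hb x
  have he : HasDerivAt (fun x => expTwoPiI (-x)) (-(2 * Real.pi * Complex.I) * expTwoPiI (-x)) x := by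
    have := ((hasDerivAt_id x).neg.const_mul (2 * Real.pi * Complex.I : ℂ)).cexp
    refine HasDerivAt.congr_deriv (f := fun x => expTwoPiI (-x)) (by exact this) ?_
    simp [expTwoPiI]
    ring
  have hd1 := ((he.const_mul (Complex.exp (Real.pi * b))).neg.mul
    ((differentiable_thetaOdd hb) x).hasDerivAt).deriv
  have hd := congrFun (congrArg deriv h) x
  rw [deriv_comp_add_const] at hd
  rw [thetaLogDeriv, hd, thetaOdd_add_I_mul hb, thetaLogDeriv]
  erw [hd1]
  have h1 := expTwoPiI_ne_zero (-x)
  have h2 := Complex.exp_ne_zero (Real.pi * b)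
  simp only [Pi.neg_apply]
  field_simp
  ring

namespace IsQuasiPeriodicPole

variable {x₀ : ℂ} {N : ℕ} {a a' : ℂ → ℂ} {E₁ E₂ : ℂ}

lemma sub_mem (h : IsQuasiPeriodicPole b x₀ N a a' E₁ E₂) {x : ℂ} (hx : x ∈ closedRect b) :
    x - x₀ ∈ doubleRect b := sub_mem_doubleRect hx h.mem

lemma isOpen_nbhd : IsOpen ((· - x₀) ⁻¹' doubleRect b) :=
  isOpen_doubleRect.preimage (continuous_id.sub continuous_const)

lemma nbhd_mem_nhds {x : ℂ} (hx : x - x₀ ∈ doubleRect b) : (· - x₀) ⁻¹' doubleRect b ∈ 𝓝 x :=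
  isOpen_nbhd.mem_nhds hx

lemma pole_mem (h : IsQuasiPeriodicPole b x₀ N a a' E₁ E₂) : x₀ - x₀ ∈ doubleRect b := by
  rw [sub_self]; exact zero_mem_doubleRect h.pos

lemma eventually_lt_norm (h : IsQuasiPeriodicPole b x₀ N a a' E₁ E₂) (C : ℝ) :
    ∀ᶠ x in 𝓝[≠] x₀, C < ‖a x‖ ^ 2 := by
  obtain ⟨X, hX, hX0, heq⟩ := h.exists_numerator
  have hXc : ContinuousAt X x₀ :=
    (hX.differentiableAt (nbhd_mem_nhds h.pole_mem)).continuousAt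
  have h1 : Tendsto (fun x => ‖X x‖ ^ 2) (𝓝[≠] x₀) (𝓝 (‖X x₀‖ ^ 2)) :=
    ((hXc.norm.pow 2).tendsto).mono_left nhdsWithin_le_nhds
  have h2 : Tendsto (fun x => (‖(x - x₀) ^ (N + 1)‖ ^ 2)⁻¹) (𝓝[≠] x₀) atTop := by
    refine Tendsto.comp tendsto_inv_nhdsGT_zero (tendsto_nhdsWithin_iff.2 ⟨?_, ?_⟩)
    · have : Continuous fun x : ℂ => ‖(x - x₀) ^ (N + 1)‖ ^ 2 := by fun_prop
      have h := this.tendsto x₀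
      simp only [sub_self, ne_eq, Nat.add_eq_zero_iff, one_ne_zero, and_false, not_false_eq_true,
        zero_pow, norm_zero, OfNat.ofNat_ne_zero] at h
      exact h.mono_left nhdsWithin_le_nhds
    · filter_upwards [self_mem_nhdsWithin] with x hx
      have : x - x₀ ≠ 0 := sub_ne_zero.2 hx
      exact pow_pos (norm_pos_iff.2 (pow_ne_zero _ this)) 2
  have h3 := h1.pos_mul_atTop (by positivity) h2
  filter_upwards [h3.eventually_gt_atTop C, self_mem_nhdsWithin,
    nhdsWithin_le_nhds (nbhd_mem_nhds h.pole_mem)] with x hx hx0 hxO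
  rw [heq x hxO hx0, norm_div, div_pow, div_eq_mul_inv]
  exact hx

lemma differentiableAt_deriv (h : IsQuasiPeriodicPole b x₀ N a a' E₁ E₂) {x : ℂ}
    (hx : x - x₀ ∈ doubleRect b) (hx0 : x ≠ x₀) : DifferentiableAt ℂ a' x := by
  have hU : IsOpen ((· - x₀) ⁻¹' doubleRect b ∩ {x₀}ᶜ) := isOpen_nbhd.inter isOpen_compl_singleton
  have hd : DifferentiableOn ℂ a ((· - x₀) ⁻¹' doubleRect b ∩ {x₀}ᶜ) := fun y hy =>
    (h.hasDerivAt y hy.1 hy.2).differentiableAt.differentiableWithinAt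
  have hd' : DifferentiableOn ℂ a' ((· - x₀) ⁻¹' doubleRect b ∩ {x₀}ᶜ) :=
    (hd.deriv hU).congr fun y hy => (h.hasDerivAt y hy.1 hy.2).deriv.symm
  exact hd'.differentiableAt (hU.mem_nhds ⟨hx, hx0⟩)

/-- The truncated area density. -/
noncomputable def density (x₀ : ℂ) (a a' : ℂ → ℂ) (k : ℝ → ℝ) (x : ℂ) : ℝ :=
  open Classical in if x = x₀ then 0 else k (‖a x‖ ^ 2) * ‖a' x‖ ^ 2

variable {M δ c : ℝ} {k K : ℝ → ℝ}

/-- Near the pole `‖a‖ ^ 2` exceeds `M + δ`, so the cutoff makes the density vanish identically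
there. -/
lemma continuousAt_density (h : IsQuasiPeriodicPole b x₀ N a a' E₁ E₂)
    (hk : IsCutoff M δ c k K) {x : ℂ} (hx : x - x₀ ∈ doubleRect b) :
    ContinuousAt (density x₀ a a' k) x := by
  rcases eq_or_ne x x₀ with rfl | hx0
  · have hev : density x a a' k =ᶠ[𝓝 x] fun _ => 0 := by
      have h1 := eventually_nhdsWithin_iff.1 (h.eventually_lt_norm (M + δ))
      filter_upwards [h1] with y hy
      rw [density]
      split_ifs with hyx
      · rfl
      · rw [hk.eq_zero _ (hy hyx).le, zero_mul]
    exact continuousAt_const.congr hev.symm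
  · have hev : density x₀ a a' k =ᶠ[𝓝 x] fun x => k (‖a x‖ ^ 2) * ‖a' x‖ ^ 2 := by
      filter_upwards [eventually_ne_nhds hx0] with y hy
      rw [density, if_neg hy]
    have ha : ContinuousAt a x := (h.hasDerivAt x hx hx0).continuousAt
    have ha' : ContinuousAt a' x := (h.differentiableAt_deriv hx hx0).continuousAt
    have hkc : ContinuousAt (fun x => k (‖a x‖ ^ 2)) x :=
      hk.continuous.continuousAt.comp (ha.norm.pow 2)
    exact (hkc.mul (ha'.norm.pow 2)).congr hev.symm

/-- The form whose antiholomorphic derivative is the truncated area density, away from the pole. -/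
noncomputable def greenForm (b : ℝ) (x₀ : ℂ) (N : ℕ) (a a' : ℂ → ℂ) (M c : ℝ) (K : ℝ → ℝ)
    (x : ℂ) : ℂ :=
  a' x * truncConj M K (a x) + (N + 1) * c * thetaLogDeriv b (x - x₀)

/-- By the chain rule the antiholomorphic part of the first term is `a' * k * conj a'`; the theta
term is holomorphic. -/
lemma hasFDerivAt_greenForm (h : IsQuasiPeriodicPole b x₀ N a a' E₁ E₂)
    (hk : IsCutoff M δ c k K) (hM : 0 < M) {x : ℂ} (hx : x - x₀ ∈ doubleRect b) (hx0 : x ≠ x₀) :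
    ∃ α, HasFDerivAt (greenForm b x₀ N a a' M c K)
      (wirtingerCLM α (density x₀ a a' k x)) x := by
  have h1 := (h.differentiableAt_deriv hx hx0).hasDerivAt.hasFDerivAt_wirtinger
  obtain ⟨α, h2⟩ := hk.hasFDerivAt_truncConj hM (a x)
  have h3 := h2.comp x (h.hasDerivAt x hx hx0).hasFDerivAt_wirtinger
  have hθ := differentiable_thetaOdd h.pos
  have hθ0 := thetaOdd_ne_zero_of_mem_doubleRect h.pos hx (sub_ne_zero.2 hx0)
  have h4 : DifferentiableAt ℂ (thetaLogDeriv b) (x - x₀) :=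
    (((hθ.differentiableOn.deriv isOpen_univ).differentiableAt univ_mem).div (hθ _) hθ0)
  have h5 := ((h4.hasDerivAt.comp_sub_const x x₀).const_mul
    ((N + 1) * c : ℂ)).hasFDerivAt_wirtinger
  refine ⟨deriv a' x * truncConj M K (a x) + a' x * α * a' x +
    (N + 1) * c * deriv (thetaLogDeriv b) (x - x₀), ((h1.mul h3).add h5).congr_fderiv ?_⟩
  refine ContinuousLinearMap.ext fun v => ?_
  have hn : (starRingEnd ℂ) (a' x) * a' x = (‖a' x‖ ^ 2 : ℝ) := by
    rw [mul_comm, Complex.mul_conj, Complex.normSq_eq_norm_sq]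
  simp only [add_apply, smul_apply, ContinuousLinearMap.comp_apply, wirtingerCLM_apply, smul_eq_mul,
    zero_mul, add_zero, Function.comp_apply, map_mul, density, if_neg hx0]
  rw [Complex.ofReal_mul, ← hn]
  ring

/-- The regular part at the pole of the form of `greenForm`. -/
lemma exists_regular_greenForm (h : IsQuasiPeriodicPole b x₀ N a a' E₁ E₂)
    (hk : IsCutoff M δ c k K) :
    ∃ R : ℂ → ℂ, DifferentiableAt ℂ R x₀ ∧
      ∀ᶠ x in 𝓝[≠] x₀, greenForm b x₀ N a a' M c K x = R x := by
  obtain ⟨X, hX, hX0, heq⟩ := h.exists_numerator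
  have hXd : DifferentiableAt ℂ X x₀ := hX.differentiableAt (nbhd_mem_nhds h.pole_mem)
  have hX'd : DifferentiableAt ℂ (deriv X) x₀ :=
    (hX.deriv isOpen_nbhd).differentiableAt (nbhd_mem_nhds h.pole_mem)
  have hq := differentiable_thetaQuot h.pos
  have hq0 : thetaQuot b (x₀ - x₀) ≠ 0 := thetaQuot_ne_zero h.pos h.pole_mem
  have hq' : Differentiable ℂ (deriv (thetaQuot b)) := fun x =>
    (hq.differentiableOn.deriv isOpen_univ).differentiableAt univ_mem
  -- Near the pole the truncation equals `c / a`, so the first term of the form is `c a' / a`, with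
  -- polar part `-(N + 1) c / (x - x₀)`. The theta term was added to cancel it; what remains are the
  -- logarithmic derivatives of the nonvanishing factors.
  refine ⟨fun x => c * (deriv X x / X x +
    (N + 1) * (deriv (thetaQuot b) (x - x₀) / thetaQuot b (x - x₀))), ?_, ?_⟩
  · have hs : DifferentiableAt ℂ (fun x => x - x₀) x₀ := differentiableAt_id.sub_const _
    exact ((hX'd.div hXd hX0).add ((DifferentiableAt.div
      ((hq' _).comp x₀ hs) ((hq _).comp x₀ hs)
      hq0).const_mul _)).const_mul _
  · have hXne : ∀ᶠ x in 𝓝[≠] x₀, X x ≠ 0 :=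
      nhdsWithin_le_nhds (hXd.continuousAt.eventually_ne hX0)
    filter_upwards [h.eventually_lt_norm (M + δ), h.eventually_lt_norm 0, self_mem_nhdsWithin,
      nhdsWithin_le_nhds (nbhd_mem_nhds h.pole_mem), hXne] with x hx hx' hx0 hxO hXx
    have hsub : x - x₀ ≠ 0 := sub_ne_zero.2 hx0
    have ha0 : a x ≠ 0 := by
      rintro h0
      rw [h0] at hx'
      simp at hx'
    have hqx : thetaQuot b (x - x₀) ≠ 0 := thetaQuot_ne_zero h.pos hxO
    have hev : a =ᶠ[𝓝 x] fun x => X x / (x - x₀) ^ (N + 1) := by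
      filter_upwards [nbhd_mem_nhds hxO, eventually_ne_nhds hx0] with y hy hy0 using heq y hy hy0
    have hd := ((hX.differentiableAt (nbhd_mem_nhds hxO)).hasDerivAt.div
      (((hasDerivAt_id x).sub_const x₀).pow (N + 1)) (pow_ne_zero _ hsub)).congr_of_eventuallyEq hev
    have ha' := (h.hasDerivAt x hxO hx0).unique hd
    have hθ : deriv (thetaOdd b) (x - x₀) =
        thetaQuot b (x - x₀) + (x - x₀) * deriv (thetaQuot b) (x - x₀) := by
      rw [funext (thetaOdd_eq_mul_thetaQuot h.pos)]
      have := ((hasDerivAt_id (x - x₀)).mul (hq (x - x₀)).hasDerivAt).deriv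
      rw [one_mul] at this
      exact this
    rw [greenForm, hk.truncConj_eq ha0, hk.eq_const _ hx.le, thetaLogDeriv, hθ,
      thetaOdd_eq_mul_thetaQuot h.pos, heq x hxO hx0, ha']
    simp only [id, Pi.pow_apply, Nat.add_sub_cancel, mul_one]
    push_cast
    rw [pow_succ]
    field_simp
    ring

end IsQuasiPeriodicPole

end GreenFormula

/-! ### Green's formula for the truncated area. -/

section TruncatedArea

variable {b : ℝ}

lemma isCompact_closedRect_sdiff : IsCompact (closedRect b \ cellRect b) :=
  isCompact_closedRect.diff isOpen_cellRect

lemma re_ofReal_add_mul_I (x y : ℝ) : (x + y * Complex.I : ℂ).re = x := by simp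

lemma im_ofReal_add_mul_I (x y : ℝ) : (x + y * Complex.I : ℂ).im = y := by simp

lemma mem_sdiff_bottom {x : ℝ} (hb : 0 < b) (hx : x ∈ Icc (-(1 / 2) : ℝ) (1 / 2)) :
    (x + (-(b / 2) : ℝ) * Complex.I : ℂ) ∈ closedRect b \ cellRect b := by
  rw [Set.mem_sdiff, mem_closedRect, mem_cellRect, re_ofReal_add_mul_I, im_ofReal_add_mul_I]
  exact ⟨⟨hx, le_rfl, by linarith⟩, fun h => lt_irrefl _ h.2.1⟩

lemma mem_sdiff_top {x : ℝ} (hb : 0 < b) (hx : x ∈ Icc (-(1 / 2) : ℝ) (1 / 2)) :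
    (x + (b / 2 : ℝ) * Complex.I : ℂ) ∈ closedRect b \ cellRect b := by
  rw [Set.mem_sdiff, mem_closedRect, mem_cellRect, re_ofReal_add_mul_I, im_ofReal_add_mul_I]
  exact ⟨⟨hx, by linarith, le_rfl⟩, fun h => lt_irrefl _ h.2.2⟩

lemma mem_sdiff_left {y : ℝ} (hy : y ∈ Icc (-(b / 2)) (b / 2)) :
    ((-(1 / 2) : ℝ) + y * Complex.I : ℂ) ∈ closedRect b \ cellRect b := by
  rw [Set.mem_sdiff, mem_closedRect, mem_cellRect, re_ofReal_add_mul_I, im_ofReal_add_mul_I]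
  exact ⟨⟨⟨le_rfl, by norm_num⟩, hy⟩, fun h => lt_irrefl _ h.1.1⟩

lemma mem_sdiff_right {y : ℝ} (hy : y ∈ Icc (-(b / 2)) (b / 2)) :
    ((1 / 2 : ℝ) + y * Complex.I : ℂ) ∈ closedRect b \ cellRect b := by
  rw [Set.mem_sdiff, mem_closedRect, mem_cellRect, re_ofReal_add_mul_I, im_ofReal_add_mul_I]
  exact ⟨⟨⟨by norm_num, le_rfl⟩, hy⟩, fun h => lt_irrefl _ h.1.2⟩

namespace IsQuasiPeriodicPole

variable {x₀ : ℂ} {N : ℕ} {a a' : ℂ → ℂ} {E₁ E₂ : ℂ} {M δ c : ℝ} {k K : ℝ → ℝ}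

lemma continuousAt (h : IsQuasiPeriodicPole b x₀ N a a' E₁ E₂) {x : ℂ}
    (hx : x ∈ closedRect b \ cellRect b) : ContinuousAt a x :=
  (h.hasDerivAt x (h.sub_mem hx.1) fun hx0 => hx.2 (hx0 ▸ h.mem)).continuousAt

lemma exists_bound (h : IsQuasiPeriodicPole b x₀ N a a' E₁ E₂) :
    ∃ M₀ : ℝ, 0 < M₀ ∧ ∀ x ∈ closedRect b \ cellRect b, ‖a x‖ ^ 2 ≤ M₀ := by
  obtain ⟨C, hC⟩ := isCompact_closedRect_sdiff.exists_bound_of_continuousOn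
    (f := a) fun x hx => (h.continuousAt hx).continuousWithinAt
  refine ⟨C ^ 2 + 1, by positivity, fun x hx => ?_⟩
  have := hC x hx
  have := norm_nonneg (a x)
  nlinarith

/-- Green's formula on the cell for the truncated area density. -/
theorem integral_density (h : IsQuasiPeriodicPole b x₀ N a a' E₁ E₂) (hk : IsCutoff M δ c k K)
    (hM : 0 < M) (hbd : ∀ x ∈ closedRect b \ cellRect b, ‖a x‖ ^ 2 ≤ M) :
    ∫ x in closedRect b, density x₀ a a' k x =
      ((starRingEnd ℂ) E₁ * E₂).im + Real.pi * (N + 1) * c := by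
  classical
  have hb := h.pos
  obtain ⟨R, hRd, hR⟩ := h.exists_regular_greenForm hk
  -- Filling in the removable singularity lets Green's formula run over the whole rectangle, with no
  -- disc cut out around the pole.
  set W : ℂ → ℂ := Function.update (greenForm b x₀ N a a' M c K) x₀ (R x₀) with hW
  -- the form is differentiable near the closed cell
  have hWd : ∀ x, x - x₀ ∈ doubleRect b →
      ∃ α, HasFDerivAt W (wirtingerCLM α (density x₀ a a' k x)) x := by
    intro x hx
    rcases eq_or_ne x x₀ with rfl | hx0
    · refine ⟨deriv R x, ?_⟩
      have : density x a a' k x = 0 := by simp [density]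
      rw [this, Complex.ofReal_zero]
      refine hRd.hasDerivAt.hasFDerivAt_wirtinger.congr_of_eventuallyEq ?_
      filter_upwards [eventually_nhdsWithin_iff.1 hR] with y hy
      rcases eq_or_ne y x with rfl | hyx
      · simp [hW]
      · rw [hW, Function.update_of_ne hyx, hy hyx]
    · obtain ⟨α, hα⟩ := h.hasFDerivAt_greenForm hk hM hx hx0
      refine ⟨α, hα.congr_of_eventuallyEq ?_⟩
      filter_upwards [eventually_ne_nhds hx0] with y hy
      rw [hW, Function.update_of_ne hy]
  choose! α hα using hWd
  have hWc : ContinuousOn W (closedRect b) := fun x hx =>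
    (hα x (h.sub_mem hx)).continuousAt.continuousWithinAt
  have hdc : ContinuousOn (density x₀ a a' k) (closedRect b) := fun x hx =>
    (h.continuousAt_density hk (h.sub_mem hx)).continuousWithinAt
  have hdc' : ContinuousOn (fun x => 2 * Complex.I * (density x₀ a a' k x : ℂ)) (closedRect b) :=
    continuousOn_const.mul (Complex.continuous_ofReal.comp_continuousOn hdc)
  set z : ℂ := ⟨-(1 / 2), -(b / 2)⟩ with hz
  set w : ℂ := ⟨1 / 2, b / 2⟩ with hw
  have hle₁ : (-(1 / 2) : ℝ) ≤ 1 / 2 := by norm_num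
  have hle₂ : -(b / 2) ≤ b / 2 := by linarith
  have hrect : uIcc z.re w.re ×ℂ uIcc z.im w.im = closedRect b := by
    rw [hz, hw, uIcc_of_le hle₁, uIcc_of_le hle₂, closedRect]
  have hgreen := Complex.integral_boundary_rect_of_hasFDerivAt_real_off_countable W
    (fun x => wirtingerCLM (α x) (density x₀ a a' k x)) z w ∅ countable_empty
    (by rw [hrect]; exact hWc)
    (by
      intro x hx
      refine hα x (h.sub_mem (cellRect_subset_closedRect ?_))
      have := hx.1
      simp only [hz, hw, min_eq_left hle₁, min_eq_left hle₂, max_eq_right hle₁,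
        max_eq_right hle₂] at this
      exact this)
    (by
      rw [hrect]
      simp only [wirtingerCLM_greenForm]
      exact hdc'.integrableOn_compact isCompact_closedRect)
  simp only [wirtingerCLM_greenForm] at hgreen
  have hrhs := integral_closedRect_eq hb hdc'
  rw [integral_const_mul, integral_complex_ofReal] at hrhs
  erw [hrhs] at hgreen
  -- the boundary values
  have hWb : ∀ x ∈ closedRect b \ cellRect b, W x =
      a' x * (starRingEnd ℂ) (a x) + (N + 1) * c * thetaLogDeriv b (x - x₀) := by
    intro x hx
    have hx0 : x ≠ x₀ := fun hx0 => hx.2 (hx0 ▸ h.mem)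
    rw [hW, Function.update_of_ne hx0, greenForm, truncConj, if_pos (hbd x hx)]
  have hne : ∀ x ∈ closedRect b \ cellRect b, x ≠ x₀ := fun x hx hx0 => hx.2 (hx0 ▸ h.mem)
  have ha'c : ContinuousOn a' (closedRect b \ cellRect b) := fun x hx =>
    (h.differentiableAt_deriv (h.sub_mem hx.1) (hne x hx)).continuousAt.continuousWithinAt
  have hWi₁ : ∀ y : ℝ, (∀ x ∈ Icc (-(1 / 2) : ℝ) (1 / 2),
      (x + y * Complex.I : ℂ) ∈ closedRect b \ cellRect b) →
      IntervalIntegrable (fun x : ℝ => W (x + y * Complex.I)) volume (-(1 / 2)) (1 / 2) := by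
    intro y hy
    refine ContinuousOn.intervalIntegrable ?_
    rw [uIcc_of_le hle₁]
    exact hWc.comp (by fun_prop) fun x hx => (hy x hx).1
  have hWi₂ : ∀ x : ℝ, (∀ y ∈ Icc (-(b / 2)) (b / 2),
      (x + y * Complex.I : ℂ) ∈ closedRect b \ cellRect b) →
      IntervalIntegrable (fun y : ℝ => W (x + y * Complex.I)) volume (-(b / 2)) (b / 2) := by
    intro x hx
    refine ContinuousOn.intervalIntegrable ?_
    rw [uIcc_of_le hle₂]
    exact hWc.comp (by fun_prop) fun y hy => (hx y hy).1
  -- On opposite edges `a'` agrees and `conj a` differs by a conjugate quasi-period, so a pair of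
  -- edges leaves that constant times the integral of `a'` along one edge, which is the other
  -- quasi-period. The horizontal pair also collects the jump of `thetaLogDeriv`.
  have hhor : (∫ x in (-(1 / 2) : ℝ)..(1 / 2), W (x + (-(b / 2) : ℝ) * Complex.I)) -
      ∫ x in (-(1 / 2) : ℝ)..(1 / 2), W (x + (b / 2 : ℝ) * Complex.I) =
      -(starRingEnd ℂ) E₂ * E₁ + 2 * Real.pi * Complex.I * (N + 1) * c := by
    rw [← intervalIntegral.integral_sub (hWi₁ _ fun x hx => mem_sdiff_bottom hb hx)
      (hWi₁ _ fun x hx => mem_sdiff_top hb hx)]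
    have hpt : ∀ x ∈ uIcc (-(1 / 2) : ℝ) (1 / 2),
        W (x + (-(b / 2) : ℝ) * Complex.I) - W (x + (b / 2 : ℝ) * Complex.I) =
        -(starRingEnd ℂ) E₂ * a' (x + (-(b / 2) : ℝ) * Complex.I) +
          2 * Real.pi * Complex.I * (N + 1) * c := by
      intro x hx
      rw [uIcc_of_le hle₁] at hx
      have h1 := mem_sdiff_bottom hb hx
      have h2 := mem_sdiff_top hb hx
      have hx2 : (x + (b / 2 : ℝ) * Complex.I : ℂ) =
          x + (-(b / 2) : ℝ) * Complex.I + b * Complex.I := by push_cast; ring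
      rw [hWb _ h1, hWb _ h2]
      rw [hx2] at h2 ⊢
      have hθ := thetaOdd_ne_zero_of_mem_doubleRect hb (h.sub_mem h1.1) (sub_ne_zero.2 (hne _ h1))
      rw [h.add_I_mul _ h1.1 h2.1, h.deriv_add_I_mul, add_sub_right_comm _ (b * Complex.I) x₀,
        thetaLogDeriv_add_I_mul hb hθ, map_add]
      ring
    rw [intervalIntegral.integral_congr hpt, intervalIntegral.integral_add,
      intervalIntegral.integral_const_mul]
    · have hint := intervalIntegral.integral_eq_sub_of_hasDerivAt
        (f := fun x : ℝ => a (x + (-(b / 2) : ℝ) * Complex.I))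
        (f' := fun x : ℝ => a' (x + (-(b / 2) : ℝ) * Complex.I))
        (a := -(1 / 2)) (b := 1 / 2) (fun x hx => by
          rw [uIcc_of_le hle₁] at hx
          have h1 := mem_sdiff_bottom hb hx
          exact ((h.hasDerivAt _ (h.sub_mem h1.1) (hne _ h1)).comp_add_const (x : ℂ) _).comp_ofReal)
        (ContinuousOn.intervalIntegrable (by
          rw [uIcc_of_le hle₁]
          exact ha'c.comp (by fun_prop) fun x hx => mem_sdiff_bottom hb hx))
      have h1 := mem_sdiff_bottom hb (x := -(1 / 2)) ⟨le_rfl, hle₁⟩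
      have h2 := mem_sdiff_bottom hb (x := 1 / 2) ⟨hle₁, le_rfl⟩
      have hx2 : (((1 / 2 : ℝ) : ℂ) + (-(b / 2) : ℝ) * Complex.I) =
        ((-(1 / 2) : ℝ) : ℂ) + (-(b / 2) : ℝ) * Complex.I + 1 := by push_cast; ring
      rw [hx2] at h2 hint
      rw [h.add_one _ h1.1 h2.1, add_sub_cancel_left] at hint
      rw [hint, intervalIntegral.integral_const]
      norm_num
    · refine ContinuousOn.intervalIntegrable ?_
      rw [uIcc_of_le hle₁]
      exact continuousOn_const.mul (ha'c.comp (by fun_prop) fun x hx => mem_sdiff_bottom hb hx)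
    · exact intervalIntegrable_const
  have hver : Complex.I * (∫ y in (-(b / 2))..(b / 2), W ((1 / 2 : ℝ) + y * Complex.I)) -
      Complex.I * ∫ y in (-(b / 2))..(b / 2), W ((-(1 / 2) : ℝ) + y * Complex.I) =
      (starRingEnd ℂ) E₁ * E₂ := by
    rw [← mul_sub, ← intervalIntegral.integral_sub (hWi₂ _ fun y hy => mem_sdiff_right hy)
      (hWi₂ _ fun y hy => mem_sdiff_left hy), ← intervalIntegral.integral_const_mul]
    have hpt : ∀ y ∈ uIcc (-(b / 2)) (b / 2),
        Complex.I * (W ((1 / 2 : ℝ) + y * Complex.I) - W ((-(1 / 2) : ℝ) + y * Complex.I)) =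
        (starRingEnd ℂ) E₁ * (a' ((-(1 / 2) : ℝ) + y * Complex.I) * Complex.I) := by
      intro y hy
      rw [uIcc_of_le hle₂] at hy
      have h1 := mem_sdiff_left hy
      have h2 := mem_sdiff_right hy
      have hx2 : ((1 / 2 : ℝ) + y * Complex.I : ℂ) =
          (-(1 / 2) : ℝ) + y * Complex.I + 1 := by push_cast; ring
      rw [hWb _ h1, hWb _ h2]
      rw [hx2] at h2 ⊢
      rw [h.add_one _ h1.1 h2.1, h.deriv_add_one, add_sub_right_comm _ 1 x₀, thetaLogDeriv_add_one,
        map_add]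
      ring
    rw [intervalIntegral.integral_congr hpt, intervalIntegral.integral_const_mul]
    have hint := intervalIntegral.integral_eq_sub_of_hasDerivAt
      (f := fun y : ℝ => a ((-(1 / 2) : ℝ) + y * Complex.I))
      (f' := fun y : ℝ => a' ((-(1 / 2) : ℝ) + y * Complex.I) * Complex.I)
      (a := -(b / 2)) (b := b / 2) (fun y hy => by
        rw [uIcc_of_le hle₂] at hy
        have h1 := mem_sdiff_left hy
        have hi : HasDerivAt (fun v : ℂ => ((-(1 / 2) : ℝ) : ℂ) + v * Complex.I)
            Complex.I (y : ℂ) := by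
          simpa using ((hasDerivAt_id (y : ℂ)).mul_const Complex.I).const_add ((-(1 / 2) : ℝ) : ℂ)
        have hA : HasDerivAt a _ (((-(1 / 2) : ℝ) : ℂ) + (y : ℂ) * Complex.I) :=
          h.hasDerivAt _ (h.sub_mem h1.1) (hne _ h1)
        exact (hA.comp (y : ℂ) hi).comp_ofReal)
      (ContinuousOn.intervalIntegrable (by
        rw [uIcc_of_le hle₂]
        exact (ha'c.comp (by fun_prop) fun y hy => mem_sdiff_left hy).mul continuousOn_const))
    have h1 := mem_sdiff_left (b := b) (y := -(b / 2)) ⟨le_rfl, hle₂⟩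
    have h2 := mem_sdiff_left (b := b) (y := b / 2) ⟨hle₂, le_rfl⟩
    have hx2 : (((-(1 / 2) : ℝ) : ℂ) + ((b / 2 : ℝ) : ℂ) * Complex.I) =
      ((-(1 / 2) : ℝ) : ℂ) + ((-(b / 2) : ℝ) : ℂ) * Complex.I + b * Complex.I := by
      push_cast; ring
    rw [hx2] at h2 hint
    rw [h.add_I_mul _ h1.1 h2.1, add_sub_cancel_left] at hint
    rw [hint]
  simp only [smul_eq_mul] at hgreen
  rw [add_sub_assoc] at hgreen
  erw [hhor, hver] at hgreen
  -- The boundary gives `conj E₁ * E₂ - conj E₂ * E₁`, that is `2i Im(conj E₁ * E₂)`, plus `2πi (N +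
  -- 1) c`; the interior gives `2i` times the truncated area.
  have him := congrArg Complex.im hgreen
  simp at him
  simp
  linarith

end IsQuasiPeriodicPole

end TruncatedArea

/-! ### Removing the truncation: the area of sublevel sets. -/

section SublevelArea

variable {b : ℝ}

namespace IsQuasiPeriodicPole

variable {x₀ : ℂ} {N : ℕ} {a a' : ℂ → ℂ} {E₁ E₂ : ℂ}

/-- The part of the closed cell where `a` is finite and `‖a‖ ^ 2` is at most `M`. -/
def sublevel (b : ℝ) (x₀ : ℂ) (a : ℂ → ℂ) (M : ℝ) : Set ℂ :=
  {x | x ∈ closedRect b ∧ x ≠ x₀ ∧ ‖a x‖ ^ 2 ≤ M}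

lemma measurableSet_sublevel (h : IsQuasiPeriodicPole b x₀ N a a' E₁ E₂) (M : ℝ) :
    MeasurableSet (sublevel b x₀ a M) := by
  set U : Set ℂ := (· - x₀) ⁻¹' doubleRect b ∩ {x₀}ᶜ
  have hU : IsOpen U := isOpen_nbhd.inter isOpen_compl_singleton
  have hc : ContinuousOn (fun x => ‖a x‖ ^ 2) U := fun x hx =>
    ((h.hasDerivAt x hx.1 hx.2).continuousAt.norm.pow 2).continuousWithinAt
  have ho := hc.isOpen_inter_preimage hU (isOpen_Ioi (a := M))
  have : sublevel b x₀ a M =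
      (closedRect b ∩ {x₀}ᶜ) \ (U ∩ (fun x => ‖a x‖ ^ 2) ⁻¹' Ioi M) := by
    ext x
    constructor
    · rintro ⟨h1, h2, h3⟩
      exact ⟨⟨h1, h2⟩, fun hx => (not_lt.2 h3) hx.2⟩
    · rintro ⟨⟨h1, h2⟩, h3⟩
      refine ⟨h1, h2, not_lt.1 fun hlt => h3 ⟨⟨h.sub_mem h1, h2⟩, hlt⟩⟩
  rw [this]
  exact (isCompact_closedRect.measurableSet.inter (measurableSet_singleton _).compl).diff
    ho.measurableSet

lemma integrableOn_sublevel (h : IsQuasiPeriodicPole b x₀ N a a' E₁ E₂) (M : ℝ) :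
    IntegrableOn (fun x => ‖a' x‖ ^ 2) (sublevel b x₀ a M) := by
  obtain ⟨V, hV, hVo, hxV⟩ := mem_nhds_iff.1 (eventually_nhdsWithin_iff.1 (h.eventually_lt_norm M))
  have hc : IsCompact (closedRect b \ V) := isCompact_closedRect.diff hVo
  have hcont : ContinuousOn (fun x => ‖a' x‖ ^ 2) (closedRect b \ V) := fun x hx =>
    ((h.differentiableAt_deriv (h.sub_mem hx.1)
      fun hx0 => hx.2 (hx0 ▸ hxV)).continuousAt.norm.pow 2).continuousWithinAt
  refine (hcont.integrableOn_compact hc).mono_set fun x hx => ⟨hx.1, fun hxV => ?_⟩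
  exact (not_lt.2 hx.2.2) (hV hxV hx.2.1)

lemma integrableOn_density (h : IsQuasiPeriodicPole b x₀ N a a' E₁ E₂) {M δ c : ℝ} {k K : ℝ → ℝ}
    (hk : IsCutoff M δ c k K) : IntegrableOn (density x₀ a a' k) (closedRect b) :=
  ContinuousOn.integrableOn_compact isCompact_closedRect fun _ hx =>
    (h.continuousAt_density hk (h.sub_mem hx)).continuousWithinAt

lemma density_nonneg {M δ c : ℝ} {k K : ℝ → ℝ} (hk : IsCutoff M δ c k K) (x : ℂ) :
    0 ≤ density x₀ a a' k x := by
  rw [density]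
  split_ifs
  · exact le_rfl
  · exact mul_nonneg (hk.nonneg _) (by positivity)

/-- The area, counted with multiplicity, of the part of the image where `‖a‖ ^ 2 ≤ M`. -/
theorem integral_sublevel (h : IsQuasiPeriodicPole b x₀ N a a' E₁ E₂) :
    ∀ᶠ M in atTop, ∫ x in sublevel b x₀ a M, ‖a' x‖ ^ 2 =
      ((starRingEnd ℂ) E₁ * E₂).im + Real.pi * (N + 1) * M := by
  obtain ⟨M₀, hM₀, hbd⟩ := h.exists_bound
  set C := ((starRingEnd ℂ) E₁ * E₂).im
  set P := Real.pi * (N + 1) with hP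
  have hP0 : 0 < P := by positivity
  have hsub : ∀ M, sublevel b x₀ a M ⊆ closedRect b := fun M x hx => hx.1
  -- The cutoff is `1` on the sublevel set at height `M`, so the truncated area dominates, and `c ≤
  -- M + δ`.
  have hupper : ∀ M δ, M₀ ≤ M → 0 < δ →
      ∫ x in sublevel b x₀ a M, ‖a' x‖ ^ 2 ≤ C + P * (M + δ) := by
    intro M δ hM hδ
    have hMpos := hM₀.trans_le hM
    obtain ⟨c, k, K, hk⟩ := exists_isCutoff hMpos.le hδ
    have hI := h.integral_density hk hMpos fun x hx => (hbd x hx).trans hM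
    have h1 : ∫ x in sublevel b x₀ a M, ‖a' x‖ ^ 2 =
        ∫ x in sublevel b x₀ a M, density x₀ a a' k x := by
      refine setIntegral_congr_fun (h.measurableSet_sublevel M) fun x hx => ?_
      simp only [density, if_neg hx.2.1, hk.eq_one _ hx.2.2, one_mul]
    have h2 := setIntegral_mono_set (h.integrableOn_density hk)
      (Eventually.of_forall fun x => density_nonneg hk x) (hsub M).eventuallyLE
    rw [h1]
    refine h2.trans (hI.le.trans ?_)
    have := mul_le_mul_of_nonneg_left hk.const_le hP0.le
    linarith
  -- The cutoff is at most `1` and vanishes outside the sublevel set at height `M + δ`, and `M ≤ c`.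
  have hlower : ∀ M δ, M₀ ≤ M → 0 < δ →
      C + P * M ≤ ∫ x in sublevel b x₀ a (M + δ), ‖a' x‖ ^ 2 := by
    intro M δ hM hδ
    have hMpos := hM₀.trans_le hM
    obtain ⟨c, k, K, hk⟩ := exists_isCutoff hMpos.le hδ
    have hI := h.integral_density hk hMpos fun x hx => (hbd x hx).trans hM
    have h1 : ∫ x in sublevel b x₀ a (M + δ), density x₀ a a' k x =
        ∫ x in closedRect b, density x₀ a a' k x := by
      refine (setIntegral_eq_of_subset_of_forall_sdiff_eq_zero
        isCompact_closedRect.measurableSet (hsub _) fun x hx => ?_).symm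
      rw [density]
      split_ifs with hx0
      · rfl
      · rw [hk.eq_zero _ (not_le.1 fun hle => hx.2 ⟨hx.1, hx0, hle⟩).le, zero_mul]
    have h2 : ∫ x in sublevel b x₀ a (M + δ), density x₀ a a' k x ≤
        ∫ x in sublevel b x₀ a (M + δ), ‖a' x‖ ^ 2 := by
      refine setIntegral_mono_on ((h.integrableOn_density hk).mono_set (hsub _))
        (h.integrableOn_sublevel _) (h.measurableSet_sublevel _) fun x hx => ?_
      rw [density, if_neg hx.2.1]
      exact mul_le_of_le_one_left (by positivity) (hk.le_one _)
    rw [h1, hI] at h2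
    refine le_trans ?_ h2
    have := mul_le_mul_of_nonneg_left hk.le_const hP0.le
    linarith
  -- The lower bound is applied at `M - d` with `d ≤ 1`; the margin `1` keeps this height above the
  -- boundary values of `‖a‖ ^ 2`.
  filter_upwards [eventually_ge_atTop (M₀ + 1)] with M hM
  refine le_antisymm (le_of_forall_pos_le_add fun ε hε => ?_)
    (le_of_forall_pos_le_add fun ε hε => ?_)
  · have := hupper M (ε / P) (by linarith) (by positivity)
    rwa [mul_add, mul_div_cancel₀ _ hP0.ne', ← add_assoc] at this
  · set d := min 1 (ε / P) with hd
    have hd0 : 0 < d := lt_min one_pos (by positivity)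
    have hd1 : d ≤ 1 := min_le_left _ _
    have hd2 : P * d ≤ ε := by
      have := mul_le_mul_of_nonneg_left (min_le_right 1 (ε / P)) hP0.le
      rwa [mul_div_cancel₀ _ hP0.ne'] at this
    have := hlower (M - d) d (by linarith) hd0
    rw [sub_add_cancel, mul_sub] at this
    linarith

end IsQuasiPeriodicPole

/-- The integral of `‖y‖⁻⁴` over the complement of a disc. -/
lemma integral_compl_ball_norm_pow {ρ : ℝ} (hρ : 0 < ρ) (c : ℝ) :
    ∫ y in (Metric.ball (0 : ℂ) ρ)ᶜ, c / ‖y‖ ^ 4 = Real.pi * c / ρ ^ 2 := by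
  have hball : (Metric.ball (0 : ℂ) ρ)ᶜ = {y | ρ ≤ ‖y‖} := by
    ext y; simp
  rw [← integral_indicator (Metric.isOpen_ball.measurableSet.compl), hball]
  have hind : ({y : ℂ | ρ ≤ ‖y‖}.indicator fun y => c / ‖y‖ ^ 4) =
      fun y => (Ici ρ).indicator (fun r => c / r ^ 4) ‖y‖ := by
    ext y
    simp [indicator]
  rw [hind, integral_fun_norm_addHaar volume, Complex.finrank_real_complex]
  have h1 : ∫ y in Ioi (0 : ℝ), y ^ (2 - 1) • (Ici ρ).indicator (fun r => c / r ^ 4) y =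
      ∫ y in Ioi ρ, c * y ^ (-3 : ℝ) := by
    have : (fun y : ℝ => y ^ (2 - 1) • (Ici ρ).indicator (fun r => c / r ^ 4) y) =
        (Ici ρ).indicator fun y => y * (c / y ^ 4) := by
      ext y
      by_cases hy : y ∈ Ici ρ <;> simp [hy]
    have hinter : Ioi (0 : ℝ) ∩ Ici ρ = Ici ρ := inter_eq_right.2 fun y hy => hρ.trans_le hy
    rw [this, setIntegral_indicator measurableSet_Ici, hinter, integral_Ici_eq_integral_Ioi]
    refine setIntegral_congr_fun measurableSet_Ioi fun y hy => ?_
    have hy0 : 0 < y := hρ.trans hy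
    rw [Real.rpow_neg hy0.le, show (3 : ℝ) = (3 : ℕ) by norm_num, Real.rpow_natCast]
    field_simp
  rw [h1, integral_const_mul, integral_Ioi_rpow_of_lt (by norm_num) hρ, Measure.real,
    Complex.volume_ball]
  have h2 : (-3 : ℝ) + 1 = -(2 : ℕ) := by norm_num
  rw [h2, Real.rpow_neg hρ.le, Real.rpow_natCast]
  simp
  field_simp

end SublevelArea

/-! ### Connectedness of the punctured cell. -/

section Punctured

/-- An open convex set stays connected when a countable set is removed, in dimension at least
two. -/
lemma Convex.isPreconnected_diff_countable {E : Type*} [AddCommGroup E] [Module ℝ E]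
    [TopologicalSpace E] [IsTopologicalAddGroup E] [ContinuousSMul ℝ E]
    (h : 1 < Module.rank ℝ E) {U s : Set E} (hU : Convex ℝ U) (hUo : IsOpen U)
    (hs : s.Countable) : IsPreconnected (U \ s) := by
  refine isPreconnected_of_forall_pair fun a ha b hb => ?_
  rcases eq_or_ne a b with rfl | hab
  · exact ⟨{a}, singleton_subset_iff.2 ha, mem_singleton a, mem_singleton a,
      isPreconnected_singleton⟩
  suffices hJ : JoinedIn (U \ s) a b by
    obtain ⟨γ, hγ⟩ := hJ
    exact ⟨range γ, range_subset_iff.2 hγ, ⟨0, γ.source⟩, ⟨1, γ.target⟩,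
      (isPreconnected_range γ.continuous)⟩
  -- The path is a broken line through an apex `c + t • y` off the midpoint. For distinct `t` the
  -- segments from one endpoint meet only there, so only countably many `t` hit `s`, and some `t`
  -- outside these keeps the apex in the open set `U`.
  let c := (2 : ℝ)⁻¹ • (a + b)
  let x := (2 : ℝ)⁻¹ • (b - a)
  have Ia : c - x = a := by simp only [c, x]; module
  have Ib : c + x = b := by simp only [c, x]; module
  have x_ne_zero : x ≠ 0 := by simpa [x] using sub_ne_zero.2 hab.symm
  obtain ⟨y, hy⟩ : ∃ y, LinearIndependent ℝ ![x, y] :=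
    exists_linearIndependent_pair_of_one_lt_rank h x_ne_zero
  have A : Set.Countable {t : ℝ | (segment ℝ (c + x) (c + t • y) ∩ s).Nonempty} := by
    apply countable_ofPred_nonempty_of_disjoint _ (fun t ↦ inter_subset_right) hs
    intro t t' htt'
    apply disjoint_iff_inter_eq_empty.2
    have N : {c + x} ∩ s = ∅ := by
      rw [singleton_inter_eq_empty, Ib]; exact hb.2
    rw [inter_assoc, inter_comm s, inter_assoc, inter_self, ← inter_assoc, ← subset_empty_iff, ← N]
    apply inter_subset_inter_left
    apply Eq.subset
    apply segment_inter_eq_endpoint_of_linearIndependent_of_ne hy htt'.symm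
  have B : Set.Countable {t : ℝ | (segment ℝ (c - x) (c + t • y) ∩ s).Nonempty} := by
    apply countable_ofPred_nonempty_of_disjoint _ (fun t ↦ inter_subset_right) hs
    intro t t' htt'
    apply disjoint_iff_inter_eq_empty.2
    have N : {c - x} ∩ s = ∅ := by
      rw [singleton_inter_eq_empty, Ia]; exact ha.2
    rw [inter_assoc, inter_comm s, inter_assoc, inter_self, ← inter_assoc, ← subset_empty_iff, ← N]
    apply inter_subset_inter_left
    rw [sub_eq_add_neg _ x]
    apply Eq.subset
    apply segment_inter_eq_endpoint_of_linearIndependent_of_ne _ htt'.symm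
    convert! hy.units_smul ![-1, 1]
    simp [← List.ofFn_inj]
  have hcU : c ∈ U := by
    have := hU.midpoint_mem ha.1 hb.1
    rwa [midpoint_eq_smul_add, invOf_eq_inv] at this
  have hopen : IsOpen {t : ℝ | c + t • y ∈ U} := hUo.preimage (by fun_prop)
  obtain ⟨t, ht, htU⟩ := ((A.union B).dense_compl ℝ).exists_mem_open hopen
    ⟨0, by simpa using hcU⟩
  let z := c + t • y
  simp only [compl_union, mem_inter_iff, mem_compl_iff, mem_ofPred_eq, not_nonempty_iff_eq_empty]
    at ht
  have JA : JoinedIn (U \ s) a z := by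
    apply JoinedIn.of_segment_subset
    refine subset_sdiff.2 ⟨hU.segment_subset ha.1 htU, disjoint_iff_inter_eq_empty.2 ?_⟩
    convert! ht.2
    exact Ia.symm
  have JB : JoinedIn (U \ s) b z := by
    apply JoinedIn.of_segment_subset
    refine subset_sdiff.2 ⟨hU.segment_subset hb.1 htU, disjoint_iff_inter_eq_empty.2 ?_⟩
    convert! ht.1
    exact Ib.symm
  exact JA.trans JB.symm

variable {b : ℝ} {ω₁ ω₂ : ℂ}

lemma latticeCongr_iff (h1 : ω₁ ≠ 0) (hω : ω₂ = ω₁ * (b * Complex.I)) (hb : 0 < b) {z w : ℂ} :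
    LatticeCongr ω₁ ω₂ z w ↔ thetaOdd b ((z - w) / ω₁) = 0 := by
  rw [thetaOdd_eq_zero_iff hb, LatticeCongr]
  refine exists_congr fun k => exists_congr fun l => ?_
  rw [div_eq_iff h1, hω, sub_eq_iff_eq_add]
  constructor <;> rintro rfl <;> ring

lemma halfPeriod_eq (hω : ω₂ = ω₁ * (b * Complex.I)) (j : Fin 3) :
    halfPeriod ω₁ ω₂ j = ω₁ * unitHalfPeriod b j := by
  fin_cases j <;> simp [halfPeriod, unitHalfPeriod, hω] <;> ring

lemma IsTorusGreen.eq_of_latticeCongr {G : ℂ → ℝ} (hG : IsTorusGreen ω₁ ω₂ G) {z w : ℂ}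
    (h : LatticeCongr ω₁ ω₂ z w) : G z = G w := by
  obtain ⟨k, l, rfl⟩ := h
  have h1 : Function.Periodic G ω₁ := hG.periodic₁
  have h2 : Function.Periodic G ω₂ := hG.periodic₂
  rw [h2.int_mul l, h1.int_mul k]

lemma LatticeCongr.sub_left {z w : ℂ} (h : LatticeCongr ω₁ ω₂ z w) (v : ℂ) :
    LatticeCongr ω₁ ω₂ (v - w) (v - z) := by
  obtain ⟨k, l, rfl⟩ := h
  exact ⟨k, l, by ring⟩

lemma countable_latticeCongr (w : ℂ) : {z | LatticeCongr ω₁ ω₂ z w}.Countable := by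
  refine (countable_range fun kl : ℤ × ℤ => w + (kl.1 : ℂ) * ω₁ + (kl.2 : ℂ) * ω₂).mono ?_
  rintro z ⟨k, l, rfl⟩
  exact ⟨(k, l), rfl⟩

lemma countable_periodCell_diff {ι : Type*} [Fintype ι] (c : ℂ) (p : ι → ℂ) :
    (periodCell ω₁ ω₂ \ puncturedCell ω₁ ω₂ c p).Countable := by
  refine ((countable_latticeCongr (ω₁ := ω₁) (ω₂ := ω₂) c).union
    (countable_iUnion fun j => countable_latticeCongr (ω₁ := ω₁) (ω₂ := ω₂) (p j))).mono ?_
  rintro z ⟨hz, hz'⟩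
  by_contra hcon
  simp only [mem_union, mem_ofPred_eq, mem_iUnion, not_or, not_exists] at hcon
  exact hz' ⟨hz, hcon⟩

variable {ι : Type*} [Fintype ι] {c : ℂ} {p : ι → ℂ}

lemma isOpen_puncturedCell (h1 : ω₁ ≠ 0) (hω : ω₂ = ω₁ * (b * Complex.I)) (hb : 0 < b) :
    IsOpen (puncturedCell ω₁ ω₂ c p) := by
  have hcl : ∀ w, IsOpen {z | ¬ LatticeCongr ω₁ ω₂ z w} := fun w => by
    simp only [latticeCongr_iff h1 hω hb]
    have : Continuous fun z => thetaOdd b ((z - w) / ω₁) :=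
      (differentiable_thetaOdd hb).continuous.comp (by fun_prop)
    exact isOpen_ne.preimage this
  have : puncturedCell ω₁ ω₂ c p = periodCell ω₁ ω₂ ∩
      ({z | ¬ LatticeCongr ω₁ ω₂ z c} ∩ ⋂ j, {z | ¬ LatticeCongr ω₁ ω₂ z (p j)}) := by
    ext z; simp [puncturedCell]; tauto
  rw [this]
  exact (isOpen_periodCell h1 hω hb).inter ((hcl c).inter (isOpen_iInter_of_finite fun j => hcl _))

lemma convex_periodCell (hω : ω₂ = ω₁ * (b * Complex.I)) (hb : 0 < b) :
    Convex ℝ (periodCell ω₁ ω₂) := by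
  rw [periodCell_eq_image hω hb]
  exact convex_cellRect.linear_image (mulRealCLM ω₁ : ℂ →ₗ[ℝ] ℂ)

lemma isPreconnected_puncturedCell (h1 : ω₁ ≠ 0) (hω : ω₂ = ω₁ * (b * Complex.I)) (hb : 0 < b) :
    IsPreconnected (puncturedCell ω₁ ω₂ c p) := by
  have h : puncturedCell ω₁ ω₂ c p =
      periodCell ω₁ ω₂ \ (periodCell ω₁ ω₂ \ puncturedCell ω₁ ω₂ c p) := by
    rw [sdiff_sdiff_right_self]
    exact (inter_eq_right.2 fun z hz => hz.1).symm
  rw [h]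
  refine (convex_periodCell hω hb).isPreconnected_diff_countable ?_ (isOpen_periodCell h1 hω hb)
    (countable_periodCell_diff c p)
  rw [Complex.rank_real_complex]; exact Cardinal.one_lt_two

end Punctured

/-! ### The potential as the squared modulus of an elliptic function. -/

section ConcentrationPotential

variable {b : ℝ} {ω₁ ω₂ τ : ℂ} {p : Fin 3 → ℂ}

lemma latticeCongr_halfPeriod_iff (h1 : ω₁ ≠ 0) (hω : ω₂ = ω₁ * (b * Complex.I)) (hb : 0 < b)
    (hp : ∀ j, LatticeCongr ω₁ ω₂ (p j) (halfPeriod ω₁ ω₂ j + τ)) {z : ℂ} (j : Fin 3) :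
    LatticeCongr ω₁ ω₂ z (p j) ↔ thetaOdd b ((z - τ) / ω₁ - unitHalfPeriod b j) = 0 := by
  have heq : (z - τ) / ω₁ - unitHalfPeriod b j = (z - (halfPeriod ω₁ ω₂ j + τ)) / ω₁ := by
    rw [halfPeriod_eq hω]; field_simp; ring
  rw [heq, ← latticeCongr_iff h1 hω hb]
  obtain ⟨k, l, hkl⟩ := hp j
  constructor
  · rintro ⟨k', l', h⟩
    exact ⟨k + k', l + l', by rw [h, hkl]; push_cast; ring⟩
  · rintro ⟨k', l', h⟩
    exact ⟨k' - k, l' - l, by rw [h, hkl]; push_cast; ring⟩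

lemma thetaOdd_ne_zero_of_mem_puncturedCell (h1 : ω₁ ≠ 0) (hω : ω₂ = ω₁ * (b * Complex.I))
    (hb : 0 < b) (hp : ∀ j, LatticeCongr ω₁ ω₂ (p j) (halfPeriod ω₁ ω₂ j + τ)) {z : ℂ}
    (hz : z ∈ puncturedCell ω₁ ω₂ τ p) : thetaOdd b ((z - τ) / ω₁) ≠ 0 ∧
      ∀ j, thetaOdd b ((z - τ) / ω₁ - unitHalfPeriod b j) ≠ 0 :=
  ⟨fun h => hz.2.1 ((latticeCongr_iff h1 hω hb).2 h),
    fun j h => hz.2.2 j ((latticeCongr_halfPeriod_iff h1 hω hb hp j).2 h)⟩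

/-- The concentration potential is the squared modulus of an elliptic function. -/
theorem exists_concPotential_eq (h1 : ω₁ ≠ 0) (hω : ω₂ = ω₁ * (b * Complex.I)) (hb : 0 < b)
    {G : ℂ → ℝ} (hG : IsTorusGreen ω₁ ω₂ G) {n : ℕ} {m : Fin 3 → ℕ}
    (hm : 2 * ∑ j, m j = n + 2) : ∃ C : ℝ, 0 < C ∧ ∀ (τ : ℂ) (p : Fin 3 → ℂ),
      (∀ j, LatticeCongr ω₁ ω₂ (p j) (halfPeriod ω₁ ω₂ j + τ)) →
      ∀ z ∈ puncturedCell ω₁ ω₂ τ p, concPotential G τ n p (fun j => 2 * m j) z =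
        ‖(C : ℂ) * halfProd b m ((z - τ) / ω₁)‖ ^ 2 := by
  obtain ⟨c₀, hG₀⟩ := exists_isTorusGreen h1 hω hb
  obtain ⟨c₁, hc₁⟩ := hG.exists_eq_add_const h1 hω hb hG₀
  choose κ hκ hκeq using exists_norm_halfRatio_eq hb
  set K : ℝ := ∏ j, κ j ^ m j with hK
  have hKpos : 0 < K := Finset.prod_pos fun j _ => pow_pos (hκ j) _
  -- The constant depends only on the lattice and the multiplicities; being chosen before `τ` and
  -- `p`, it makes the final value independent of them.
  refine ⟨K⁻¹, inv_pos.2 hKpos, fun τ p hp z hz => ?_⟩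
  obtain ⟨hz0, hzj⟩ := thetaOdd_ne_zero_of_mem_puncturedCell h1 hω hb hp hz
  set x := (z - τ) / ω₁ with hx
  set g := thetaGreen b with hg
  have hGτ : G (z - τ) = g x + (c₁ - c₀) := by rw [hc₁ _ hz0]; ring
  have hGj : ∀ j, G (z - p j) = g (x - unitHalfPeriod b j) + (c₁ - c₀) := fun j => by
    have hxj : (z - (halfPeriod ω₁ ω₂ j + τ)) / ω₁ = x - unitHalfPeriod b j := by
      rw [halfPeriod_eq hω, hx]; field_simp; ring
    rw [← hG.eq_of_latticeCongr ((hp j).sub_left z), hc₁ _ (by rw [hxj]; exact hzj j), hxj]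
    ring
  have hprod : ‖halfProd b m x‖ =
      K * Real.exp (∑ j, m j * (4 * Real.pi * (g x - g (x - unitHalfPeriod b j)))) := by
    rw [halfProd, norm_prod, hK, Real.exp_sum, ← Finset.prod_mul_distrib]
    refine Finset.prod_congr rfl fun j _ => ?_
    rw [norm_pow, hκeq j x hz0 (hzj j), mul_pow, Real.exp_nat_mul]
  -- The balance condition: the total coefficient of `G(z - τ)` becomes `8π ∑ mⱼ`, matching the
  -- vortices `pⱼ`, and the constant `c₁ - c₀` cancels.
  have hn : (n : ℝ) = 2 * ∑ j, (m j : ℝ) - 2 := by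
    have : ((2 * ∑ j, m j : ℕ) : ℝ) = (n + 2 : ℕ) := by rw [hm]
    push_cast at this
    linarith
  rw [norm_mul, hprod, Complex.norm_real, Real.norm_eq_abs, abs_of_pos (inv_pos.2 hKpos),
    inv_mul_cancel_left₀ hKpos.ne', ← Real.exp_nat_mul, concPotential, vortexU₀, hGτ]
  simp only [hGj]
  congr 1
  rw [hn]
  simp only [Fin.sum_univ_three]
  push_cast
  ring

end ConcentrationPotential

/-! ### Existence and uniqueness of the meromorphic square root. -/

section SquareRoot

variable {b : ℝ} {ω₁ ω₂ τ : ℂ} {p : Fin 3 → ℂ}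

lemma meromorphicAt_halfProd (hb : 0 < b) (m : Fin 3 → ℕ) (x : ℂ) :
    MeromorphicAt (halfProd b m) x := by
  have h1 : Differentiable ℂ (thetaSq b) := (differentiable_thetaOdd hb).pow 2
  unfold halfProd halfRatio
  refine MeromorphicAt.fun_prod fun j _ => MeromorphicAt.fun_pow (MeromorphicAt.fun_div ?_ ?_) _
  · exact (((differentiable_halfTwist j).mul (h1.comp (differentiable_id.sub_const _))).analyticAt
      x).meromorphicAt
  · exact (h1.analyticAt x).meromorphicAt

lemma analyticAt_sub_div (z : ℂ) : AnalyticAt ℂ (fun z => (z - τ) / ω₁) z :=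
  ((differentiable_id.sub_const τ).div_const ω₁).analyticAt z

lemma sub_div_mem_doubleRect (h1 : ω₁ ≠ 0) (hω : ω₂ = ω₁ * (b * Complex.I)) (hb : 0 < b)
    (hτ : τ ∈ periodCell ω₁ ω₂) {z : ℂ} (hz : z ∈ periodCell ω₁ ω₂) :
    (z - τ) / ω₁ ∈ doubleRect b := by
  rw [sub_div]
  exact sub_mem_doubleRect (cellRect_subset_closedRect ((mem_periodCell h1 hω hb).1 hz))
    ((mem_periodCell h1 hω hb).1 hτ)

lemma halfProd_ne_zero_of_mem_puncturedCell (h1 : ω₁ ≠ 0) (hω : ω₂ = ω₁ * (b * Complex.I))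
    (hb : 0 < b) (hp : ∀ j, LatticeCongr ω₁ ω₂ (p j) (halfPeriod ω₁ ω₂ j + τ)) {m : Fin 3 → ℕ}
    {z : ℂ} (hz : z ∈ puncturedCell ω₁ ω₂ τ p) : halfProd b m ((z - τ) / ω₁) ≠ 0 :=
  have h := thetaOdd_ne_zero_of_mem_puncturedCell h1 hω hb hp hz
  halfProd_ne_zero h.1 h.2

lemma differentiableAt_halfProd_div (h1 : ω₁ ≠ 0) (hω : ω₂ = ω₁ * (b * Complex.I))
    (hb : 0 < b) (hp : ∀ j, LatticeCongr ω₁ ω₂ (p j) (halfPeriod ω₁ ω₂ j + τ)) {m : Fin 3 → ℕ}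
    {z : ℂ} (hz : z ∈ puncturedCell ω₁ ω₂ τ p) :
    DifferentiableAt ℂ (fun z => halfProd b m ((z - τ) / ω₁)) z :=
  DifferentiableAt.fun_comp' z (differentiableAt_halfProd hb m
    (thetaOdd_ne_zero_of_mem_puncturedCell h1 hω hb hp hz).1)
    (analyticAt_sub_div z).differentiableAt

lemma isSqrtPotential_halfProd (h1 : ω₁ ≠ 0) (hω : ω₂ = ω₁ * (b * Complex.I)) (hb : 0 < b)
    (hp : ∀ j, LatticeCongr ω₁ ω₂ (p j) (halfPeriod ω₁ ω₂ j + τ)) {G : ℂ → ℝ} {n : ℕ}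
    {k m : Fin 3 → ℕ} {C : ℂ} (hC : ∀ z ∈ puncturedCell ω₁ ω₂ τ p,
      concPotential G τ n p k z = ‖C * halfProd b m ((z - τ) / ω₁)‖ ^ 2) :
    IsSqrtPotential ω₁ ω₂ G τ n p k fun z => C * halfProd b m ((z - τ) / ω₁) where
  meromorphic z _ := (MeromorphicAt.const C z).fun_mul
    ((meromorphicAt_halfProd hb m _).comp_analyticAt (analyticAt_sub_div z))
  differentiable _ hz :=
    ((differentiableAt_halfProd_div h1 hω hb hp hz).const_mul C).differentiableWithinAt
  normSq_eq _ hz := (hC _ hz).symm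

/-- The meromorphic square root of the concentration potential is unique up to a unimodular
factor. -/
lemma IsSqrtPotential.exists_eq_mul (h1 : ω₁ ≠ 0) (hω : ω₂ = ω₁ * (b * Complex.I)) (hb : 0 < b)
    (hp : ∀ j, LatticeCongr ω₁ ω₂ (p j) (halfPeriod ω₁ ω₂ j + τ)) {G : ℂ → ℝ} {n : ℕ}
    {k m : Fin 3 → ℕ} {C : ℂ} (hC0 : C ≠ 0) (hC : ∀ z ∈ puncturedCell ω₁ ω₂ τ p,
      concPotential G τ n p k z = ‖C * halfProd b m ((z - τ) / ω₁)‖ ^ 2) {H₀ : ℂ → ℂ}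
    (hH : IsSqrtPotential ω₁ ω₂ G τ n p k H₀) :
    ∃ u : ℂ, ‖u‖ = 1 ∧ ∀ z ∈ puncturedCell ω₁ ω₂ τ p,
      H₀ z = u * (C * halfProd b m ((z - τ) / ω₁)) := by
  have hne : ∀ z ∈ puncturedCell ω₁ ω₂ τ p, C * halfProd b m ((z - τ) / ω₁) ≠ 0 := fun z hz =>
    mul_ne_zero hC0 (halfProd_ne_zero_of_mem_puncturedCell h1 hω hb hp hz)
  have hnorm : ∀ z ∈ puncturedCell ω₁ ω₂ τ p,
      ‖H₀ z / (C * halfProd b m ((z - τ) / ω₁))‖ = 1 := fun z hz => by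
    have h := hH.normSq_eq z hz
    rw [hC z hz, pow_left_inj₀ (norm_nonneg _) (norm_nonneg _) two_ne_zero] at h
    rw [norm_div, h, div_self (norm_ne_zero_iff.2 (hne z hz))]
  rcases (puncturedCell ω₁ ω₂ τ p).eq_empty_or_nonempty with he | ⟨z₀, hz₀⟩
  · exact ⟨1, norm_one, by simp [he]⟩
  refine ⟨_, hnorm z₀ hz₀, fun z hz => ?_⟩
  have hd : DifferentiableOn ℂ (fun z => H₀ z / (C * halfProd b m ((z - τ) / ω₁)))
      (puncturedCell ω₁ ω₂ τ p) := fun w hw =>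
    (hH.differentiable w hw).fun_div
      ((differentiableAt_halfProd_div h1 hω hb hp hw).const_mul C).differentiableWithinAt
      (hne w hw)
  -- The quotient of two square roots is holomorphic of modulus one on a connected open set, hence
  -- constant by the maximum principle.
  have := Complex.eqOn_of_isPreconnected_of_isMaxOn_norm (isPreconnected_puncturedCell h1 hω hb)
    (isOpen_puncturedCell h1 hω hb) hd hz₀
    (fun w hw => by simp only [mem_ofPred_eq, Function.comp, hnorm w hw, hnorm z₀ hz₀, le_refl]) hz
  simp only [Function.const] at this
  rw [← this, div_mul_cancel₀ _ (hne z hz)]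

end SquareRoot

/-! ### Antiderivatives on the period cell. -/

section Antiderivative

variable {b : ℝ} {ω₁ ω₂ τ : ℂ} {p : Fin 3 → ℂ}

lemma isMeroAntideriv_div (h1 : ω₁ ≠ 0) (hω : ω₂ = ω₁ * (b * Complex.I)) (hb : 0 < b)
    (hτ : τ ∈ periodCell ω₁ ω₂)
    (hp : ∀ j, LatticeCongr ω₁ ω₂ (p j) (halfPeriod ω₁ ω₂ j + τ)) {m : Fin 3 → ℕ} {k : ℕ}
    {χ : ℂ → ℂ} (hχ : DifferentiableOn ℂ χ (doubleRect b))
    (hχd : ∀ x ∈ doubleRect b, x ≠ 0 → HasDerivAt (fun x => χ x / x ^ k) (halfProd b m x) x)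
    {w : ℂ} {H₀ : ℂ → ℂ}
    (hH : ∀ z ∈ puncturedCell ω₁ ω₂ τ p, H₀ z = w * halfProd b m ((z - τ) / ω₁)) :
    IsMeroAntideriv ω₁ ω₂ τ p H₀
      fun z => w * ω₁ * (χ ((z - τ) / ω₁) / ((z - τ) / ω₁) ^ k) where
  meromorphic z hz := by
    have hx := sub_div_mem_doubleRect h1 hω hb hτ hz
    have h2 := (analyticAt_sub_div (τ := τ) (ω₁ := ω₁) z)
    refine (MeromorphicAt.const _ z).fun_mul (MeromorphicAt.fun_div ?_
      (h2.meromorphicAt.fun_pow k))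
    have h3 : MeromorphicAt χ ((z - τ) / ω₁) :=
      (hχ.analyticAt (isOpen_doubleRect.mem_nhds hx)).meromorphicAt
    exact MeromorphicAt.comp_analyticAt (g := fun z => (z - τ) / ω₁) h3 h2
  hasDerivAt z hz := by
    have hx := sub_div_mem_doubleRect h1 hω hb hτ hz.1
    have hx0 : (z - τ) / ω₁ ≠ 0 := fun h => by
      have := (thetaOdd_ne_zero_of_mem_puncturedCell h1 hω hb hp hz).1
      exact this (h ▸ thetaOdd_zero hb)
    have h2 : HasDerivAt (fun z => (z - τ) / ω₁) (1 / ω₁) z :=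
      ((hasDerivAt_id z).sub_const τ).div_const ω₁
    have h3 := ((hχd _ hx hx0).comp z h2).const_mul (w * ω₁)
    have hval : w * halfProd b m ((z - τ) / ω₁) =
        w * ω₁ * (halfProd b m ((z - τ) / ω₁) * (1 / ω₁)) := by
      field_simp
    rw [hH z hz, hval]
    exact h3

lemma IsMeroAntideriv.exists_eq_add_const (h1 : ω₁ ≠ 0) (hω : ω₂ = ω₁ * (b * Complex.I))
    (hb : 0 < b) {H₀ F₁ F₂ : ℂ → ℂ} (hF₁ : IsMeroAntideriv ω₁ ω₂ τ p H₀ F₁)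
    (hF₂ : IsMeroAntideriv ω₁ ω₂ τ p H₀ F₂) :
    ∃ κ : ℂ, ∀ z ∈ puncturedCell ω₁ ω₂ τ p, F₁ z = F₂ z + κ := by
  have hd : ∀ z ∈ puncturedCell ω₁ ω₂ τ p, HasDerivAt (fun z => F₁ z - F₂ z) 0 z := fun z hz => by
    have h := (hF₁.hasDerivAt z hz).fun_sub (hF₂.hasDerivAt z hz)
    rwa [sub_self] at h
  obtain ⟨κ, hκ⟩ := (isOpen_puncturedCell h1 hω hb).exists_is_const_of_deriv_eq_zero
    (isPreconnected_puncturedCell h1 hω hb)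
    (fun z hz => (hd z hz).differentiableAt.differentiableWithinAt) fun z hz => (hd z hz).deriv
  exact ⟨κ, fun z hz => by rw [← hκ z hz]; ring⟩

/-- The zeros of an antiderivative with nonvanishing derivative form a null set. -/
lemma measure_zeros_eq_zero {U : Set ℂ} {F F' : ℂ → ℂ} (hF : ∀ z ∈ U, HasDerivAt F (F' z) z)
    (hF' : ∀ z ∈ U, F' z ≠ 0) : volume {z | z ∈ U ∧ F z = 0} = 0 := by
  refine measure_null_of_locally_null _ fun z hz => ⟨{z}, ?_, measure_singleton z⟩
  have h := eventually_nhdsWithin_iff.1 ((hF z hz.1).eventually_ne (c := 0) (hF' z hz.1))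
  rw [mem_nhdsWithin_iff_eventually]
  filter_upwards [h] with w hw hwz
  by_contra hne
  exact hw hne hwz.2

end Antiderivative

/-! ### The coefficient in terms of the quasi-periods. -/

section Coefficient

variable {b : ℝ} {ω₁ ω₂ τ : ℂ} {p : Fin 3 → ℂ}

/-- The translated antiderivative, in the normalised coordinate. -/
lemma isQuasiPeriodicPole_halfProd (hb : 0 < b) {m : Fin 3 → ℕ} {M : ℕ} {x₀ : ℂ}
    (hx₀ : x₀ ∈ cellRect b) {χ : ℂ → ℂ} (hχ : DifferentiableOn ℂ χ (doubleRect b)) (hχ0 : χ 0 ≠ 0)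
    (hχd : ∀ x ∈ doubleRect b, x ≠ 0 →
      HasDerivAt (fun x => χ x / x ^ (2 * M + 1)) (halfProd b m x) x) {E₁ E₂ : ℂ}
    (hE₁ : ∀ x ∈ doubleRect b, x + 1 ∈ doubleRect b →
      χ (x + 1) / (x + 1) ^ (2 * M + 1) - χ x / x ^ (2 * M + 1) = E₁)
    (hE₂ : ∀ x ∈ doubleRect b, x + b * Complex.I ∈ doubleRect b →
      χ (x + b * Complex.I) / (x + b * Complex.I) ^ (2 * M + 1) - χ x / x ^ (2 * M + 1) = E₂)
    {w : ℂ} (hw : w ≠ 0) (κ : ℂ) :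
    IsQuasiPeriodicPole b x₀ (2 * M)
      (fun x => w * (χ (x - x₀) / (x - x₀) ^ (2 * M + 1)) + κ)
      (fun x => w * halfProd b m (x - x₀)) (w * E₁) (w * E₂) where
  pos := hb
  mem := hx₀
  exists_numerator := by
    refine ⟨fun x => w * χ (x - x₀) + κ * (x - x₀) ^ (2 * M + 1), ?_, ?_, fun x _ hx => ?_⟩
    · have h1 : DifferentiableOn ℂ (fun x => χ (x - x₀)) ((· - x₀) ⁻¹' doubleRect b) :=
        hχ.fun_comp (differentiable_id.sub_const x₀).differentiableOn fun x hx => hx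
      have h2 : Differentiable ℂ fun x : ℂ => κ * (x - x₀) ^ (2 * M + 1) := by fun_prop
      exact (h1.const_mul w).fun_add h2.differentiableOn
    · simpa using ⟨hw, hχ0⟩
    · have := sub_ne_zero.2 hx
      field_simp
  hasDerivAt x hx hx0 :=
    (((hχd _ hx (sub_ne_zero.2 hx0)).comp_sub_const x x₀).const_mul w).add_const κ
  add_one x hx hx1 := by
    have h := hE₁ _ (sub_mem_doubleRect hx hx₀)
      (by rw [sub_add_eq_add_sub]; exact sub_mem_doubleRect hx1 hx₀)
    rw [sub_add_eq_add_sub] at h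
    rw [← h]; ring
  deriv_add_one x := by rw [← sub_add_eq_add_sub, halfProd_add_one]
  add_I_mul x hx hx1 := by
    have h := hE₂ _ (sub_mem_doubleRect hx hx₀)
      (by rw [sub_add_eq_add_sub]; exact sub_mem_doubleRect hx1 hx₀)
    rw [sub_add_eq_add_sub] at h
    rw [← h]; ring
  deriv_add_I_mul x := by rw [← sub_add_eq_add_sub, halfProd_add_I_mul hb]

lemma mem_outerDomain {F : ℂ → ℂ} {ρ : ℝ} {z : ℂ} :
    z ∈ outerDomain ω₁ ω₂ F ρ ↔ z ∈ periodCell ω₁ ω₂ ∧ ρ ≤ ‖F z‖⁻¹ := by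
  simp [outerDomain, sigmaZero]

/-- Up to a null set, the domain of integration is a sublevel set in the normalised coordinate. -/
lemma outerDomain_ae_eq (h1 : ω₁ ≠ 0) (hω : ω₂ = ω₁ * (b * Complex.I)) (hb : 0 < b)
    {F a H₀ : ℂ → ℂ} {ρ : ℝ} (hρ : 0 < ρ)
    (hF : ∀ z ∈ puncturedCell ω₁ ω₂ τ p, HasDerivAt F (H₀ z) z)
    (hH : ∀ z ∈ puncturedCell ω₁ ω₂ τ p, H₀ z ≠ 0)
    (ha : ∀ z ∈ puncturedCell ω₁ ω₂ τ p, F z = a (z / ω₁)) :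
    outerDomain ω₁ ω₂ F ρ =ᵐ[volume]
      (fun x => ω₁ * x) '' IsQuasiPeriodicPole.sublevel b (τ / ω₁) a (1 / ρ ^ 2) := by
  have hedge : volume ((fun x => ω₁ * x) '' (closedRect b \ cellRect b)) = 0 := by
    have := Measure.addHaar_image_continuousLinearMap volume (mulRealCLM ω₁)
      (closedRect b \ cellRect b)
    rw [volume_closedRect_sdiff, mul_zero] at this
    exact this
  have hvortex := (countable_periodCell_diff (ω₁ := ω₁) (ω₂ := ω₂) τ p).measure_zero volume
  -- At a zero of `F` the convention `0⁻¹ = 0` puts `sigmaZero F` at `0`, inside the ball, although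
  -- `‖F‖` is small there. Such points belong to the sublevel set but not to `outerDomain`; they
  -- form a null set.
  have hzeros := measure_zeros_eq_zero hF hH
  filter_upwards [compl_mem_ae_iff.2 hedge, compl_mem_ae_iff.2 hvortex,
    compl_mem_ae_iff.2 hzeros] with z hz1 hz2 hz3
  refine propext (?_ : z ∈ outerDomain ω₁ ω₂ F ρ ↔ z ∈ _ '' _)
  rw [mem_outerDomain]
  have key : z ∈ puncturedCell ω₁ ω₂ τ p → (ρ ≤ ‖F z‖⁻¹ ↔ ‖a (z / ω₁)‖ ^ 2 ≤ 1 / ρ ^ 2) := by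
    intro hz
    have hF0 : 0 < ‖F z‖ := norm_pos_iff.2 fun h0 => hz3 ⟨hz, h0⟩
    rw [← ha z hz, le_inv_comm₀ hρ hF0, ← one_div_pow, one_div,
      pow_le_pow_iff_left₀ hF0.le (inv_nonneg.2 hρ.le) two_ne_zero]
  constructor
  · rintro ⟨hz, hle⟩
    have hzp : z ∈ puncturedCell ω₁ ω₂ τ p := by_contra fun h => hz2 ⟨hz, h⟩
    refine ⟨z / ω₁, ⟨cellRect_subset_closedRect ((mem_periodCell h1 hω hb).1 hz), fun heq => ?_,
      (key hzp).1 hle⟩, mul_div_cancel₀ _ h1⟩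
    rw [div_left_inj' h1] at heq
    exact hzp.2.1 ⟨0, 0, by simp [heq]⟩
  · rintro ⟨x, ⟨hx, hx0, hle⟩, rfl⟩
    have hz : ω₁ * x ∈ periodCell ω₁ ω₂ := by
      rw [mul_mem_periodCell h1 hω hb]
      exact by_contra fun h => hz1 ⟨x, ⟨hx, h⟩, rfl⟩
    have hzp : ω₁ * x ∈ puncturedCell ω₁ ω₂ τ p := by_contra fun h => hz2 ⟨hz, h⟩
    refine ⟨hz, (key hzp).2 ?_⟩
    rwa [mul_div_cancel_left₀ _ h1]

/-- The coefficient as an area form evaluated at the quasi-periods. -/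
theorem eventually_coeffD₀_eq (h1 : ω₁ ≠ 0) (hω : ω₂ = ω₁ * (b * Complex.I)) (hb : 0 < b)
    (hp : ∀ j, LatticeCongr ω₁ ω₂ (p j) (halfPeriod ω₁ ω₂ j + τ)) {G : ℂ → ℝ} {M : ℕ}
    {k m : Fin 3 → ℕ} {w : ℂ} {a : ℂ → ℂ} {E₁ E₂ : ℂ} (hw : w ≠ 0)
    (hC : ∀ z ∈ puncturedCell ω₁ ω₂ τ p,
      concPotential G τ (2 * M) p k z = ‖w * halfProd b m ((z - τ) / ω₁)‖ ^ 2)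
    (ha : IsQuasiPeriodicPole b (τ / ω₁) (2 * M) a
      (fun x => w * ω₁ * halfProd b m (x - τ / ω₁)) E₁ E₂)
    {F : ℂ → ℂ} (hF : ∀ z ∈ puncturedCell ω₁ ω₂ τ p,
      HasDerivAt F (w * halfProd b m ((z - τ) / ω₁)) z)
    (hFa : ∀ z ∈ puncturedCell ω₁ ω₂ τ p, F z = a (z / ω₁)) :
    ∀ᶠ ρ in 𝓝[>] (0 : ℝ),
      IntegrableOn (concPotential G τ (2 * M) p k) (outerDomain ω₁ ω₂ F ρ) ∧
      coeffD₀ ω₁ ω₂ G τ (2 * M) p k F ρ = ((starRingEnd ℂ) E₁ * E₂).im / Real.pi := by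
  have hlim : Tendsto (fun ρ : ℝ => 1 / ρ ^ 2) (𝓝[>] 0) atTop := by
    have := (tendsto_pow_atTop (α := ℝ) two_ne_zero).comp tendsto_inv_nhdsGT_zero
    refine this.congr fun ρ => ?_
    simp
  filter_upwards [hlim.eventually ha.integral_sublevel, self_mem_nhdsWithin] with ρ hI hρ
  rw [mem_Ioi] at hρ
  set S := IsQuasiPeriodicPole.sublevel b (τ / ω₁) a (1 / ρ ^ 2)
  have hS : MeasurableSet S := ha.measurableSet_sublevel _
  set g : ℂ → ℝ := fun z => ‖w * halfProd b m ((z - τ) / ω₁)‖ ^ 2 with hg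
  have hdom : outerDomain ω₁ ω₂ F ρ =ᵐ[volume] (fun x => ω₁ * x) '' S :=
    outerDomain_ae_eq h1 hω hb hρ hF
      (fun z hz => mul_ne_zero hw (halfProd_ne_zero_of_mem_puncturedCell h1 hω hb hp hz)) hFa
  have hpot : concPotential G τ (2 * M) p k =ᵐ[volume.restrict (outerDomain ω₁ ω₂ F ρ)] g := by
    have hvortex := (countable_periodCell_diff (ω₁ := ω₁) (ω₂ := ω₂) τ p).measure_zero volume
    have hsub : ∀ᵐ z ∂volume.restrict (periodCell ω₁ ω₂), concPotential G τ (2 * M) p k z = g z := by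
      rw [ae_restrict_iff' (isOpen_periodCell h1 hω hb).measurableSet]
      filter_upwards [compl_mem_ae_iff.2 hvortex] with z hz hzc
      exact hC z (by_contra fun h => hz ⟨hzc, h⟩)
    exact ae_restrict_of_ae_restrict_of_subset sdiff_subset hsub
  have hga : ∀ x, g (ω₁ * x) = (‖ω₁‖ ^ 2)⁻¹ * ‖w * ω₁ * halfProd b m (x - τ / ω₁)‖ ^ 2 := fun x => by
    have : (ω₁ * x - τ) / ω₁ = x - τ / ω₁ := by rw [sub_div, mul_div_cancel_left₀ _ h1]
    have hn : ‖ω₁‖ ≠ 0 := norm_ne_zero_iff.2 h1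
    simp only [hg, this, norm_mul]
    field_simp
  have hint : IntegrableOn g ((fun x => ω₁ * x) '' S) := by
    rw [integrableOn_mul_image h1 hS]
    simp only [hga]
    exact (ha.integrableOn_sublevel _).const_mul _
  refine ⟨((hint.congr_set_ae hdom).congr hpot.symm), ?_⟩
  have hn : ‖ω₁‖ ^ 2 ≠ 0 := pow_ne_zero 2 (norm_ne_zero_iff.2 h1)
  rw [coeffD₀, integral_congr_ae hpot, setIntegral_congr_set hdom, setIntegral_mul_image h1 hS]
  simp only [hga]
  -- The divergent terms are now both `π (2M + 1) / ρ ^ 2`, since the pole order `N + 1` of the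
  -- antiderivative equals `n + 1`. They cancel, leaving a value free of `ρ`.
  rw [integral_const_mul, mul_inv_cancel_left₀ hn, hI, integral_compl_ball_norm_pow hρ]
  push_cast
  field_simp
  ring

end Coefficient

/-! ### The sign of the coefficient and the conclusion. -/

lemma im_conj_mul_quasiPeriods (w : ℂ) (I₁ I₂ : ℝ) (m₀ m₁ m₂ : ℕ) :
    ((starRingEnd ℂ) (w * ((-1) ^ (m₀ + m₁ + m₂) * I₁)) *
      (w * ((-1) ^ (m₀ + m₁) * I₂ * Complex.I))).im = ‖w‖ ^ 2 * ((-1) ^ m₂ * (I₁ * I₂)) := by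
  -- Both quasi-periods carry the sign `(-1) ^ (m₀ + m₁)`, so it squares away and only `(-1) ^ m₂`
  -- survives.
  have hs : ((-1 : ℂ) ^ (m₀ + m₁)) ^ 2 = 1 := by rw [← pow_mul, mul_comm, pow_mul]; simp
  have : (starRingEnd ℂ) (w * ((-1) ^ (m₀ + m₁ + m₂) * I₁)) *
      (w * ((-1) ^ (m₀ + m₁) * I₂ * Complex.I)) =
      ((‖w‖ ^ 2 * ((-1) ^ m₂ * (I₁ * I₂)) : ℝ) : ℂ) * Complex.I := by
    push_cast
    rw [← Complex.conj_mul' w]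
    simp only [map_mul, map_pow, map_neg, map_one, Complex.conj_ofReal, pow_add _ (m₀ + m₁)]
    linear_combination ((starRingEnd ℂ) w * w * (-1) ^ m₂ * I₁ * I₂ * Complex.I) * hs
  rw [this, Complex.im_ofReal_mul, Complex.I_im, mul_one]

theorem mainTheorem4 (ω₁ ω₂ : ℂ) (hpos : 0 < (ω₂ / ω₁).im) (hrect : (ω₂ / ω₁).re = 0)
    (n n₁ n₂ n₃ : ℕ) (hn : Even n) (hn₁ : Even n₁) (hn₂ : Even n₂) (hn₃ : Even n₃)
    (hbal : n₁ / 2 + n₂ / 2 + n₃ / 2 = n / 2 + 1) :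
    (∃ G : ℂ → ℝ, IsTorusGreen ω₁ ω₂ G) ∧
    ∀ G : ℂ → ℝ, IsTorusGreen ω₁ ω₂ G →
      ∃ D₀ : ℝ,
        (Odd (n₃ / 2) → D₀ < 0) ∧ (Even (n₃ / 2) → 0 < D₀) ∧
        ∀ τ ∈ periodCell ω₁ ω₂, ∀ p : Fin 3 → ℂ,
          (∀ j, LatticeCongr ω₁ ω₂ (p j) (halfPeriod ω₁ ω₂ j + τ)) →
          (∃ H₀ : ℂ → ℂ, IsSqrtPotential ω₁ ω₂ G τ n p ![n₁, n₂, n₃] H₀) ∧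
          ∀ H₀ : ℂ → ℂ, IsSqrtPotential ω₁ ω₂ G τ n p ![n₁, n₂, n₃] H₀ →
            (∃ F : ℂ → ℂ, IsMeroAntideriv ω₁ ω₂ τ p H₀ F) ∧
            ∀ F : ℂ → ℂ, IsMeroAntideriv ω₁ ω₂ τ p H₀ F →
              ∀ᶠ ρ in 𝓝[>] (0 : ℝ),
                IntegrableOn (concPotential G τ n p ![n₁, n₂, n₃])
                  (outerDomain ω₁ ω₂ F ρ) ∧
                coeffD₀ ω₁ ω₂ G τ n p ![n₁, n₂, n₃] F ρ = D₀ := by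
  have h1 : ω₁ ≠ 0 := by rintro rfl; simp at hpos
  obtain ⟨b, hb, hω⟩ : ∃ b : ℝ, 0 < b ∧ ω₂ = ω₁ * (b * Complex.I) := by
    refine ⟨_, hpos, ?_⟩
    rw [mul_comm, ← div_eq_iff h1]
    exact Complex.ext (by simp [hrect]) (by simp)
  obtain ⟨M, rfl⟩ := even_iff_exists_two_mul.1 hn
  obtain ⟨m₁, rfl⟩ := even_iff_exists_two_mul.1 hn₁
  obtain ⟨m₂, rfl⟩ := even_iff_exists_two_mul.1 hn₂
  obtain ⟨m₃, rfl⟩ := even_iff_exists_two_mul.1 hn₃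
  have hmul : ![2 * m₁, 2 * m₂, 2 * m₃] = fun j => 2 * ![m₁, m₂, m₃] j := by
    ext j; fin_cases j <;> rfl
  simp only [Nat.mul_div_cancel_left _ two_pos] at hbal ⊢
  rw [hmul]
  set m : Fin 3 → ℕ := ![m₁, m₂, m₃] with hm
  have hsum : ∑ j, m j = M + 1 := by rw [Fin.sum_univ_three]; exact hbal
  obtain ⟨c, hc⟩ := exists_isTorusGreen h1 hω hb
  refine ⟨⟨_, hc⟩, fun G hG => ?_⟩
  obtain ⟨C, hC0, hC⟩ := exists_concPotential_eq h1 hω hb hG (n := 2 * M) (m := m) (by omega)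
  obtain ⟨χ, hχ, hχ0, hχd⟩ := exists_antideriv_halfProd hb hsum
  obtain ⟨I₁, I₂, hI₁, hI₂, hE₁, hE₂⟩ := exists_quasiPeriods hb m hχd
  have hC0' : (C : ℂ) ≠ 0 := Complex.ofReal_ne_zero.2 hC0.ne'
  have hscale : 0 < (C * ‖ω₁‖) ^ 2 := by positivity
  -- All ingredients are fixed before `τ`, `p`, `H₀` and `F` enter, which is the asserted
  -- independence.
  refine ⟨(C * ‖ω₁‖) ^ 2 * ((-1) ^ m₃ * (I₁ * I₂)) / Real.pi, fun hodd => ?_, fun heven => ?_,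
    fun τ hτ p hp => ⟨⟨_, isSqrtPotential_halfProd h1 hω hb hp (hC τ p hp)⟩, fun H₀ hH => ?_⟩⟩
  · rw [hodd.neg_one_pow, neg_one_mul, mul_neg, neg_div, neg_lt_zero]
    positivity
  · rw [heven.neg_one_pow]
    positivity
  -- The freedom in `H₀` is a unimodular factor `u`, in `F` an additive constant `κ`. The first
  -- rotates both quasi-periods alike, the second does not affect them, so `Im(conj E₁ * E₂)` is
  -- unchanged.
  obtain ⟨u, hu, hHu⟩ := hH.exists_eq_mul h1 hω hb hp hC0' (hC τ p hp)
  have hu0 : u ≠ 0 := norm_ne_zero_iff.1 (by rw [hu]; exact one_ne_zero)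
  simp only [← mul_assoc] at hHu
  have hF₀ := isMeroAntideriv_div h1 hω hb hτ hp hχ hχd hHu
  refine ⟨⟨_, hF₀⟩, fun F hF => ?_⟩
  obtain ⟨κ, hκ⟩ := hF.exists_eq_add_const h1 hω hb hF₀
  have hpole := isQuasiPeriodicPole_halfProd hb ((mem_periodCell h1 hω hb).1 hτ) hχ hχ0 hχd hE₁ hE₂
    (mul_ne_zero (mul_ne_zero hu0 hC0') h1) κ
  have hcoeff := eventually_coeffD₀_eq h1 hω hb hp (k := fun j => 2 * m j) (G := G)
    (mul_ne_zero hu0 hC0')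
    (fun z hz => by rw [hC τ p hp z hz, mul_assoc u, norm_mul u, hu, one_mul]) hpole
    (fun z hz => hHu z hz ▸ hF.hasDerivAt z hz) (fun z hz => by rw [hκ z hz, sub_div])
  rw [im_conj_mul_quasiPeriods, norm_mul, norm_mul, hu, one_mul, Complex.norm_real,
    Real.norm_of_nonneg hC0.le] at hcoeff
  exact hcoeff
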